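/- Consider a network with $N$ tiers of base stations (BSs) and $M$ files. The BSs of tier $l$ form a homogeneous Poisson point process $\Phi_l$ of density $\lambda_l>0$ in the plane and have transmit power $S_l>0$. Each BS of tier $l$ caches file $j$ with probability $p_{lj}\in[0,1]$. The fading coefficients between the typical user, located at the origin, and the BSs have law $\mathcal{CN}(0,1)$. The user requests file $j$ with probability $t_j$, $\sum_j t_j=1$. The point processes of the tiers, the caches of the BSs, the fading coefficients and the request are mutually independent (the caching events of different files at one and the same BS may be dependent). Let $\beta>2$ be the path loss exponent, $\sigma^2\ge 0$ the noise variance and $\tau>0$ the SINR threshold. Let $r_{l|j}$ be the distance from the user to the nearest BS of tier $l$ that caches file $j$ ($\infty$ if there is none). For file $j$ the user is associated with tier $i$ if $r_{i|j}<\infty$ and $S_i r_{i|j}^{-\beta}>S_l r_{l|j}^{-\beta}$ for all $l\ne i$; let $\mathcal W_{i|j}$ be the probability of this event. In that case it is served by the nearest BS $n_{io}$ of tier $i$ that caches $j$, at distance $R_{i|j}=r_{i|j}$, and $$\mathrm{SINR}_{i|j}=\frac{S_i|h_{i,o}|^2R_{i|j}^{-\beta}}{\sigma^2+\sum_{l=1}^N\sum_{k\in\Phi_l\setminus\{n_{io}\}}S_l|h_{l,k}|^2d_{l,k}^{-\beta}},$$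 where $h_{i,o}$ is the fading coefficient of the serving BS, $h_{l,k}$ and $d_{l,k}$ are the fading coefficient and the distance to the user of the $k$-th BS of tier $l$, and the interference comes from all other BSs, whether or not they cache $j$. Let $\mathcal C_{i|j}=\mathbb E_{R_{i|j}}\big[\mathbb P[\mathrm{SINR}_{i|j}>\tau\mid R_{i|j}]\big]$, all probabilities being conditional on association with tier $i$ for file $j$, and $\mathcal C=\sum_{j=1}^M\sum_{i=1}^N t_j\mathcal W_{i|j}\mathcal C_{i|j}$ (terms with $p_{ij}=0$ being $0$). Put $$H(\tau,\beta)=\frac{2\tau}{\beta-2}\,{}_2F_1\Big(1,1-\tfrac2\beta;2-\tfrac2\beta;-\tau\Big),\qquad D(\tau,\beta)=\tfrac2\beta\,\tau^{2/\beta}B\Big(\tfrac2\beta,1-\tfrac2\beta\Big),$$ where ${}_2F_1$ is the Gauss hypergeometric function (the hypergeometric series, continued analytically to $(-\infty,1)$) and $B(x,y)=\int_0^1\mu^{x-1}(1-\mu)^{y-1}\,d\mu$. Then, for every file $j$ and tier $i$ with $p_{ij}>0$, $$\mathcal W_{i|j}=\frac{\lambda_ip_{ij}S_i^{2/\beta}}{\sum_{l=1}^N\lambda_lp_{lj}S_l^{2/\beta}},\qquad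 \mathcal C_{i|j}=\frac{2\pi p_{ij}\lambda_i}{\mathcal W_{i|j}}\,J_{ij},$$ where the integral $J_{ij}$ converges and is $$J_{ij}=\int_0^\infty r\exp\Big(-\frac{\tau r^\beta\sigma^2}{S_i}\Big)\exp\Big(-\pi\sum_{l=1}^N\lambda_l\Big(\frac{S_l}{S_i}\Big)^{2/\beta}\big(p_{lj}H(\tau,\beta)+(1-p_{lj})D(\tau,\beta)+p_{lj}\big)r^2\Big)\,dr,$$ and $\mathcal W_{i|j}=0$ if $p_{ij}=0$. Moreover, $\mathcal C=\sum_{j=1}^M\sum_{i=1}^N2\pi p_{ij}t_j\lambda_i\,J_{ij}$, and $\mathcal C$ is the probability that the requested file is successfully delivered, i.e. that the user is associated, for the file it requests, with some tier and the corresponding SINR exceeds $\tau$. -/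

import Mathlib

open MeasureTheory ProbabilityTheory Set Filter Topology
open scoped ENNReal NNReal

noncomputable section

/-! ### Special functions -/

/-- `F` is a Gauss hypergeometric function `₂F₁(a, b; c; ·)` on the real half-line `(-∞, 1)`:
it is real-analytic there, and near `0` it is the sum of the hypergeometric series. (The series
itself, which is Mathlib's `₂F₁`, converges only for `|x| < 1`.) -/
structure IsGaussHypergeometric (a b c : ℝ) (F : ℝ → ℝ) : Prop where
  analytic : AnalyticOnNhd ℝ F (Iio 1)
  series : ∀ᶠ x in 𝓝 0, F x = ₂F₁ a b c x

/-- The continuation of the hypergeometric series to `(-∞, 1)` is unique. -/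
theorem IsGaussHypergeometric.eqOn {a b c : ℝ} {F G : ℝ → ℝ} (hF : IsGaussHypergeometric a b c F)
    (hG : IsGaussHypergeometric a b c G) : EqOn F G (Iio 1) := by
  refine hF.analytic.eqOn_of_preconnected_of_eventuallyEq hG.analytic isPreconnected_Iio
    (z₀ := 0) (by simp) ?_
  filter_upwards [hF.series, hG.series] with x h1 h2
  rw [h1, h2]

/-- The Gauss hypergeometric function `₂F₁(a, b; c; x)` for real `x < 1`, as the analytic
continuation of the hypergeometric series. -/
def gaussHypergeometric (a b c : ℝ) : ℝ → ℝ := Classical.epsilon (IsGaussHypergeometric a b c)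

/-- The Beta function `B(x, y) = ∫₀¹ μ^(x-1) (1-μ)^(y-1) dμ`. -/
def betaFunction (x y : ℝ) : ℝ := ∫ μ in (0 : ℝ)..1, μ ^ (x - 1) * (1 - μ) ^ (y - 1)

/-- `H(τ, β) = 2τ/(β-2) ₂F₁(1, 1-2/β; 2-2/β; -τ)`. -/
def coefH (τ β : ℝ) : ℝ :=
  2 * τ / (β - 2) * gaussHypergeometric 1 (1 - 2 / β) (2 - 2 / β) (-τ)

/-- `D(τ, β) = (2/β) τ^(2/β) B(2/β, 1-2/β)`. -/
def coefD (τ β : ℝ) : ℝ := 2 / β * τ ^ (2 / β) * betaFunction (2 / β) (1 - 2 / β)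

/-! ### The probabilistic model -/

/-- The Euclidean plane. -/
abbrev Plane : Type := EuclideanSpace ℝ (Fin 2)

/-- The number of points of the sequence `X` that lie in `B`. -/
def pointCount {Ω : Type*} (X : ℕ → Ω → Plane) (B : Set Plane) (ω : Ω) : ℕ∞ :=
  {k : ℕ | X k ω ∈ B}.encard

/-- The random points `X 0, X 1, …` of the plane form a homogeneous Poisson point process of
density `lam > 0` (such a process has almost surely infinitely many points): the number of points
in a Borel set of finite area is Poisson with mean `lam * area`, and the numbers of points in
disjoint Borel sets are independent. -/
structure IsHomogeneousPPP {Ω : Type*} [MeasurableSpace Ω] (P : Measure Ω) (lam : ℝ)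
    (X : ℕ → Ω → Plane) : Prop where
  lam_pos : 0 < lam
  measurable : ∀ k, Measurable (X k)
  count_law : ∀ B : Set Plane, MeasurableSet B → volume B ≠ ∞ → ∀ n : ℕ,
    P {ω | pointCount X B ω = n} = poissonMeasure (lam.toNNReal * (volume B).toNNReal) {n}
  count_indep : ∀ (n : ℕ) (B : Fin n → Set Plane), (∀ a, MeasurableSet (B a)) →
    (∀ a, volume (B a) ≠ ∞) → Pairwise (fun a b => Disjoint (B a) (B b)) →
    iIndepFun (fun a => pointCount X (B a)) P

/-- The circularly symmetric complex Gaussian law `CN(0, 1)`: the real and the imaginary part are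
independent centred Gaussians of variance `1/2`. -/
def stdComplexGaussian : Measure ℂ :=
  ((gaussianReal 0 (1 / 2)).prod (gaussianReal 0 (1 / 2))).map (fun z : ℝ × ℝ => ⟨z.1, z.2⟩)

/-- A cache-enabled heterogeneous network with `N` tiers and `M` files, seen from a typical user
at the origin. The base stations (BSs) of each tier are numbered by `ℕ`. The law of the set of
files stored in a BS is only constrained through the caching probability of each file, so the
caching events of different files at one BS may depend on each other (as they do when the cache
has a limited size). -/
structure HetNet (N M : ℕ) {Ω : Type*} [MeasurableSpace Ω] (P : Measure Ω) where
  /-- BS density of each tier -/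
  lam : Fin N → ℝ
  /-- transmit power of each tier -/
  S : Fin N → ℝ
  /-- caching probability of each file in each tier -/
  p : Fin N → Fin M → ℝ
  /-- popularity of each file -/
  t : Fin M → ℝ
  /-- path loss exponent -/
  β : ℝ
  /-- standard deviation of the noise -/
  σ : ℝ
  /-- SINR threshold -/
  τ : ℝ
  /-- location of the `k`-th BS of tier `l` -/
  X : Fin N → ℕ → Ω → Plane
  /-- files stored in the `k`-th BS of tier `l` -/
  cache : Fin N → ℕ → Ω → Set (Fin M)
  /-- fading coefficient between the user and the `k`-th BS of tier `l` -/
  h : Fin N → ℕ → Ω → ℂ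
  /-- file requested by the user -/
  req : Ω → Fin M
  S_pos : ∀ l, 0 < S l
  two_lt_β : 2 < β
  τ_pos : 0 < τ
  ppp : ∀ l, IsHomogeneousPPP P (lam l) (X l)
  measurable_cache : ∀ l k, Measurable (cache l k)
  measurable_h : ∀ l k, Measurable (h l k)
  measurable_req : Measurable req
  cache_prob : ∀ l k j, P.real {ω | j ∈ cache l k ω} = p l j
  fading_law : ∀ l k, P.map (h l k) = stdComplexGaussian
  req_prob : ∀ j, P.real {ω | req ω = j} = t j
  /-- The point processes of the tiers, the caches of the BSs, the fading coefficients and the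
  request are mutually independent. -/
  indep : iIndep (Sum.elim (fun l : Fin N =>
      MeasurableSpace.comap (fun ω k => X l k ω) inferInstance)
    (Sum.elim (fun a : Fin N × ℕ => MeasurableSpace.comap (cache a.1 a.2) inferInstance)
      (Sum.elim (fun a : Fin N × ℕ => MeasurableSpace.comap (h a.1 a.2) inferInstance)
        (fun _ : Unit => MeasurableSpace.comap req inferInstance)))) P

namespace HetNet

variable {N M : ℕ} {Ω : Type*} [MeasurableSpace Ω] {P : Measure Ω} (𝓗 : HetNet N M P)

/-- `r_{l|j}`: the distance from the user to the nearest BS of tier `l` that caches file `j`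
(`∞` if there is none). -/
def dist (l : Fin N) (j : Fin M) (ω : Ω) : ℝ≥0∞ :=
  ⨅ (k : ℕ) (_ : j ∈ 𝓗.cache l k ω), ‖𝓗.X l k ω‖ₑ

/-- The user that requests file `j` is associated with tier `i`: some BS of tier `i` caches `j`,
and the average power `S_i r_{i|j}^(-β)` received from the nearest one exceeds the corresponding
power of every other tier. -/
def assoc (i : Fin N) (j : Fin M) : Set Ω :=
  {ω | (∃ k, j ∈ 𝓗.cache i k ω) ∧ ∀ l, l ≠ i →
    ENNReal.ofReal (𝓗.S l) * 𝓗.dist l j ω ^ (-𝓗.β) <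
      ENNReal.ofReal (𝓗.S i) * 𝓗.dist i j ω ^ (-𝓗.β)}

/-- `W_{i|j}`: the probability of association with tier `i` for file `j`. -/
def assocProb (i : Fin N) (j : Fin M) : ℝ := P.real (𝓗.assoc i j)

/-- The number of the serving BS: the nearest BS of tier `i` that caches file `j`. -/
def serving (i : Fin N) (j : Fin M) (ω : Ω) : ℕ :=
  sInf {k | j ∈ 𝓗.cache i k ω ∧ ‖𝓗.X i k ω‖ₑ = 𝓗.dist i j ω}

open Classical in
/-- The interference from tier `l` when the user is served by tier `i` with file `j`: the total
power received from all the BSs of tier `l` (whether or not they cache `j`) other than the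
serving BS. -/
def interference (i : Fin N) (j : Fin M) (l : Fin N) (ω : Ω) : ℝ≥0∞ :=
  ∑' k : ℕ, if l = i ∧ k = 𝓗.serving i j ω then 0 else
    ENNReal.ofReal (𝓗.S l) * ‖𝓗.h l k ω‖ₑ ^ 2 * ‖𝓗.X l k ω‖ₑ ^ (-𝓗.β)

/-- `SINR_{i|j}`: the signal-to-interference-plus-noise ratio of the user that requests file `j`
and is associated with tier `i`. -/
def sinr (i : Fin N) (j : Fin M) (ω : Ω) : ℝ≥0∞ :=
  ENNReal.ofReal (𝓗.S i) * ‖𝓗.h i (𝓗.serving i j ω) ω‖ₑ ^ 2 * 𝓗.dist i j ω ^ (-𝓗.β) /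
    (ENNReal.ofReal (𝓗.σ ^ 2) + ∑ l, 𝓗.interference i j l ω)

/-- The event `SINR_{i|j} > τ`. -/
def success (i : Fin N) (j : Fin M) : Set Ω := {ω | ENNReal.ofReal 𝓗.τ < 𝓗.sinr i j ω}

/-- `C_{i|j} = E_R[P[SINR_{i|j} > τ | R]]`: the successful delivery probability of file `j` from
tier `i`. Probabilities are conditional on the association with tier `i`, and `R = R_{i|j}` is the
distance from the user to its serving BS. -/
def sdp (i : Fin N) (j : Fin M) : ℝ :=
  ∫ ω, (condExp (MeasurableSpace.comap (𝓗.dist i j) inferInstance) (cond P (𝓗.assoc i j))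
    ((𝓗.success i j).indicator (fun _ => (1 : ℝ)))) ω ∂(cond P (𝓗.assoc i j))

/-- `C = ∑_j ∑_i t_j W_{i|j} C_{i|j}`: the average successful delivery probability. -/
def averageSDP : ℝ := ∑ j, ∑ i, 𝓗.t j * 𝓗.assocProb i j * 𝓗.sdp i j

/-- The event that the file requested by the user is successfully delivered to it from the tier
it is associated with. -/
def delivered : Set Ω := {ω | ∃ i, ω ∈ 𝓗.assoc i (𝓗.req ω) ∧ ω ∈ 𝓗.success i (𝓗.req ω)}

/-- The integrand in the formula for `C_{i|j}`. -/
def integrand (i : Fin N) (j : Fin M) (r : ℝ) : ℝ :=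
  r * Real.exp (-(𝓗.τ * r ^ 𝓗.β * 𝓗.σ ^ 2 / 𝓗.S i)) *
    Real.exp (-Real.pi * (∑ l, 𝓗.lam l * (𝓗.S l / 𝓗.S i) ^ (2 / 𝓗.β) *
      (𝓗.p l j * coefH 𝓗.τ 𝓗.β + (1 - 𝓗.p l j) * coefD 𝓗.τ 𝓗.β + 𝓗.p l j)) * r ^ 2)

end HetNet

end

/-!
The distance `r` from the user to its serving station has a density, and for each `r` the success
probability given this distance is explicit, because every constraint on the other stations is
multiplicative over stations.

Fix a tier `i`, a file `j` and a threshold `θ`. A station of tier `i` at distance `r` serves the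
user successfully if it stores `j`, if no other station that stores `j` is preferred to it, and if
`|h|² > θ r^β / S_i * (σ² + I)`, with `I` the interference from all the other stations. Since
`|h|²` is exponentially distributed, the last event has probability `e^(-θ r^β (σ² + I) / S_i)`
given everything else. A forbidden station can be given the weight `∞` in the same exponent, with
`e^(-∞) = 0`, so association and interference are treated together: for fixed positions the
probability of the whole event is a product over the stations (`HetNet.measure_load_lt`), a station
of tier `l` at `x` contributing the factor `(1 - p_lj or 1) / (1 + w(x))`. The Laplace functional of
the Poisson process (`IsHomogeneousPPP.lintegral_mul_expNeg_tsum`) averages this product over the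
positions and gives `exp (-λ_l ∫ (1 - factor))` for each tier. In polar coordinates the integral is
`π (S_l / S_i)^(2/β) r²` times the number `areaCoef p_lj θ β`.

No Palm calculus is needed to treat the serving station itself. For a thin annulus
`a ≤ |x| < b` a *candidate* is a station of tier `i` in the annulus that meets the constraints
with the other stations of tier `i` in the annulus ignored. The serving station, when it lies in
the annulus, is a candidate with constraints at radius `a`, and a candidate at radius `b` that is
alone in the annulus is the serving station
(`HetNet.exists_candidate_of_served`, `HetNet.served_of_candidate`). As the
count in the annulus is independent of the process outside of it, the mean number of candidates is a
product (`HetNet.tsum_measure_candidate`). This squeezes the right derivative of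
`R ↦ P(served from a distance less than R)`, and the fundamental theorem of calculus yields
`P(served) = 2π p_ij λ_i ∫ r * servedProb r dr` (`HetNet.measureReal_served`).

The threshold `θ = 0` gives the association probability, since `areaCoef p 0 β = p` makes the
integrand Gaussian. At `θ = τ` one has `areaCoef p τ β = p H + (1 - p) D + p` (`areaCoef_eq`): the
integral over the whole plane is a Beta integral, and the part outside of the unit disc is Euler's
integral for `₂F₁(1, b; b + 1; -τ)` with `b = 1 - 2/β`, which is analytic on `(-∞, 1)` and agrees
with the hypergeometric series near `0`. The expectation of a conditional probability is the
probability itself, and the average over files and tiers is the probability of a disjoint union by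
independence of the request.
-/

noncomputable section

/-! ### The function `e^(-x)` on `[0, ∞]` -/

/-- The function `x ↦ e^(-x)` on `[0, ∞]`, with `e^(-∞) = 0`. -/
def expNeg (x : ℝ≥0∞) : ℝ≥0∞ := EReal.exp (-(x : EReal))

@[simp] lemma expNeg_zero : expNeg 0 = 1 := by simp [expNeg]

@[simp] lemma expNeg_top : expNeg ∞ = 0 := by simp [expNeg]

lemma expNeg_add (x y : ℝ≥0∞) : expNeg (x + y) = expNeg x * expNeg y := by
  rw [expNeg, expNeg, expNeg, ← EReal.exp_add, EReal.coe_ennreal_add, EReal.neg_add, sub_eq_add_neg]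
  · exact Or.inl (EReal.coe_ennreal_ne_bot _)
  · exact Or.inr (EReal.coe_ennreal_ne_bot _)

lemma expNeg_antitone : Antitone expNeg := fun x y h => by
  unfold expNeg
  exact EReal.exp_monotone (EReal.neg_le_neg_iff.2 (by exact_mod_cast h))

lemma expNeg_le_one (x : ℝ≥0∞) : expNeg x ≤ 1 := by
  simpa using expNeg_antitone (zero_le (a := x))

lemma expNeg_ne_top (x : ℝ≥0∞) : expNeg x ≠ ∞ :=
  ((expNeg_le_one x).trans_lt ENNReal.one_lt_top).ne

lemma continuous_expNeg : Continuous expNeg :=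
  ENNReal.continuous_exp.comp (continuous_neg.comp continuous_coe_ennreal_ereal)

@[fun_prop] lemma measurable_expNeg : Measurable expNeg := continuous_expNeg.measurable

lemma expNeg_ofReal {x : ℝ} (hx : 0 ≤ x) :
    expNeg (ENNReal.ofReal x) = ENNReal.ofReal (Real.exp (-x)) := by
  rw [expNeg, EReal.coe_ennreal_ofReal, max_eq_left hx, ← EReal.coe_neg, EReal.exp_coe]

lemma expNeg_sum {κ : Type*} (s : Finset κ) (f : κ → ℝ≥0∞) :
    expNeg (∑ a ∈ s, f a) = ∏ a ∈ s, expNeg (f a) := by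
  classical
  induction s using Finset.induction_on with
  | empty => simp
  | insert a s ha ih => rw [Finset.sum_insert ha, Finset.prod_insert ha, expNeg_add, ih]

lemma expNeg_nat_mul (n : ℕ) (x : ℝ≥0∞) : expNeg (n * x) = expNeg x ^ n := by
  simpa [nsmul_eq_mul] using expNeg_sum (Finset.range n) (fun _ => x)

/-- The inverse of `expNeg` on `[0, 1]`. -/
def negLog (g : ℝ≥0∞) : ℝ≥0∞ := (-(ENNReal.log g)).toENNReal

lemma expNeg_negLog {g : ℝ≥0∞} (hg : g ≤ 1) : expNeg (negLog g) = g := by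
  have h : 0 ≤ -(ENNReal.log g) := by
    rw [EReal.le_neg, neg_zero]
    simpa using ENNReal.log_monotone hg
  rw [expNeg, negLog, EReal.coe_toENNReal h, neg_neg, ENNReal.exp_log]

@[fun_prop] lemma measurable_negLog : Measurable negLog :=
  measurable_ereal_toENNReal.comp (continuous_neg.measurable.comp ENNReal.measurable_log)

/-- For countably many independent `[0, ∞]`-valued variables the Laplace transform of the (possibly
infinite) sum is the product of the Laplace transforms. -/
lemma lintegral_expNeg_tsum {Ω κ : Type*} [MeasurableSpace Ω] {μ : Measure Ω}
    [IsProbabilityMeasure μ] [Countable κ] {W : κ → Ω → ℝ≥0∞} (hW : ∀ b, Measurable (W b))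
    (hind : iIndepFun W μ) {w : κ → ℝ≥0∞} (h : ∀ b, ∫⁻ ω, expNeg (W b ω) ∂μ = expNeg (w b)) :
    ∫⁻ ω, expNeg (∑' b, W b ω) ∂μ = expNeg (∑' b, w b) := by
  have h1 : Tendsto (fun s : Finset κ => ∫⁻ ω, expNeg (∑ b ∈ s, W b ω) ∂μ) atTop
      (𝓝 (∫⁻ ω, expNeg (∑' b, W b ω) ∂μ)) := by
    refine tendsto_lintegral_filter_of_dominated_convergence (fun _ => 1) ?_ ?_ (by simp) ?_
    · exact Eventually.of_forall fun s =>
        measurable_expNeg.comp (Finset.measurable_sum _ fun b _ => hW b)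
    · exact Eventually.of_forall fun s => ae_of_all _ fun ω => expNeg_le_one _
    · exact ae_of_all _ fun ω => (continuous_expNeg.tendsto _).comp ENNReal.summable.hasSum
  have h2 : Tendsto (fun s : Finset κ => expNeg (∑ b ∈ s, w b)) atTop (𝓝 (expNeg (∑' b, w b))) :=
    (continuous_expNeg.tendsto _).comp ENNReal.summable.hasSum
  refine tendsto_nhds_unique h1 (h2.congr fun s => ?_)
  simp_rw [expNeg_sum]
  rw [lintegral_prod_eq_prod_lintegral_of_indepFun s (fun b ω => expNeg (W b ω))]
  · simp_rw [h]
  · exact hind.comp (fun _ => expNeg) fun _ => measurable_expNeg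
  · exact fun b => measurable_expNeg.comp (hW b)

/-! ### The Gauss hypergeometric function as an Euler integral -/

section

variable {b : ℝ}

/-- The Cauchy transform of the measure `t ^ (b - 1) dt` on `(0, 1]`. -/
def eulerTransform (b : ℝ) (z : ℂ) : ℂ :=
  ∫ t in Ioc (0 : ℝ) 1, ((t ^ (b - 1) : ℝ) : ℂ) * (1 - z * t)⁻¹

lemma le_norm_one_sub_mul {z : ℂ} {t c : ℝ} (ht : t ∈ Ioc (0 : ℝ) 1) (hc : c ≤ 1)
    (hz : z.re ≤ 1 - c) : c ≤ ‖1 - z * t‖ := by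
  refine le_trans ?_ ((le_abs_self _).trans (Complex.abs_re_le_norm _))
  simp only [Complex.sub_re, Complex.one_re, Complex.mul_re, Complex.ofReal_re, Complex.ofReal_im,
    mul_zero, sub_zero]
  nlinarith [mul_le_mul_of_nonneg_right hz ht.1.le,
    mul_nonneg (sub_nonneg.2 hc) (sub_nonneg.2 ht.2)]

lemma integrableOn_rpow_sub_one (hb : 0 < b) :
    IntegrableOn (fun t : ℝ => t ^ (b - 1)) (Ioc 0 1) := by
  rw [← intervalIntegrable_iff_integrableOn_Ioc_of_le zero_le_one]
  exact intervalIntegral.intervalIntegrable_rpow' (by linarith)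

lemma differentiableAt_eulerTransform (hb : 0 < b) {z : ℂ} (hz : z.re < 1) :
    DifferentiableAt ℂ (eulerTransform b) z := by
  obtain ⟨c, hc0, hc1, hcz⟩ : ∃ c : ℝ, 0 < c ∧ c ≤ 1 ∧ z.re < 1 - c := by
    refine ⟨min ((1 - z.re) / 2) 1, lt_min (by linarith) one_pos, min_le_right _ _, ?_⟩
    linarith [min_le_left ((1 - z.re) / 2) 1]
  have hs : {w : ℂ | w.re < 1 - c} ∈ 𝓝 z :=
    (isOpen_lt Complex.continuous_re continuous_const).mem_nhds hcz
  have hint := integrableOn_rpow_sub_one hb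
  have hmeas : ∀ w : ℂ, ∀ n : ℕ, AEStronglyMeasurable
      (fun t : ℝ => ((t ^ (b - 1) : ℝ) : ℂ) * (t ^ n * ((1 - w * t)⁻¹) ^ (n + 1)))
      (volume.restrict (Ioc 0 1)) := fun w n => by
    refine Measurable.aestronglyMeasurable ?_
    fun_prop
  have hne : ∀ w : ℂ, w.re < 1 - c → ∀ t ∈ Ioc (0 : ℝ) 1, ‖(1 - w * t)⁻¹‖ ≤ c⁻¹ := by
    intro w hw t ht
    rw [norm_inv]
    exact inv_anti₀ hc0 (le_norm_one_sub_mul ht hc1 hw.le)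
  have hbd : ∀ n : ℕ, ∀ᵐ t ∂(volume.restrict (Ioc (0 : ℝ) 1)), ∀ w ∈ {w : ℂ | w.re < 1 - c},
      ‖((t ^ (b - 1) : ℝ) : ℂ) * (t ^ n * ((1 - w * t)⁻¹) ^ (n + 1))‖ ≤
        t ^ (b - 1) * c⁻¹ ^ (n + 1) := fun n =>
    (ae_restrict_iff' measurableSet_Ioc).2 (ae_of_all _ fun t ht w hw => by
      rw [norm_mul, norm_mul, norm_pow, norm_pow, Complex.norm_real, Complex.norm_real,
        Real.norm_of_nonneg (Real.rpow_nonneg ht.1.le _), Real.norm_of_nonneg ht.1.le]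
      refine mul_le_mul_of_nonneg_left ?_ (Real.rpow_nonneg ht.1.le _)
      exact (mul_le_of_le_one_left (by positivity) (pow_le_one₀ ht.1.le ht.2)).trans
        (pow_le_pow_left₀ (norm_nonneg _) (hne w hw t ht) _))
  -- the integrand is the case `n = 0` of the bounds, its derivative the case `n = 1`
  have h0 : ∀ (w : ℂ) (t : ℝ), ((t ^ (b - 1) : ℝ) : ℂ) * (1 - w * t)⁻¹ =
      ((t ^ (b - 1) : ℝ) : ℂ) * (t ^ 0 * ((1 - w * t)⁻¹) ^ (0 + 1)) := fun w t => by simp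
  refine (hasDerivAt_integral_of_dominated_loc_of_deriv_le
    (F' := fun w t => ((t ^ (b - 1) : ℝ) : ℂ) * (t ^ 1 * ((1 - w * t)⁻¹) ^ (1 + 1)))
    (bound := fun t => t ^ (b - 1) * c⁻¹ ^ (1 + 1)) hs ?_ ?_ (hmeas z 1) (hbd 1)
    (hint.mul_const _) ?_).2.differentiableAt
  · exact .of_forall fun w => by
      simp_rw [h0]
      exact hmeas w 0
  · simp_rw [h0]
    refine (hint.mul_const (c⁻¹ ^ (0 + 1))).mono' (hmeas z 0) ?_
    filter_upwards [hbd 0] with t ht using ht z hcz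
  · refine (ae_restrict_iff' measurableSet_Ioc).2 (ae_of_all _ fun t ht w hw => ?_)
    have h1 : 1 - w * t ≠ 0 := norm_pos_iff.1
      (hc0.trans_le (le_norm_one_sub_mul ht hc1 (le_of_lt hw)))
    have h2 : HasDerivAt (fun w : ℂ => 1 - w * t) (-t) w := by
      simpa using ((hasDerivAt_id w).mul_const (t : ℂ)).const_sub 1
    refine ((h2.inv h1).const_mul _).congr_deriv ?_
    rw [inv_pow, pow_one, neg_neg, div_eq_mul_inv]

lemma re_eulerTransform (x : ℝ) : (eulerTransform b x).re =
    ∫ t in Ioc (0 : ℝ) 1, t ^ (b - 1) * (1 - x * t)⁻¹ := by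
  have : eulerTransform b x = ((∫ t in Ioc (0 : ℝ) 1, t ^ (b - 1) * (1 - x * t)⁻¹ : ℝ) : ℂ) := by
    rw [← integral_complex_ofReal, eulerTransform]
    push_cast
    rfl
  rw [this, Complex.ofReal_re]

lemma ascPochhammer_eval_div (hb : 0 < b) (n : ℕ) :
    (ascPochhammer ℝ n).eval b * ((ascPochhammer ℝ n).eval (b + 1))⁻¹ = b / (b + n) := by
  have h : ∀ n : ℕ, (ascPochhammer ℝ n).eval b * (b + n) =
      b * (ascPochhammer ℝ n).eval (b + 1) := by
    intro n
    induction n with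
    | zero => simp
    | succ n ih =>
      rw [ascPochhammer_succ_eval, ih, ascPochhammer_succ_eval]
      push_cast
      ring
  have h1 := ascPochhammer_pos n (b + 1) (by linarith)
  rw [← div_eq_mul_inv, div_eq_div_iff h1.ne' (by positivity), h n]

lemma hasSum_eulerTransform (hb : 0 < b) {x : ℝ} (hx : |x| < 1) :
    HasSum (fun n : ℕ => x ^ n * (b + n)⁻¹)
      (∫ t in Ioc (0 : ℝ) 1, t ^ (b - 1) * (1 - x * t)⁻¹) := by
  have hint : ∀ n : ℕ, ∫ t in Ioc (0 : ℝ) 1, t ^ (b - 1) * (x * t) ^ n = x ^ n * (b + n)⁻¹ := by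
    intro n
    have h1 : ∫ t in Ioc (0 : ℝ) 1, t ^ (b - 1) * (x * t) ^ n =
        ∫ t in Ioc (0 : ℝ) 1, x ^ n * t ^ (b + n - 1) := by
      refine setIntegral_congr_fun measurableSet_Ioc fun t ht => ?_
      rw [mul_pow, ← Real.rpow_natCast t n, mul_left_comm, ← Real.rpow_add ht.1]
      ring_nf
    have h2 : 0 < b + n := by positivity
    rw [h1, integral_const_mul, ← intervalIntegral.integral_of_le zero_le_one,
      integral_rpow (Or.inl (by linarith)), sub_add_cancel, Real.one_rpow, Real.zero_rpow h2.ne',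
      sub_zero, one_div]
  simp_rw [← hint]
  have hsum : Summable fun n : ℕ => |x| ^ n := summable_geometric_of_lt_one (abs_nonneg x) hx
  refine hasSum_integral_of_dominated_convergence (fun n t => t ^ (b - 1) * |x| ^ n)
    (fun n => Measurable.aestronglyMeasurable (by fun_prop)) (fun n =>
    (ae_restrict_iff' measurableSet_Ioc).2 (ae_of_all _ fun t ht => ?_))
    (ae_of_all _ fun t => hsum.mul_left _) ?_
    ((ae_restrict_iff' measurableSet_Ioc).2 (ae_of_all _ fun t ht => ?_))
  · rw [norm_mul, Real.norm_of_nonneg (Real.rpow_nonneg ht.1.le _), norm_pow, Real.norm_eq_abs,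
      abs_mul, abs_of_pos ht.1]
    exact mul_le_mul_of_nonneg_left (pow_le_pow_left₀ (mul_nonneg (abs_nonneg _) ht.1.le)
      (mul_le_of_le_one_right (abs_nonneg _) ht.2) _) (Real.rpow_nonneg ht.1.le _)
  · simp_rw [tsum_mul_left]
    exact (integrableOn_rpow_sub_one hb).mul_const _
  · refine (hasSum_geometric_of_abs_lt_one ?_).mul_left _
    rw [abs_mul, abs_of_pos ht.1]
    exact (mul_le_of_le_one_right (abs_nonneg _) ht.2).trans_lt hx

/-- Euler's integral represents `₂F₁(1, b; b + 1; ·)`. -/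
lemma isGaussHypergeometric_eulerIntegral (hb : 0 < b) :
    IsGaussHypergeometric 1 b (b + 1)
      fun x => b * ∫ t in Ioc (0 : ℝ) 1, t ^ (b - 1) * (1 - x * t)⁻¹ where
  analytic := by
    have h1 : AnalyticOnNhd ℂ (eulerTransform b) {z | z.re < 1} :=
      DifferentiableOn.analyticOnNhd (fun z hz =>
        (differentiableAt_eulerTransform hb hz).differentiableWithinAt)
        (isOpen_lt Complex.continuous_re continuous_const)
    intro x hx
    simp_rw [← re_eulerTransform]
    exact analyticAt_const.mul (h1 x (by simpa using hx)).re_ofReal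
  series := by
    have h1 : ∀ᶠ x : ℝ in 𝓝 0, |x| < 1 :=
      (continuous_abs.tendsto' 0 0 abs_zero).eventually_lt_const one_pos
    filter_upwards [h1] with x hx
    rw [ordinaryHypergeometric_eq_tsum, ← ((hasSum_eulerTransform hb hx).mul_left b).tsum_eq]
    refine tsum_congr fun n => ?_
    have h2 : ((n.factorial : ℝ))⁻¹ * (ascPochhammer ℝ n).eval 1 = 1 := by
      rw [ascPochhammer_eval_one, inv_mul_cancel₀ (by positivity)]
    rw [h2, one_mul, ascPochhammer_eval_div hb, smul_eq_mul]
    ring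

lemma gaussHypergeometric_eq_eulerIntegral (hb : 0 < b) {x : ℝ} (hx : x < 1) :
    gaussHypergeometric 1 b (b + 1) x = b * ∫ t in Ioc (0 : ℝ) 1, t ^ (b - 1) * (1 - x * t)⁻¹ :=
  (Classical.epsilon_spec ⟨_, isGaussHypergeometric_eulerIntegral hb⟩ :
    IsGaussHypergeometric 1 b (b + 1) (gaussHypergeometric 1 b (b + 1))).eqOn
    (isGaussHypergeometric_eulerIntegral hb) hx

end

/-! ### Rayleigh fading -/

lemma measurable_complex_mk : Measurable fun z : ℝ × ℝ => (⟨z.1, z.2⟩ : ℂ) :=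
  Complex.measurableEquivRealProd.symm.measurable

/-- The squared modulus of a `CN(0, 1)` variable is exponentially distributed with mean `1`. -/
lemma lintegral_stdComplexGaussian {G : ℝ≥0∞ → ℝ≥0∞} (hG : Measurable G) :
    ∫⁻ z, G (‖z‖ₑ ^ 2) ∂stdComplexGaussian =
      ∫⁻ t in Ioi (0 : ℝ), ENNReal.ofReal (Real.exp (-t)) * G (ENNReal.ofReal t) := by
  have hγ : gaussianReal 0 (1 / 2) = volume.withDensity (gaussianPDF 0 (1 / 2)) :=
    gaussianReal_of_var_ne_zero _ (by norm_num)
  have hmeas : Measurable fun p : ℝ × ℝ => G (ENNReal.ofReal (p.1 ^ 2 + p.2 ^ 2)) :=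
    hG.comp (by fun_prop)
  have hK : Measurable fun p : ℝ × ℝ => ENNReal.ofReal (Real.pi⁻¹ *
      Real.exp (-(p.1 ^ 2 + p.2 ^ 2))) * G (ENNReal.ofReal (p.1 ^ 2 + p.2 ^ 2)) :=
    Measurable.mul (by fun_prop) hmeas
  have hpdf : ∀ x y : ℝ, gaussianPDF 0 (1 / 2) x * gaussianPDF 0 (1 / 2) y =
      ENNReal.ofReal (Real.pi⁻¹ * Real.exp (-(x ^ 2 + y ^ 2))) := fun x y => by
    rw [gaussianPDF, gaussianPDF, ← ENNReal.ofReal_mul (gaussianPDFReal_nonneg _ _ _)]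
    congr 1
    simp only [gaussianPDFReal]
    have h1 : 2 * Real.pi * ((1 / 2 : ℝ≥0) : ℝ) = Real.pi := by push_cast; ring
    have h2 : 2 * ((1 / 2 : ℝ≥0) : ℝ) = 1 := by push_cast; ring
    rw [h1, h2]
    have h3 : (√Real.pi)⁻¹ * (√Real.pi)⁻¹ = Real.pi⁻¹ := by
      rw [← mul_inv, Real.mul_self_sqrt Real.pi_pos.le]
    calc _ = ((√Real.pi)⁻¹ * (√Real.pi)⁻¹) *
          (Real.exp (-(x - 0) ^ 2 / 1) * Real.exp (-(y - 0) ^ 2 / 1)) := by ring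
      _ = _ := by
        rw [h3, ← Real.exp_add]
        congr 2
        ring
  have h1 : ∫⁻ z, G (‖z‖ₑ ^ 2) ∂stdComplexGaussian =
      ∫⁻ p : ℝ × ℝ, ENNReal.ofReal (Real.pi⁻¹ * Real.exp (-(p.1 ^ 2 + p.2 ^ 2))) *
        G (ENNReal.ofReal (p.1 ^ 2 + p.2 ^ 2)) := by
    rw [stdComplexGaussian, lintegral_map (by fun_prop) measurable_complex_mk, hγ,
      prod_withDensity (measurable_gaussianPDF _ _) (measurable_gaussianPDF _ _),
      ← Measure.volume_eq_prod, lintegral_withDensity_eq_lintegral_mul _ (by fun_prop)]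
    · refine lintegral_congr fun p => ?_
      have hn : ‖(⟨p.1, p.2⟩ : ℂ)‖ₑ ^ 2 = ENNReal.ofReal (p.1 ^ 2 + p.2 ^ 2) := by
        rw [← ofReal_norm, ← ENNReal.ofReal_pow (norm_nonneg _), Complex.sq_norm,
          Complex.normSq_mk]
        congr 1
        ring
      rw [Pi.mul_apply, hpdf, hn]
    · exact (hG.comp (by fun_prop : Measurable fun z : ℂ => ‖z‖ₑ ^ 2)).comp measurable_complex_mk
  -- polar coordinates
  have h2 : (∫⁻ p : ℝ × ℝ, ENNReal.ofReal (Real.pi⁻¹ * Real.exp (-(p.1 ^ 2 + p.2 ^ 2))) *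
        G (ENNReal.ofReal (p.1 ^ 2 + p.2 ^ 2))) =
      ∫⁻ r in Ioi (0 : ℝ), ENNReal.ofReal (2 * r) *
        (ENNReal.ofReal (Real.exp (-(r ^ 2))) * G (ENNReal.ofReal (r ^ 2))) := by
    rw [← lintegral_comp_polarCoord_symm, polarCoord_target, Measure.volume_eq_prod,
      ← Measure.prod_restrict, lintegral_prod]
    · refine setLIntegral_congr_fun measurableSet_Ioi fun r (hr : 0 < r) => ?_
      have : ∀ a : ℝ, (r * Real.cos a) ^ 2 + (r * Real.sin a) ^ 2 = r ^ 2 := fun a => by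
        rw [mul_pow, mul_pow, ← mul_add, Real.cos_sq_add_sin_sq, mul_one]
      simp only [polarCoord_symm_apply, this, smul_eq_mul, lintegral_const,
        Measure.restrict_apply_univ, Real.volume_Ioo]
      have h3 : ENNReal.ofReal r * ENNReal.ofReal (Real.pi⁻¹ * Real.exp (-r ^ 2)) *
          ENNReal.ofReal (Real.pi - -Real.pi) =
          ENNReal.ofReal (2 * r) * ENNReal.ofReal (Real.exp (-r ^ 2)) := by
        rw [← ENNReal.ofReal_mul hr.le, ← ENNReal.ofReal_mul (by positivity),
          ← ENNReal.ofReal_mul (by positivity)]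
        congr 1
        field_simp
        ring
      rw [← mul_assoc (ENNReal.ofReal (2 * r)), ← h3]
      ring
    · refine Measurable.aemeasurable ?_
      have : Measurable fun x : ℝ × ℝ => polarCoord.symm x :=
        continuous_polarCoord_symm.measurable
      exact (measurable_fst.ennreal_ofReal).smul (hK.comp this)
  -- the substitution `t = r ^ 2`
  have himg : (fun r : ℝ => r ^ 2) '' Ioi 0 = Ioi 0 := by
    ext t
    constructor
    · rintro ⟨r, hr, rfl⟩
      exact pow_pos (mem_Ioi.1 hr) 2
    · exact fun ht => ⟨√t, Real.sqrt_pos.2 ht, Real.sq_sqrt (le_of_lt ht)⟩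
  rw [h1, h2]
  conv_rhs => rw [← himg]
  rw [lintegral_image_eq_lintegral_abs_deriv_mul measurableSet_Ioi
    (f' := fun r => 2 * r)
    (fun r _ => by simpa using (hasDerivAt_pow 2 r).hasDerivWithinAt)
    (fun x hx y hy hxy => (pow_left_inj₀ (le_of_lt hx) (le_of_lt hy) two_ne_zero).1 hxy)]
  refine setLIntegral_congr_fun measurableSet_Ioi fun r (hr : 0 < r) => ?_
  rw [abs_of_pos (by linarith)]

lemma stdComplexGaussian_tail (x : ℝ≥0∞) :
    stdComplexGaussian {z | x < ‖z‖ₑ ^ 2} = expNeg x := by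
  induction x with
  | top => simp
  | coe x =>
    have hs : MeasurableSet {t : ℝ≥0∞ | (x : ℝ≥0∞) < t} := measurableSet_Ioi
    have h1 := lintegral_stdComplexGaussian (G := {t | (x : ℝ≥0∞) < t}.indicator fun _ => 1)
      (measurable_const.indicator hs)
    have h2 : ∀ z : ℂ, {t : ℝ≥0∞ | (x : ℝ≥0∞) < t}.indicator (fun _ => (1 : ℝ≥0∞)) (‖z‖ₑ ^ 2) =
      {z : ℂ | (x : ℝ≥0∞) < ‖z‖ₑ ^ 2}.indicator (fun _ => 1) z := fun z => rfl
    have hm : MeasurableSet {z : ℂ | (x : ℝ≥0∞) < ‖z‖ₑ ^ 2} :=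
      measurableSet_lt measurable_const (by fun_prop)
    simp_rw [h2] at h1
    rw [lintegral_indicator hm, setLIntegral_one] at h1
    have h3 : ∀ t : ℝ, ENNReal.ofReal (Real.exp (-t)) *
        {t : ℝ≥0∞ | (x : ℝ≥0∞) < t}.indicator (fun _ => (1 : ℝ≥0∞)) (ENNReal.ofReal t) =
        (Ioi (x : ℝ)).indicator (fun t => ENNReal.ofReal (Real.exp (-t))) t := fun t => by
      have : (x : ℝ≥0∞) < ENNReal.ofReal t ↔ (x : ℝ) < t := by
        rw [← ENNReal.ofReal_coe_nnreal, ENNReal.ofReal_lt_ofReal_iff_of_nonneg x.coe_nonneg]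
      by_cases ht : (x : ℝ) < t
      · rw [indicator_of_mem (show _ ∈ Ioi _ from ht),
          indicator_of_mem (by exact this.2 ht), mul_one]
      · rw [indicator_of_notMem (show _ ∉ Ioi _ from ht),
          indicator_of_notMem (by exact fun h => ht (this.1 h)), mul_zero]
    simp_rw [h3] at h1
    rw [lintegral_indicator measurableSet_Ioi, Measure.restrict_restrict measurableSet_Ioi,
      inter_eq_left.2 (Ioi_subset_Ioi x.coe_nonneg),
      ← ofReal_integral_eq_lintegral_ofReal (integrableOn_exp_neg_Ioi _)
        (ae_of_all _ fun t => (Real.exp_pos _).le), integral_exp_neg_Ioi,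
      ← expNeg_ofReal x.coe_nonneg, ENNReal.ofReal_coe_nnreal] at h1
    exact h1

lemma stdComplexGaussian_laplace (u : ℝ≥0∞) :
    ∫⁻ z, expNeg (u * ‖z‖ₑ ^ 2) ∂stdComplexGaussian = (1 + u)⁻¹ := by
  rw [lintegral_stdComplexGaussian (G := fun t => expNeg (u * t)) (by fun_prop)]
  induction u with
  | top =>
    rw [setLIntegral_congr_fun (g := fun _ => 0) measurableSet_Ioi]
    · simp
    · intro t (ht : 0 < t)
      simp [ENNReal.top_mul, ht]
  | coe u =>
    have h1 : ∀ t ∈ Ioi (0 : ℝ), ENNReal.ofReal (Real.exp (-t)) *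
        expNeg (u * ENNReal.ofReal t) = ENNReal.ofReal (Real.exp (-(1 + u) * t)) := by
      intro t (ht : 0 < t)
      rw [← ENNReal.ofReal_coe_nnreal, ← ENNReal.ofReal_mul u.coe_nonneg,
        expNeg_ofReal (by positivity), ← ENNReal.ofReal_mul (Real.exp_pos _).le, ← Real.exp_add]
      congr 2
      ring
    have hu : -(1 + (u : ℝ)) < 0 := by have := u.coe_nonneg; linarith
    rw [setLIntegral_congr_fun measurableSet_Ioi h1, ← ofReal_integral_eq_lintegral_ofReal
      (integrableOn_exp_mul_Ioi hu 0) (ae_of_all _ fun t => (Real.exp_pos _).le),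
      integral_exp_mul_Ioi hu]
    have : (1 + (u : ℝ≥0∞)) = ENNReal.ofReal (1 + u) := by
      rw [ENNReal.ofReal_add zero_le_one u.coe_nonneg]; simp
    rw [this, ← ENNReal.ofReal_inv_of_pos (by linarith)]
    congr 1
    rw [mul_zero, Real.exp_zero, neg_div_neg_eq, one_div]

/-! ### The Laplace functional of a Poisson point process -/

section PointCount

variable {Ω : Type*} {X : ℕ → Ω → Plane} {B : Set Plane}

lemma toENNReal_pointCount (X : ℕ → Ω → Plane) (B : Set Plane) (ω : Ω) :
    ((pointCount X B ω : ℕ∞) : ℝ≥0∞) = ∑' k, B.indicator (fun _ => (1 : ℝ≥0∞)) (X k ω) := by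
  rw [pointCount, ← ENNReal.tsum_set_one, tsum_subtype {k | X k ω ∈ B} (fun _ => (1 : ℝ≥0∞))]
  rfl

variable [MeasurableSpace Ω]

lemma measurable_pointCount (hX : ∀ k, Measurable (X k)) (hB : MeasurableSet B) :
    Measurable (pointCount X B) := by
  refine measurable_to_countable' fun n => ?_
  have : pointCount X B ⁻¹' {n} =
      {ω | ∑' k, B.indicator (fun _ => (1 : ℝ≥0∞)) (X k ω) = (n : ℝ≥0∞)} := by
    ext ω
    simp only [mem_preimage, mem_singleton_iff, mem_ofPred_eq]
    rw [← toENNReal_pointCount, ENat.toENNReal_inj]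
  rw [this]
  refine measurableSet_eq_fun (Measurable.tsum fun k => ?_) measurable_const
  exact (measurable_const.indicator hB).comp (hX k)

variable {P : Measure Ω} [IsProbabilityMeasure P] {lam : ℝ}

/-- The distribution of the number of points in `B`, as an integration formula. -/
lemma IsHomogeneousPPP.lintegral_pointCount (h : IsHomogeneousPPP P lam X)
    (hB : MeasurableSet B) (hv : volume B ≠ ∞) (F : ℕ∞ → ℝ≥0∞) :
    ∫⁻ ω, F (pointCount X B ω) ∂P =
      ∑' n : ℕ, F n * poissonMeasure (lam.toNNReal * (volume B).toNNReal) {n} := by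
  set m := poissonMeasure (lam.toNNReal * (volume B).toNNReal) with hm
  have hN := measurable_pointCount h.measurable hB
  have hsing : ∀ n : ℕ, P.map (pointCount X B) {(n : ℕ∞)} = m {n} := fun n => by
    rw [Measure.map_apply hN (measurableSet_singleton _)]
    exact h.count_law B hB hv n
  have hprob : IsProbabilityMeasure (P.map (pointCount X B)) :=
    Measure.isProbabilityMeasure_map hN.aemeasurable
  -- the Poisson weights add up to one, so that the number of points is almost surely finite
  have hrange : P.map (pointCount X B) (range ((↑) : ℕ → ℕ∞)) = 1 := by
    have : range ((↑) : ℕ → ℕ∞) = ⋃ n : ℕ, {(n : ℕ∞)} := by ext x; simp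
    rw [this, measure_iUnion (fun a b hab => by simpa using hab)
      (fun _ => measurableSet_singleton _)]
    simp_rw [hsing]
    rw [← measure_iUnion (fun a b hab => by simpa using hab) (fun _ => measurableSet_singleton _)]
    have : (⋃ n : ℕ, {n}) = (univ : Set ℕ) := by ext; simp
    rw [this, measure_univ]
  have htop : P.map (pointCount X B) {⊤} = 0 := by
    have := (prob_compl_eq_zero_iff
      (MeasurableSet.of_discrete (s := range ((↑) : ℕ → ℕ∞)))).2 hrange
    refine measure_mono_null ?_ this
    simp
  have hmap : P.map (pointCount X B) = m.map ((↑) : ℕ → ℕ∞) := by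
    refine Measure.ext_of_singleton fun n => ?_
    rw [Measure.map_apply (μ := m) .of_discrete (measurableSet_singleton _)]
    induction n with
    | top => rw [htop]; simp [preimage]
    | coe n =>
      rw [hsing]
      congr 1
      ext; simp
  rw [← lintegral_map (.of_discrete) hN, hmap, lintegral_map .of_discrete .of_discrete,
    lintegral_countable']

lemma IsHomogeneousPPP.lintegral_expNeg_mul_pointCount (h : IsHomogeneousPPP P lam X)
    (hB : MeasurableSet B) (hv : volume B ≠ ∞) (c : ℝ≥0∞) :
    ∫⁻ ω, expNeg (c * (pointCount X B ω : ℝ≥0∞)) ∂P =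
      expNeg (ENNReal.ofReal lam * (volume B * (1 - expNeg c))) := by
  rw [h.lintegral_pointCount hB hv (fun n => expNeg (c * (n : ℝ≥0∞)))]
  set r := lam.toNNReal * (volume B).toNNReal with hr
  set s := (expNeg c).toReal with hs
  have hcs : expNeg c = ENNReal.ofReal s := (ENNReal.ofReal_toReal (expNeg_ne_top c)).symm
  have hs0 : 0 ≤ s := ENNReal.toReal_nonneg
  have hs1 : s ≤ 1 := by
    simpa using ENNReal.toReal_mono ENNReal.one_ne_top (expNeg_le_one c)
  have hterm : ∀ n : ℕ, expNeg (c * ((n : ℕ∞) : ℝ≥0∞)) * poissonMeasure r {n} =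
      ENNReal.ofReal (Real.exp (-r) * ((r * s) ^ n / n.factorial)) := fun n => by
    rw [ENat.toENNReal_coe, mul_comm c, expNeg_nat_mul, hcs, poissonMeasure_singleton,
      ← ENNReal.ofReal_pow hs0, ← ENNReal.ofReal_mul (by positivity)]
    congr 1
    rw [mul_pow]
    ring
  have hsum : HasSum (fun n : ℕ => Real.exp (-r) * ((r * s) ^ n / n.factorial))
      (Real.exp (-(r * (1 - s)))) := by
    rw [show -(r * (1 - s)) = -r + r * s by ring, Real.exp_add, Real.exp_eq_exp_ℝ]
    exact (NormedSpace.expSeries_div_hasSum_exp (r * s : ℝ)).mul_left _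
  simp_rw [hterm]
  rw [← ENNReal.ofReal_tsum_of_nonneg (fun n => by positivity) hsum.summable, hsum.tsum_eq,
    ← expNeg_ofReal (mul_nonneg r.coe_nonneg (by linarith))]
  congr 1
  rw [ENNReal.ofReal_mul r.coe_nonneg, ENNReal.ofReal_sub _ hs0, ← hcs, ENNReal.ofReal_one,
    ← mul_assoc]
  congr 1
  rw [ENNReal.ofReal_coe_nnreal, hr, ENNReal.coe_mul, ENNReal.coe_toNNReal hv]
  rfl

lemma IsHomogeneousPPP.lintegral_pointCount_id (h : IsHomogeneousPPP P lam X)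
    (hB : MeasurableSet B) (hv : volume B ≠ ∞) :
    ∫⁻ ω, (pointCount X B ω : ℝ≥0∞) ∂P = ENNReal.ofReal lam * volume B := by
  rw [h.lintegral_pointCount hB hv (fun n => (n : ℝ≥0∞))]
  set r := lam.toNNReal * (volume B).toNNReal with hr
  have hterm : ∀ n : ℕ, ((n + 1 : ℕ) : ℕ∞) * poissonMeasure r {n + 1} =
      r * poissonMeasure r {n} := fun n => by
    rw [ENat.toENNReal_coe, poissonMeasure_singleton, poissonMeasure_singleton,
      ← ENNReal.ofReal_natCast, ← ENNReal.ofReal_mul (by positivity), ← ENNReal.ofReal_coe_nnreal,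
      ← ENNReal.ofReal_mul (by positivity), Nat.factorial_succ]
    congr 1
    push_cast
    field_simp
    ring
  rw [tsum_eq_zero_add' ENNReal.summable]
  simp_rw [hterm]
  rw [ENNReal.tsum_mul_left, ← measure_iUnion (fun a b hab => by simpa using hab)
    (fun _ => measurableSet_singleton _)]
  have : (⋃ n : ℕ, {n}) = (univ : Set ℕ) := by ext; simp
  rw [this, measure_univ, hr, ENNReal.coe_mul, ENNReal.coe_toNNReal hv]
  simp [ENNReal.ofReal]

end PointCount

section Laplace

variable {Ω : Type*} {X : ℕ → Ω → Plane} {B : Set Plane} [MeasurableSpace Ω]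
variable {P : Measure Ω} {lam : ℝ}

lemma IsHomogeneousPPP.iIndepFun_pointCount {ι : Type*} [Finite ι] (h : IsHomogeneousPPP P lam X)
    {A : ι → Set Plane} (hA : ∀ a, MeasurableSet (A a)) (hv : ∀ a, volume (A a) ≠ ∞)
    (hd : Pairwise fun a b => Disjoint (A a) (A b)) :
    iIndepFun (fun a => pointCount X (A a)) P := by
  have := Fintype.ofFinite ι
  let e := (Fintype.equivFin ι).symm
  have h1 := h.count_indep _ (A ∘ e) (fun a => hA _) (fun a => hv _)
    (fun a b hab => hd (e.injective.ne hab))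
  exact iIndepFun.of_precomp (g := e) e.surjective h1

variable [IsProbabilityMeasure P]

/-- The Laplace functional for a weight that is constant on finitely many disjoint sets. -/
lemma IsHomogeneousPPP.lintegral_mul_expNeg_step {ι : Type*} [Fintype ι]
    (h : IsHomogeneousPPP P lam X) {A : Option ι → Set Plane} (hA : ∀ a, MeasurableSet (A a))
    (hv : ∀ a, volume (A a) ≠ ∞) (hd : Pairwise fun a b => Disjoint (A a) (A b))
    (ψ : ℕ∞ → ℝ≥0∞) (c : ι → ℝ≥0∞) {f : Plane → ℝ≥0∞}
    (hf : ∀ x, f x = ∑ a, c a * (A (some a)).indicator (fun _ => 1) x) :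
    ∫⁻ ω, ψ (pointCount X (A none) ω) * expNeg (∑' m, f (X m ω)) ∂P =
      (∫⁻ ω, ψ (pointCount X (A none) ω) ∂P) *
        expNeg (ENNReal.ofReal lam * ∫⁻ x, (1 - expNeg (f x))) := by
  have h1 : ∀ ω, ∑' m, f (X m ω) = ∑ a, c a * (pointCount X (A (some a)) ω : ℝ≥0∞) := fun ω => by
    simp_rw [hf, toENNReal_pointCount, ← ENNReal.tsum_mul_left]
    exact Summable.tsum_finsetSum fun a _ => ENNReal.summable
  have h2 : ∀ x, 1 - expNeg (f x) =
      ∑ a, (1 - expNeg (c a)) * (A (some a)).indicator (fun _ => 1) x := fun x => by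
    rw [hf]
    by_cases hx : ∃ a, x ∈ A (some a)
    · obtain ⟨a, ha⟩ := hx
      have hb : ∀ b, b ≠ a → x ∉ A (some b) := fun b hb hxb =>
        disjoint_left.1 (hd (show some b ≠ some a by simpa using hb)) hxb ha
      rw [Finset.sum_eq_single a (fun b _ hba => by simp [hb b hba]) (by simp),
        Finset.sum_eq_single a (fun b _ hba => by simp [hb b hba]) (by simp)]
      simp [ha]
    · push Not at hx
      simp [hx]
  let W : Option ι → ℕ∞ → ℝ≥0∞ := fun a => a.elim ψ fun a n => expNeg (c a * (n : ℝ≥0∞))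
  have h3 : ∀ ω, ψ (pointCount X (A none) ω) * expNeg (∑' m, f (X m ω)) =
      ∏ a : Option ι, W a (pointCount X (A a) ω) := fun ω => by
    rw [Fintype.prod_option, h1, expNeg_sum]
    rfl
  simp_rw [h3, h2]
  rw [lintegral_prod_eq_prod_lintegral_of_indepFun _ (fun a ω => W a (pointCount X (A a) ω))
    ((h.iIndepFun_pointCount hA hv hd).comp _ fun a => .of_discrete)
    (fun a => Measurable.of_discrete.comp (measurable_pointCount h.measurable (hA a))),
    Fintype.prod_option, lintegral_finsetSum _ (fun a _ =>
      (measurable_const.indicator (hA _)).const_mul _), Finset.mul_sum, expNeg_sum]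
  congr 1
  refine Finset.prod_congr rfl fun a _ => ?_
  rw [lintegral_const_mul _ (measurable_const.indicator (hA _)),
    lintegral_indicator (hA _), setLIntegral_one, mul_comm (1 - _)]
  exact h.lintegral_expNeg_mul_pointCount (hA _) (hv _) _

/-- Approximation of a measurable weight by simple functions with bounded support. -/
def boundedApprox (f : Plane → ℝ≥0∞) (n : ℕ) : SimpleFunc Plane ℝ≥0∞ :=
  (SimpleFunc.eapprox f n).restrict (Metric.ball 0 n)

lemma boundedApprox_apply (f : Plane → ℝ≥0∞) (n : ℕ) (x : Plane) :
    boundedApprox f n x = (Metric.ball 0 n).indicator (SimpleFunc.eapprox f n) x := by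
  rw [boundedApprox, SimpleFunc.restrict_apply _ measurableSet_ball]

lemma monotone_boundedApprox (f : Plane → ℝ≥0∞) (x : Plane) :
    Monotone fun n => boundedApprox f n x := fun n m h => by
  simp only [boundedApprox_apply]
  by_cases hx : x ∈ Metric.ball (0 : Plane) n
  · rw [indicator_of_mem hx, indicator_of_mem (Metric.ball_subset_ball (by exact_mod_cast h) hx)]
    exact SimpleFunc.monotone_eapprox f h x
  · simp [hx]

lemma boundedApprox_le {f : Plane → ℝ≥0∞} (hf : Measurable f) (n : ℕ) (x : Plane) :
    boundedApprox f n x ≤ f x := by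
  rw [boundedApprox_apply]
  refine (indicator_le_self' (fun _ _ => zero_le) x).trans ?_
  rw [← SimpleFunc.iSup_eapprox_apply hf x]
  exact le_iSup (fun n => SimpleFunc.eapprox f n x) n

lemma tendsto_boundedApprox {f : Plane → ℝ≥0∞} (hf : Measurable f) (x : Plane) :
    Tendsto (fun n => boundedApprox f n x) atTop (𝓝 (f x)) := by
  have h1 : Tendsto (fun n => SimpleFunc.eapprox f n x) atTop (𝓝 (f x)) := by
    rw [← SimpleFunc.iSup_eapprox_apply hf x]
    exact tendsto_atTop_iSup fun n m h => SimpleFunc.monotone_eapprox f h x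
  refine h1.congr' ?_
  obtain ⟨k, hk⟩ := exists_nat_gt ‖x‖
  filter_upwards [eventually_ge_atTop k] with n hn
  rw [boundedApprox_apply, indicator_of_mem]
  rw [mem_ball_zero_iff]
  exact hk.trans_le (by exact_mod_cast hn)

lemma tendsto_tsum_of_monotone {κ : Type*} {g : ℕ → κ → ℝ≥0∞} {G : κ → ℝ≥0∞}
    (hmono : ∀ k, Monotone fun n => g n k) (hlim : ∀ k, Tendsto (fun n => g n k) atTop (𝓝 (G k))) :
    Tendsto (fun n => ∑' k, g n k) atTop (𝓝 (∑' k, G k)) := by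
  let _ : MeasurableSpace κ := ⊤
  simp_rw [← lintegral_count]
  exact lintegral_tendsto_of_tendsto_of_monotone (fun n => Measurable.of_discrete.aemeasurable)
    (ae_of_all _ hmono) (ae_of_all _ hlim)

/-- The Laplace functional of a Poisson point process, jointly with the number of points in a set
on which the weight vanishes: the two are independent, and the expectation of `∏ e^(-f(X m))` is
`exp (-λ ∫ (1 - e^(-f)))`. -/
theorem IsHomogeneousPPP.lintegral_mul_expNeg_tsum (h : IsHomogeneousPPP P lam X)
    (hB : MeasurableSet B) (hv : volume B ≠ ∞) {ψ : ℕ∞ → ℝ≥0∞}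
    (hψ : ∫⁻ ω, ψ (pointCount X B ω) ∂P ≠ ∞) {f : Plane → ℝ≥0∞} (hf : Measurable f)
    (hfB : ∀ x ∈ B, f x = 0) :
    ∫⁻ ω, ψ (pointCount X B ω) * expNeg (∑' m, f (X m ω)) ∂P =
      (∫⁻ ω, ψ (pointCount X B ω) ∂P) *
        expNeg (ENNReal.ofReal lam * ∫⁻ x, (1 - expNeg (f x))) := by
  have hstep : ∀ n, ∫⁻ ω, ψ (pointCount X B ω) * expNeg (∑' m, boundedApprox f n (X m ω)) ∂P =
      (∫⁻ ω, ψ (pointCount X B ω) ∂P) *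
        expNeg (ENNReal.ofReal lam * ∫⁻ x, (1 - expNeg (boundedApprox f n x))) := fun n => by
    classical
    let A : Option (boundedApprox f n).range → Set Plane := fun a =>
      a.elim B fun c => if (c : ℝ≥0∞) = 0 then ∅ else boundedApprox f n ⁻¹' {(c : ℝ≥0∞)}
    refine h.lintegral_mul_expNeg_step (A := A) ?_ ?_ ?_ ψ (fun c => (c : ℝ≥0∞)) ?_
    · rintro (_ | c)
      · exact hB
      · change MeasurableSet (if (c : ℝ≥0∞) = 0 then ∅ else boundedApprox f n ⁻¹' {(c : ℝ≥0∞)})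
        split_ifs
        exacts [.empty, SimpleFunc.measurableSet_preimage _ _]
    · rintro (_ | c)
      · exact hv
      · change volume (if (c : ℝ≥0∞) = 0 then ∅ else boundedApprox f n ⁻¹' {(c : ℝ≥0∞)}) ≠ ∞
        split_ifs with hc
        · simp
        · refine ((measure_mono fun x hx => ?_).trans_lt
            (measure_ball_lt_top (μ := volume) (x := (0 : Plane)) (r := n))).ne
          by_contra hxb
          rw [mem_preimage, mem_singleton_iff, boundedApprox_apply, indicator_of_notMem hxb] at hx
          exact hc hx.symm
    · have hBc : ∀ c : (boundedApprox f n).range, Disjoint (A none) (A (some c)) := fun c => by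
        change Disjoint B (if (c : ℝ≥0∞) = 0 then ∅ else boundedApprox f n ⁻¹' {(c : ℝ≥0∞)})
        split_ifs with hc
        · simp
        · refine disjoint_left.2 fun x hx hxc => hc ?_
          rw [← (mem_singleton_iff.1 hxc), ← nonpos_iff_eq_zero, ← hfB x hx]
          exact boundedApprox_le hf n x
      rintro (_ | c) (_ | d) hcd
      · exact absurd rfl hcd
      · exact hBc d
      · exact (hBc c).symm
      · change Disjoint (if (c : ℝ≥0∞) = 0 then ∅ else boundedApprox f n ⁻¹' {(c : ℝ≥0∞)})
          (if (d : ℝ≥0∞) = 0 then ∅ else boundedApprox f n ⁻¹' {(d : ℝ≥0∞)})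
        split_ifs
        · simp
        · simp
        · simp
        · refine disjoint_left.2 fun x hx hxd => hcd ?_
          rw [mem_preimage, mem_singleton_iff] at hx hxd
          rw [Option.some_inj, Subtype.ext_iff, ← hx, ← hxd]
    · intro x
      rw [Finset.sum_eq_single ⟨boundedApprox f n x, SimpleFunc.mem_range_self _ _⟩]
      · change _ = _ * (if boundedApprox f n x = 0 then ∅ else
          boundedApprox f n ⁻¹' {boundedApprox f n x}).indicator _ x
        split_ifs with h0
        · simp [h0]
        · simp
      · intro c _ hc
        change _ * (if (c : ℝ≥0∞) = 0 then ∅ else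
          boundedApprox f n ⁻¹' {(c : ℝ≥0∞)}).indicator _ x = 0
        split_ifs with h0
        · simp
        · rw [indicator_of_notMem, mul_zero]
          intro hx
          exact hc (Subtype.ext hx.symm)
      · simp
  have hlim1 : Tendsto (fun n => ∫⁻ ω, ψ (pointCount X B ω) *
      expNeg (∑' m, boundedApprox f n (X m ω)) ∂P) atTop
      (𝓝 (∫⁻ ω, ψ (pointCount X B ω) * expNeg (∑' m, f (X m ω)) ∂P)) := by
    have hψm : Measurable fun ω => ψ (pointCount X B ω) :=
      Measurable.of_discrete.comp (measurable_pointCount h.measurable hB)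
    refine tendsto_lintegral_of_dominated_convergence' _ (fun n => ?_)
      (fun n => ae_of_all _ fun ω => mul_le_of_le_one_right zero_le (expNeg_le_one _)) hψ ?_
    · exact (hψm.mul (measurable_expNeg.comp (Measurable.tsum fun m =>
        (boundedApprox f n).measurable.comp (h.measurable m)))).aemeasurable
    · have hfin := ae_lt_top hψm hψ
      filter_upwards [hfin] with ω hω
      refine ENNReal.Tendsto.const_mul ((continuous_expNeg.tendsto _).comp ?_) (Or.inr hω.ne)
      exact tendsto_tsum_of_monotone (fun m => monotone_boundedApprox f _)
        fun m => tendsto_boundedApprox hf _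
  have hlim2 : Tendsto (fun n => ∫⁻ x, (1 - expNeg (boundedApprox f n x))) atTop
      (𝓝 (∫⁻ x, (1 - expNeg (f x)))) := by
    refine lintegral_tendsto_of_tendsto_of_monotone (fun n => ?_) ?_ ?_
    · exact (measurable_const.sub
        (measurable_expNeg.comp (boundedApprox f n).measurable)).aemeasurable
    · exact ae_of_all _ fun x n m hnm =>
        tsub_le_tsub_left (expNeg_antitone (monotone_boundedApprox f x hnm)) _
    · exact ae_of_all _ fun x => ENNReal.Tendsto.sub tendsto_const_nhds
        ((continuous_expNeg.tendsto _).comp (tendsto_boundedApprox hf x)) (Or.inl (by simp))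
  simp_rw [hstep] at hlim1
  refine tendsto_nhds_unique hlim1 (ENNReal.Tendsto.const_mul ?_ (Or.inr hψ))
  exact (continuous_expNeg.tendsto _).comp
    (ENNReal.Tendsto.const_mul hlim2 (Or.inr ENNReal.ofReal_ne_top))

end Laplace

/-! ### Averaging over the caches and the fading for fixed positions -/

lemma expNeg_injective : Function.Injective expNeg := fun x y h => by
  have := EReal.exp_strictMono.injective h
  exact_mod_cast neg_injective this

lemma negLog_mul {a b : ℝ≥0∞} (ha : a ≤ 1) (hb : b ≤ 1) : negLog (a * b) = negLog a + negLog b :=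
  expNeg_injective <| by
    rw [expNeg_add, expNeg_negLog ha, expNeg_negLog hb, expNeg_negLog (mul_le_one' ha hb)]

lemma measurable_const_add_tsum {α κ : Type*} [Countable κ] {m : MeasurableSpace α}
    {W : κ → α → ℝ≥0∞} (hW : ∀ b, Measurable (W b)) (s : ℝ≥0∞) :
    Measurable fun x => s + ∑' b, W b x :=
  (Measurable.tsum hW).const_add s

/-- Fubini's theorem for two independent variables. -/
lemma measure_prodMk_mem_of_indepFun {Ω α β : Type*} [MeasurableSpace Ω] [MeasurableSpace α]
    [MeasurableSpace β] {P : Measure Ω} [IsProbabilityMeasure P] {Z : Ω → α} {Y : Ω → β}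
    (hZ : Measurable Z) (hY : Measurable Y) (h : IndepFun Z Y P) {E : Set (α × β)}
    (hE : MeasurableSet E) :
    P {ω | (Z ω, Y ω) ∈ E} = ∫⁻ ω, P {ω' | (Z ω, Y ω') ∈ E} ∂P := by
  have h1 : P {ω | (Z ω, Y ω) ∈ E} = P.map (fun ω => (Z ω, Y ω)) E :=
    (Measure.map_apply (hZ.prodMk hY) hE).symm
  have : IsProbabilityMeasure (P.map Y) := Measure.isProbabilityMeasure_map hY.aemeasurable
  rw [h1, (indepFun_iff_map_prod_eq_prod_map_map hZ.aemeasurable hY.aemeasurable).1 h,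
    Measure.prod_apply hE, lintegral_map (measurable_measure_prodMk_left hE) hZ]
  refine lintegral_congr fun ω => ?_
  rw [Measure.map_apply hY (measurable_prodMk_left hE)]
  rfl

namespace HetNet

/-- The positions of the base stations of each tier, the caches, and the fading coefficients. -/
abbrev Configuration (N M : ℕ) : Type :=
  (Fin N → ℕ → Plane) × ((Fin N × ℕ → Set (Fin M)) × (Fin N × ℕ → ℂ))

variable {N M : ℕ} {Ω : Type*} [MeasurableSpace Ω] {P : Measure Ω} (𝓗 : HetNet N M P)

/-- The independent σ-algebras of the model. -/
abbrev source : Fin N ⊕ (Fin N × ℕ) ⊕ (Fin N × ℕ) ⊕ Unit → MeasurableSpace Ω :=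
  Sum.elim (fun l : Fin N => MeasurableSpace.comap (fun ω k => 𝓗.X l k ω) inferInstance)
    (Sum.elim (fun a : Fin N × ℕ => MeasurableSpace.comap (𝓗.cache a.1 a.2) inferInstance)
      (Sum.elim (fun a : Fin N × ℕ => MeasurableSpace.comap (𝓗.h a.1 a.2) inferInstance)
        (fun _ : Unit => MeasurableSpace.comap 𝓗.req inferInstance)))

lemma iIndep_source : iIndep 𝓗.source P := 𝓗.indep

lemma measurable_X (l : Fin N) (k : ℕ) : Measurable (𝓗.X l k) := (𝓗.ppp l).measurable k

lemma source_le (b) : 𝓗.source b ≤ ‹MeasurableSpace Ω› := by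
  rcases b with l | a | a | u
  · exact (measurable_pi_iff.2 fun k => 𝓗.measurable_X l k).comap_le
  · exact (𝓗.measurable_cache a.1 a.2).comap_le
  · exact (𝓗.measurable_h a.1 a.2).comap_le
  · exact 𝓗.measurable_req.comap_le

/-- The positions of all the base stations. -/
def pos (ω : Ω) : Fin N → ℕ → Plane := fun l k => 𝓗.X l k ω

/-- The caches and the fading coefficients of all the base stations. -/
def marks (ω : Ω) : (Fin N × ℕ → Set (Fin M)) × (Fin N × ℕ → ℂ) :=
  (fun a => 𝓗.cache a.1 a.2 ω, fun a => 𝓗.h a.1 a.2 ω)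

lemma measurable_pos : Measurable 𝓗.pos :=
  measurable_pi_iff.2 fun l => measurable_pi_iff.2 fun k => 𝓗.measurable_X l k

lemma measurable_marks : Measurable 𝓗.marks :=
  Measurable.prodMk (measurable_pi_iff.2 fun a => 𝓗.measurable_cache a.1 a.2)
    (measurable_pi_iff.2 fun a => 𝓗.measurable_h a.1 a.2)

lemma comap_pos_le : MeasurableSpace.comap 𝓗.pos inferInstance ≤
    ⨆ b ∈ range (Sum.inl : Fin N → _), 𝓗.source b := by
  rw [← measurable_iff_comap_le]
  refine (@measurable_pi_iff _ _ _ (⨆ b ∈ range Sum.inl, 𝓗.source b) _ _).2 fun l => ?_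
  have h1 : Measurable[𝓗.source (.inl l)] fun ω => 𝓗.pos ω l := comap_measurable _
  exact h1.mono (le_iSup₂_of_le (Sum.inl l) ⟨l, rfl⟩ le_rfl) le_rfl

/-- The indices of the σ-algebras of the caches and of the fading coefficients. -/
def markIndex : Set (Fin N ⊕ (Fin N × ℕ) ⊕ (Fin N × ℕ) ⊕ Unit) :=
  {b | ∃ a, b = .inr (.inl a) ∨ b = .inr (.inr (.inl a))}

lemma comap_marks_le : MeasurableSpace.comap 𝓗.marks inferInstance ≤
    ⨆ b ∈ markIndex, 𝓗.source b := by
  rw [← measurable_iff_comap_le]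
  refine Measurable.prodMk
    ((@measurable_pi_iff _ _ _ (⨆ b ∈ markIndex, 𝓗.source b) _ _).2 fun a => ?_)
    ((@measurable_pi_iff _ _ _ (⨆ b ∈ markIndex, 𝓗.source b) _ _).2 fun a => ?_)
  · have h1 : Measurable[𝓗.source (.inr (.inl a))] fun ω => 𝓗.cache a.1 a.2 ω := comap_measurable _
    exact h1.mono (le_iSup₂_of_le (.inr (.inl a)) ⟨a, .inl rfl⟩ le_rfl) le_rfl
  · have h1 : Measurable[𝓗.source (.inr (.inr (.inl a)))] fun ω => 𝓗.h a.1 a.2 ω :=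
      comap_measurable _
    exact h1.mono (le_iSup₂_of_le (.inr (.inr (.inl a))) ⟨a, .inr rfl⟩ le_rfl) le_rfl

lemma indepFun_pos_marks : IndepFun 𝓗.pos 𝓗.marks P := by
  rw [IndepFun_iff_Indep]
  refine indep_of_indep_of_le (indep_iSup_of_disjoint 𝓗.source_le 𝓗.iIndep_source ?_)
    𝓗.comap_pos_le 𝓗.comap_marks_le
  rw [disjoint_left]
  rintro _ ⟨l, rfl⟩ ⟨a, h | h⟩ <;> cases h

lemma indepFun_req : IndepFun 𝓗.req (fun ω => (𝓗.pos ω, 𝓗.marks ω)) P := by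
  rw [IndepFun_iff_Indep]
  refine indep_of_indep_of_le (indep_iSup_of_disjoint 𝓗.source_le 𝓗.iIndep_source
    (S := {.inr (.inr (.inr ()))}) (T := {.inr (.inr (.inr ()))}ᶜ) disjoint_compl_right)
    (le_iSup₂_of_le (.inr (.inr (.inr ()))) (mem_singleton _) le_rfl) ?_
  rw [← measurable_iff_comap_le]
  refine Measurable.prodMk ?_ ?_
  · rw [measurable_iff_comap_le]
    exact 𝓗.comap_pos_le.trans (biSup_mono (by rintro _ ⟨l, rfl⟩; simp))
  · rw [measurable_iff_comap_le]
    exact 𝓗.comap_marks_le.trans (biSup_mono (by rintro _ ⟨a, rfl | rfl⟩ <;> simp))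

lemma iIndepFun_pos : iIndepFun (fun l ω => 𝓗.pos ω l) P := by
  rw [iIndepFun_iff_iIndep]
  exact 𝓗.iIndep_source.precomp (g := Sum.inl) Sum.inl_injective

lemma measurableSet_mem_cache (j : Fin M) (a : Fin N × ℕ) :
    MeasurableSet {ω | j ∈ 𝓗.cache a.1 a.2 ω} :=
  measurableSet_setOfPred.2 ((measurable_set_mem j).comp (𝓗.measurable_cache a.1 a.2))

lemma p_nonneg (l : Fin N) (j : Fin M) : 0 ≤ 𝓗.p l j := by
  rw [← 𝓗.cache_prob l 0 j]; exact measureReal_nonneg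

lemma lintegral_expNeg_fading (a : Fin N × ℕ) (w : ℝ≥0∞) :
    ∫⁻ ω, expNeg (w * ‖𝓗.h a.1 a.2 ω‖ₑ ^ 2) ∂P = (1 + w)⁻¹ := by
  rw [← stdComplexGaussian_laplace w, ← 𝓗.fading_law a.1 a.2,
    lintegral_map (by fun_prop) (𝓗.measurable_h _ _)]

lemma measure_lt_fading (a : Fin N × ℕ) (t : ℝ≥0∞) :
    P {ω | t < ‖𝓗.h a.1 a.2 ω‖ₑ ^ 2} = expNeg t := by
  rw [← stdComplexGaussian_tail t, ← 𝓗.fading_law a.1 a.2,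
    Measure.map_apply (𝓗.measurable_h _ _) (measurableSet_lt measurable_const (by fun_prop))]
  rfl

variable [IsProbabilityMeasure P]

lemma p_le_one (l : Fin N) (j : Fin M) : 𝓗.p l j ≤ 1 := by
  rw [← 𝓗.cache_prob l 0 j]; exact measureReal_le_one

lemma measure_mem_cache (j : Fin M) (a : Fin N × ℕ) :
    P {ω | j ∈ 𝓗.cache a.1 a.2 ω} = ENNReal.ofReal (𝓗.p a.1 j) := by
  rw [← 𝓗.cache_prob a.1 a.2 j, ofReal_measureReal]

lemma measure_notMem_cache (j : Fin M) (a : Fin N × ℕ) :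
    P {ω | j ∈ 𝓗.cache a.1 a.2 ω}ᶜ = ENNReal.ofReal (1 - 𝓗.p a.1 j) := by
  rw [prob_compl_eq_one_sub (𝓗.measurableSet_mem_cache j a), measure_mem_cache,
    ENNReal.ofReal_sub _ (𝓗.p_nonneg _ _), ENNReal.ofReal_one]

open Classical in
/-- The penalty by which the cache `C` of the base station `a` enters the load at `a₀`: it is `∞`
if `a₀` itself does not store `j`, or if another base station of the set `D` stores `j`. -/
def cachePenalty (j : Fin M) (a₀ : Fin N × ℕ) (D : Set (Fin N × ℕ)) (a : Fin N × ℕ)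
    (C : Set (Fin M)) : ℝ≥0∞ :=
  if a = a₀ then (if j ∈ C then 0 else ∞) else (if a ∈ D ∧ j ∈ C then ∞ else 0)

/-- The total load at the base station `a₀`: the noise `s`, the cache penalties and the
interference with weights `w`. -/
def load (j : Fin M) (a₀ : Fin N × ℕ) (D : Set (Fin N × ℕ)) (s : ℝ≥0∞) (w : Fin N × ℕ → ℝ≥0∞)
    (y : (Fin N × ℕ → Set (Fin M)) × (Fin N × ℕ → ℂ)) : ℝ≥0∞ :=
  s + (∑' a, cachePenalty j a₀ D a (y.1 a) + ∑' a, w a * ‖y.2 a‖ₑ ^ 2)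

lemma measurable_cachePenalty (j : Fin M) (a₀ : Fin N × ℕ) (D : Set (Fin N × ℕ)) (a : Fin N × ℕ) :
    Measurable (cachePenalty j a₀ D a) := by
  classical
  have hj : MeasurableSet {C : Set (Fin M) | j ∈ C} :=
    measurableSet_setOfPred.2 (measurable_set_mem j)
  unfold cachePenalty
  refine Measurable.ite (.const _) (Measurable.ite hj measurable_const measurable_const)
    (Measurable.ite ?_ measurable_const measurable_const)
  exact (MeasurableSet.const (a ∈ D)).inter hj

open Classical in
/-- The mean of `e^(-·)` of the total contribution to the load of one base station other than the
serving one: `p` is its caching probability, `near` says that it must not store the file, and `w` is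
the weight of its fading coefficient. -/
def stationFactor (p : ℝ) (near : Prop) (w : ℝ≥0∞) : ℝ≥0∞ :=
  (if near then ENNReal.ofReal (1 - p) else 1) * (1 + w)⁻¹

lemma stationFactor_le_one {p : ℝ} (hp : 0 ≤ p) (near : Prop) (w : ℝ≥0∞) :
    stationFactor p near w ≤ 1 := by
  refine mul_le_one' ?_ (ENNReal.inv_le_one.2 le_self_add)
  split_ifs
  · exact ENNReal.ofReal_le_one.2 (by linarith)
  · exact le_rfl

lemma lintegral_expNeg_cachePenalty (j : Fin M) (a₀ : Fin N × ℕ) (D : Set (Fin N × ℕ))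
    (a : Fin N × ℕ) [Decidable (a = a₀)] [Decidable (a ∈ D)] :
    ∫⁻ ω, expNeg (cachePenalty j a₀ D a (𝓗.cache a.1 a.2 ω)) ∂P =
      if a = a₀ then ENNReal.ofReal (𝓗.p a₀.1 j) else
        if a ∈ D then ENNReal.ofReal (1 - 𝓗.p a.1 j) else 1 := by
  have hm := 𝓗.measurableSet_mem_cache j a
  split_ifs with h1 h2
  · subst h1
    rw [← 𝓗.measure_mem_cache j a, ← lintegral_indicator_one hm]
    refine lintegral_congr fun ω => ?_
    by_cases hω : j ∈ 𝓗.cache a.1 a.2 ω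
    · rw [indicator_of_mem (by exact hω)]; simp [cachePenalty, hω]
    · rw [indicator_of_notMem (by exact hω)]; simp [cachePenalty, hω]
  · rw [← 𝓗.measure_notMem_cache j a, ← lintegral_indicator_one hm.compl]
    refine lintegral_congr fun ω => ?_
    by_cases hω : j ∈ 𝓗.cache a.1 a.2 ω
    · rw [indicator_of_notMem (by simpa using hω)]; simp [cachePenalty, hω, h1, h2]
    · rw [indicator_of_mem (by simpa using hω)]; simp [cachePenalty, hω, h1]
  · simp [cachePenalty, h1, h2]

/-- For fixed positions, the probability that the fading coefficient of the base station `a₀`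
exceeds the load, as a product over the base stations. -/
theorem measure_load_lt (j : Fin M) {a₀ : Fin N × ℕ} {D : Set (Fin N × ℕ)} (hD : a₀ ∉ D)
    (s : ℝ≥0∞) {w : Fin N × ℕ → ℝ≥0∞} (hw : w a₀ = 0) :
    P {ω | load j a₀ D s w (𝓗.marks ω) < ‖𝓗.h a₀.1 a₀.2 ω‖ₑ ^ 2} =
      ENNReal.ofReal (𝓗.p a₀.1 j) *
        expNeg (s + ∑' a, negLog (stationFactor (𝓗.p a.1 j) (a ∈ D) (w a))) := by
  classical
  let W : (Fin N × ℕ) ⊕ (Fin N × ℕ) → Ω → ℝ≥0∞ :=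
    Sum.elim (fun a ω => cachePenalty j a₀ D a (𝓗.cache a.1 a.2 ω))
      (fun a ω => w a * ‖𝓗.h a.1 a.2 ω‖ₑ ^ 2)
  let v : (Fin N × ℕ) ⊕ (Fin N × ℕ) → ℝ≥0∞ :=
    Sum.elim (fun a => negLog (if a = a₀ then ENNReal.ofReal (𝓗.p a₀.1 j) else
        if a ∈ D then ENNReal.ofReal (1 - 𝓗.p a.1 j) else 1))
      (fun a => negLog (1 + w a)⁻¹)
  have hload : ∀ ω, load j a₀ D s w (𝓗.marks ω) = s + ∑' b, W b ω := fun ω => by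
    rw [Summable.tsum_sum ENNReal.summable ENNReal.summable]
    rfl
  have hp1 : ∀ a : Fin N × ℕ, ENNReal.ofReal (𝓗.p a.1 j) ≤ 1 := fun a =>
    ENNReal.ofReal_le_one.2 (𝓗.p_le_one _ _)
  have hq1 : ∀ a : Fin N × ℕ,
      (if a ∈ D then ENNReal.ofReal (1 - 𝓗.p a.1 j) else 1) ≤ 1 := fun a => by
    split_ifs
    · exact ENNReal.ofReal_le_one.2 (by linarith [𝓗.p_nonneg a.1 j])
    · exact le_rfl
  have hw1 : ∀ a, (1 + w a)⁻¹ ≤ 1 := fun a => ENNReal.inv_le_one.2 le_self_add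
  have hWm : ∀ b, Measurable (W b) := by
    rintro (a | a)
    · exact (measurable_cachePenalty j a₀ D a).comp (𝓗.measurable_cache _ _)
    · have := 𝓗.measurable_h a.1 a.2
      change Measurable fun ω => w a * ‖𝓗.h a.1 a.2 ω‖ₑ ^ 2
      fun_prop
  have hWind : iIndepFun W P := by
    rw [iIndepFun_iff_iIndep]
    refine iIndep_of_iIndep_of_le (𝓗.iIndep_source.precomp
      (g := fun b => Sum.elim (fun a => .inr (.inl a)) (fun a => .inr (.inr (.inl a))) b) ?_) ?_
    · rintro (a | a) (b | b) hab <;> simp_all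
    · rintro (a | a)
      · rw [← measurable_iff_comap_le]
        exact (measurable_cachePenalty j a₀ D a).comp (comap_measurable _)
      · rw [← measurable_iff_comap_le]
        exact Measurable.comp (g := fun z : ℂ => w a * ‖z‖ₑ ^ 2) (by fun_prop) (comap_measurable _)
  have hmean : ∀ b, ∫⁻ ω, expNeg (W b ω) ∂P = expNeg (v b) := by
    rintro (a | a)
    · change ∫⁻ ω, expNeg (cachePenalty j a₀ D a (𝓗.cache a.1 a.2 ω)) ∂P = expNeg (negLog _)
      rw [𝓗.lintegral_expNeg_cachePenalty, expNeg_negLog]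
      split_ifs with h1 h2
      · exact hp1 _
      · exact ENNReal.ofReal_le_one.2 (by linarith [𝓗.p_nonneg a.1 j])
      · exact le_rfl
    · change ∫⁻ ω, expNeg (w a * ‖𝓗.h a.1 a.2 ω‖ₑ ^ 2) ∂P = expNeg (negLog _)
      rw [𝓗.lintegral_expNeg_fading, expNeg_negLog (hw1 a)]
  have hsum : ∑' b, v b = negLog (ENNReal.ofReal (𝓗.p a₀.1 j)) +
      ∑' a, negLog (stationFactor (𝓗.p a.1 j) (a ∈ D) (w a)) := by
    rw [Summable.tsum_sum ENNReal.summable ENNReal.summable,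
      ENNReal.tsum_eq_add_tsum_ite (f := fun a => v (.inl a)) a₀, add_assoc, ← ENNReal.tsum_add]
    congr 1
    · simp [v]
    · refine tsum_congr fun a => ?_
      rw [stationFactor, negLog_mul (by convert hq1 a) (hw1 a)]
      congr 1
      by_cases h1 : a = a₀
      · subst h1
        have : negLog 1 = 0 := expNeg_injective (by rw [expNeg_negLog le_rfl, expNeg_zero])
        simp [hD, this]
      · simp [h1, v]
  have hind : IndepFun (fun ω => load j a₀ D s w (𝓗.marks ω)) (𝓗.h a₀.1 a₀.2) P := by
    rw [IndepFun_iff_Indep]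
    refine indep_of_indep_of_le (indep_iSup_of_disjoint 𝓗.source_le 𝓗.iIndep_source
      (S := {.inr (.inr (.inl a₀))}ᶜ) (T := {.inr (.inr (.inl a₀))}) disjoint_compl_left) ?_
      (le_iSup₂_of_le (.inr (.inr (.inl a₀))) (mem_singleton _) le_rfl)
    rw [← measurable_iff_comap_le]
    simp_rw [hload]
    refine measurable_const_add_tsum ?_ s
    rintro (a | a)
    · have h1 : Measurable[𝓗.source (.inr (.inl a))] fun ω => 𝓗.cache a.1 a.2 ω :=
        comap_measurable _
      exact (measurable_cachePenalty j a₀ D a).comp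
        (h1.mono (le_iSup₂_of_le (.inr (.inl a)) (by simp) le_rfl) le_rfl)
    · by_cases ha : a = a₀
      · -- the fading coefficient of `a₀` itself has weight zero in the load
        have : W (.inr a) = fun _ => 0 := by
          funext ω
          simp [W, ha, hw]
        rw [this]
        exact measurable_const
      · have h1 : Measurable[𝓗.source (.inr (.inr (.inl a)))] fun ω => 𝓗.h a.1 a.2 ω :=
          comap_measurable _
        exact Measurable.comp (g := fun z : ℂ => w a * ‖z‖ₑ ^ 2) (by fun_prop)
          (h1.mono (le_iSup₂_of_le (.inr (.inr (.inl a))) (by simpa using ha) le_rfl) le_rfl)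
  have hTm : Measurable fun ω => load j a₀ D s w (𝓗.marks ω) := by
    simp_rw [hload]
    exact measurable_const_add_tsum hWm s
  have hprod := measure_prodMk_mem_of_indepFun hTm (𝓗.measurable_h a₀.1 a₀.2) hind
    (E := {q : ℝ≥0∞ × ℂ | q.1 < ‖q.2‖ₑ ^ 2}) (measurableSet_lt measurable_fst (by fun_prop))
  simp only [mem_ofPred_eq] at hprod
  rw [hprod]
  simp_rw [𝓗.measure_lt_fading, hload, expNeg_add]
  have hexp : Measurable fun ω => expNeg (∑' b, W b ω) :=
    measurable_expNeg.comp (Measurable.tsum hWm)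
  rw [lintegral_const_mul _ hexp,
    lintegral_expNeg_tsum hWm hWind hmean, hsum, expNeg_add, expNeg_negLog (hp1 a₀)]
  ring

end HetNet

/-! ### The mean number of candidate serving stations in a region -/

namespace HetNet

variable {N M : ℕ} {Ω : Type*} [MeasurableSpace Ω] {P : Measure Ω} (𝓗 : HetNet N M P)

/-- The ratio `(S_l / S_i)^(1/β)`: a base station of tier `l` at distance `ratio i l * r` is
received with the same average power as one of tier `i` at distance `r`. -/
def ratio (i l : Fin N) : ℝ := (𝓗.S l / 𝓗.S i) ^ (1 / 𝓗.β)

/-- The factor by which noise and interference are multiplied in the success condition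
`|h|² > θ r^β / S_i * (noise + interference)` of a base station of tier `i` at distance `r`. -/
def threshold (i : Fin N) (θ r : ℝ) : ℝ≥0∞ := ENNReal.ofReal (θ * r ^ 𝓗.β / 𝓗.S i)

/-- The base station of tier `l` at `x`, outside the part of tier `i` in `B`, would be preferred
to one of tier `i` at distance `r`. -/
def IsNear (i : Fin N) (r : ℝ) (B : Set Plane) (l : Fin N) (x : Plane) : Prop :=
  ¬(l = i ∧ x ∈ B) ∧ ‖x‖ₑ < ENNReal.ofReal (𝓗.ratio i l * r)

open Classical in
/-- The weight of the fading coefficient of the base station of tier `l` at `x` in the load; the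
base stations of tier `i` in `B` are not counted. -/
def weight (i : Fin N) (θ r : ℝ) (B : Set Plane) (l : Fin N) (x : Plane) : ℝ≥0∞ :=
  if l = i ∧ x ∈ B then 0 else
    𝓗.threshold i θ r * (ENNReal.ofReal (𝓗.S l) * ‖x‖ₑ ^ (-𝓗.β))

/-- The mean of `e^(-·)` of the contribution to the load of a base station of tier `l` at `x`. -/
def factor (i : Fin N) (j : Fin M) (θ r : ℝ) (B : Set Plane) (l : Fin N) (x : Plane) : ℝ≥0∞ :=
  stationFactor (𝓗.p l j) (𝓗.IsNear i r B l x) (𝓗.weight i θ r B l x)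

/-- The load at the base station `k` of tier `i`, as a function of positions and marks. -/
def candidateLoad (i : Fin N) (j : Fin M) (θ r : ℝ) (B : Set Plane) (k : ℕ)
    (q : Configuration N M) : ℝ≥0∞ :=
  load j (i, k) {a | 𝓗.IsNear i r B a.1 (q.1 a.1 a.2)}
    (𝓗.threshold i θ r * ENNReal.ofReal (𝓗.σ ^ 2))
    (fun a => 𝓗.weight i θ r B a.1 (q.1 a.1 a.2)) q.2

/-- The base station `k` of tier `i` lies in `B`, stores `j`, no base station that stores `j` is
near, and the fading coefficient is large enough for a success at distance `r`. -/
def candidate (i : Fin N) (j : Fin M) (θ r : ℝ) (B : Set Plane) (k : ℕ) : Set Ω :=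
  {ω | 𝓗.X i k ω ∈ B ∧
    𝓗.candidateLoad i j θ r B k (𝓗.pos ω, 𝓗.marks ω) < ‖𝓗.h i k ω‖ₑ ^ 2}

variable {i : Fin N} {j : Fin M} {θ r : ℝ} {B : Set Plane}

lemma measurableSet_isNear (hB : MeasurableSet B) (l : Fin N) :
    MeasurableSet {x | 𝓗.IsNear i r B l x} :=
  ((MeasurableSet.const (l = i)).inter hB).compl.inter
    (measurableSet_lt measurable_enorm measurable_const)

lemma measurable_weight (hB : MeasurableSet B) (l : Fin N) :
    Measurable (𝓗.weight i θ r B l) := by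
  classical
  unfold weight
  exact Measurable.ite ((MeasurableSet.const (l = i)).inter hB) measurable_const (by fun_prop)

lemma measurable_factor (hB : MeasurableSet B) (l : Fin N) :
    Measurable (𝓗.factor i j θ r B l) := by
  classical
  unfold factor stationFactor
  exact (Measurable.ite (𝓗.measurableSet_isNear hB l) measurable_const measurable_const).mul
    ((𝓗.measurable_weight hB l).const_add _).inv

lemma factor_eq_one_of_mem {x : Plane} (hx : x ∈ B) : 𝓗.factor i j θ r B i x = 1 := by
  simp [factor, stationFactor, IsNear, weight, hx]

lemma measurable_candidateLoad (hB : MeasurableSet B) (k : ℕ) :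
    Measurable (𝓗.candidateLoad i j θ r B k) := by
  classical
  have hpos : ∀ a : Fin N × ℕ, Measurable fun q : Configuration N M => q.1 a.1 a.2 := fun a =>
    (measurable_pi_apply a.2).comp ((measurable_pi_apply a.1).comp measurable_fst)
  have hcache : ∀ a : Fin N × ℕ, MeasurableSet {q : Configuration N M | j ∈ q.2.1 a} := fun a =>
    measurableSet_setOfPred.2 ((measurable_set_mem j).comp ((measurable_pi_apply a).comp
      (measurable_fst.comp measurable_snd)))
  unfold candidateLoad load
  refine Measurable.const_add (Measurable.add (Measurable.tsum fun a => ?_)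
    (Measurable.tsum fun a => ?_)) _
  · unfold cachePenalty
    refine Measurable.ite (.const _) (Measurable.ite (hcache a) measurable_const measurable_const)
      (Measurable.ite ?_ measurable_const measurable_const)
    exact (hpos a (𝓗.measurableSet_isNear hB a.1)).inter (hcache a)
  · refine ((𝓗.measurable_weight hB a.1).comp (hpos a)).mul ?_
    have : Measurable fun q : Configuration N M => q.2.2 a :=
      (measurable_pi_apply a).comp (measurable_snd.comp measurable_snd)
    fun_prop

lemma measurableSet_candidate (hB : MeasurableSet B) (k : ℕ) :
    MeasurableSet (𝓗.candidate i j θ r B k) := by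
  refine (𝓗.measurable_X i k hB).inter (measurableSet_lt
    ((𝓗.measurable_candidateLoad hB k).comp (𝓗.measurable_pos.prodMk 𝓗.measurable_marks)) ?_)
  have := 𝓗.measurable_h i k
  fun_prop

lemma factor_le_one (l : Fin N) (x : Plane) : 𝓗.factor i j θ r B l x ≤ 1 :=
  stationFactor_le_one (𝓗.p_nonneg _ _) _ _

variable [IsProbabilityMeasure P]

lemma measure_candidate (hB : MeasurableSet B) (k : ℕ) (A : Set ℕ∞) :
    P ({ω | pointCount (𝓗.X i) B ω ∈ A} ∩ 𝓗.candidate i j θ r B k) =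
      ∫⁻ ω, A.indicator (fun _ => 1) (pointCount (𝓗.X i) B ω) *
        B.indicator (fun _ => 1) (𝓗.X i k ω) * (ENNReal.ofReal (𝓗.p i j) *
          expNeg (𝓗.threshold i θ r * ENNReal.ofReal (𝓗.σ ^ 2) +
            ∑' a : Fin N × ℕ, negLog (𝓗.factor i j θ r B a.1 (𝓗.X a.1 a.2 ω)))) ∂P := by
  let E : Set (Configuration N M) :=
    {q | pointCount (fun m (x : Fin N → ℕ → Plane) => x i m) B q.1 ∈ A ∧ q.1 i k ∈ B ∧
      𝓗.candidateLoad i j θ r B k q < ‖q.2.2 (i, k)‖ₑ ^ 2}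
  have hx : ∀ m, Measurable fun x : Fin N → ℕ → Plane => x i m := fun m =>
    (measurable_pi_apply m).comp (measurable_pi_apply i)
  have hE : MeasurableSet E := by
    refine MeasurableSet.inter ?_ (MeasurableSet.inter ?_ (measurableSet_lt
      (𝓗.measurable_candidateLoad hB k) ?_))
    · exact ((measurable_pointCount hx hB).comp measurable_fst) (MeasurableSet.of_discrete (s := A))
    · exact ((hx k).comp measurable_fst) hB
    · have : Measurable fun q : Configuration N M => q.2.2 (i, k) :=
        (measurable_pi_apply (i, k)).comp (measurable_snd.comp measurable_snd)
      fun_prop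
  have h1 := measure_prodMk_mem_of_indepFun 𝓗.measurable_pos 𝓗.measurable_marks
    𝓗.indepFun_pos_marks hE
  have h2 : {ω | pointCount (𝓗.X i) B ω ∈ A} ∩ 𝓗.candidate i j θ r B k =
    {ω | (𝓗.pos ω, 𝓗.marks ω) ∈ E} := rfl
  rw [h2, h1]
  refine lintegral_congr fun ω => ?_
  by_cases hA : pointCount (𝓗.X i) B ω ∈ A
  · by_cases hk : 𝓗.X i k ω ∈ B
    · rw [indicator_of_mem hA, indicator_of_mem hk, one_mul, one_mul]
      have h3 : {ω' | (𝓗.pos ω, 𝓗.marks ω') ∈ E} = {ω' | load j (i, k)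
          {a | 𝓗.IsNear i r B a.1 (𝓗.pos ω a.1 a.2)}
          (𝓗.threshold i θ r * ENNReal.ofReal (𝓗.σ ^ 2))
          (fun a => 𝓗.weight i θ r B a.1 (𝓗.pos ω a.1 a.2)) (𝓗.marks ω') <
            ‖𝓗.h (i, k).1 (i, k).2 ω'‖ₑ ^ 2} := by
        ext ω'
        exact ⟨fun h => h.2.2, fun h => ⟨hA, hk, h⟩⟩
      rw [h3, 𝓗.measure_load_lt j]
      · rfl
      · exact fun h => h.1 ⟨rfl, hk⟩
      · exact if_pos ⟨rfl, hk⟩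
    · have h3 : {ω' | (𝓗.pos ω, 𝓗.marks ω') ∈ E} = ∅ := by
        ext ω'
        exact ⟨fun h => hk h.2.1, fun h => h.elim⟩
      rw [h3, indicator_of_notMem hk]
      simp
  · have h3 : {ω' | (𝓗.pos ω, 𝓗.marks ω') ∈ E} = ∅ := by
      ext ω'
      exact ⟨fun h => hA h.1, fun h => h.elim⟩
    rw [h3, indicator_of_notMem hA]
    simp

open Classical in
/-- The contribution of tier `l` with positions `x` to the mean number of candidates. -/
def tierFunctional (i : Fin N) (j : Fin M) (θ r : ℝ) (B : Set Plane) (ψ : ℕ∞ → ℝ≥0∞) (l : Fin N)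
    (x : ℕ → Plane) : ℝ≥0∞ :=
  (if l = i then ψ (pointCount (fun m (x : ℕ → Plane) => x m) B x) else 1) *
    expNeg (∑' m, negLog (𝓗.factor i j θ r B l (x m)))

omit [IsProbabilityMeasure P] in
lemma measurable_tierFunctional (hB : MeasurableSet B) (ψ : ℕ∞ → ℝ≥0∞) (l : Fin N) :
    Measurable (𝓗.tierFunctional i j θ r B ψ l) := by
  refine Measurable.mul ?_ (measurable_expNeg.comp (Measurable.tsum fun m =>
    (measurable_negLog.comp (𝓗.measurable_factor hB l)).comp (measurable_pi_apply m)))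
  split_ifs
  · exact (Measurable.of_discrete (f := ψ)).comp (measurable_pointCount measurable_pi_apply hB)
  · exact measurable_const

lemma lintegral_tierFunctional (hB : MeasurableSet B) (hv : volume B ≠ ∞) {ψ : ℕ∞ → ℝ≥0∞}
    (hψ : ∫⁻ ω, ψ (pointCount (𝓗.X i) B ω) ∂P ≠ ∞) (l : Fin N) [Decidable (l = i)] :
    ∫⁻ ω, 𝓗.tierFunctional i j θ r B ψ l (𝓗.pos ω l) ∂P =
      (if l = i then ∫⁻ ω, ψ (pointCount (𝓗.X i) B ω) ∂P else 1) *
        expNeg (ENNReal.ofReal (𝓗.lam l) * ∫⁻ x, (1 - 𝓗.factor i j θ r B l x)) := by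
  have hfac : ∀ x, 1 - 𝓗.factor i j θ r B l x =
      1 - expNeg (negLog (𝓗.factor i j θ r B l x)) := fun x => by
    rw [expNeg_negLog (𝓗.factor_le_one l x)]
  have hf : Measurable fun x => negLog (𝓗.factor i j θ r B l x) :=
    measurable_negLog.comp (𝓗.measurable_factor hB l)
  simp_rw [hfac]
  by_cases hl : l = i
  · subst hl
    simp only [tierFunctional, if_true]
    refine (𝓗.ppp l).lintegral_mul_expNeg_tsum hB hv hψ hf fun x hx => ?_
    refine expNeg_injective ?_
    rw [expNeg_negLog (𝓗.factor_le_one l x), 𝓗.factor_eq_one_of_mem hx, expNeg_zero]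
  · simp only [tierFunctional, if_neg hl]
    have := (𝓗.ppp l).lintegral_mul_expNeg_tsum (B := ∅) .empty (by simp)
      (ψ := fun _ => 1) (by simp) hf (by simp)
    simp only [one_mul, lintegral_one, measure_univ] at this ⊢
    exact this

omit [IsProbabilityMeasure P] in
lemma tsum_candidate_density (s : ℝ≥0∞) (A : Set ℕ∞) (ω : Ω) :
    ∑' k, A.indicator (fun _ => (1 : ℝ≥0∞)) (pointCount (𝓗.X i) B ω) *
        B.indicator (fun _ => 1) (𝓗.X i k ω) * (ENNReal.ofReal (𝓗.p i j) *
          expNeg (s + ∑' a : Fin N × ℕ, negLog (𝓗.factor i j θ r B a.1 (𝓗.X a.1 a.2 ω)))) =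
      (ENNReal.ofReal (𝓗.p i j) * expNeg s) *
        ∏ l, 𝓗.tierFunctional i j θ r B (A.indicator fun n => (n : ℝ≥0∞)) l (𝓗.pos ω l) := by
  classical
  have h1 : A.indicator (fun _ => (1 : ℝ≥0∞)) (pointCount (𝓗.X i) B ω) *
      (pointCount (𝓗.X i) B ω : ℝ≥0∞) =
      A.indicator (fun n => (n : ℝ≥0∞)) (pointCount (𝓗.X i) B ω) := by
    by_cases hA : pointCount (𝓗.X i) B ω ∈ A <;> simp [hA]
  have h2 : ∏ l, 𝓗.tierFunctional i j θ r B (A.indicator fun n => (n : ℝ≥0∞)) l (𝓗.pos ω l) =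
      A.indicator (fun n => (n : ℝ≥0∞)) (pointCount (𝓗.X i) B ω) *
        ∏ l, expNeg (∑' m, negLog (𝓗.factor i j θ r B l (𝓗.X l m ω))) := by
    simp only [tierFunctional]
    rw [Finset.prod_mul_distrib, Finset.prod_eq_single i (fun l _ hl => if_neg hl) (by simp),
      if_pos rfl]
    rfl
  rw [ENNReal.tsum_mul_right, ENNReal.tsum_mul_left, ← toENNReal_pointCount, expNeg_add,
    ENNReal.tsum_prod (f := fun l m => negLog (𝓗.factor i j θ r B l (𝓗.X l m ω))), tsum_fintype,
    expNeg_sum, h1, h2]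
  ring

/-- The mean number of candidate serving stations in `B`, on the event that the number of base
stations of tier `i` in `B` belongs to `A`. -/
theorem tsum_measure_candidate (hB : MeasurableSet B) (hv : volume B ≠ ∞) (A : Set ℕ∞) :
    ∑' k, P ({ω | pointCount (𝓗.X i) B ω ∈ A} ∩ 𝓗.candidate i j θ r B k) =
      (∫⁻ ω, A.indicator (fun n => (n : ℝ≥0∞)) (pointCount (𝓗.X i) B ω) ∂P) *
        (ENNReal.ofReal (𝓗.p i j) *
          expNeg (𝓗.threshold i θ r * ENNReal.ofReal (𝓗.σ ^ 2) +
            ∑ l, ENNReal.ofReal (𝓗.lam l) * ∫⁻ x, (1 - 𝓗.factor i j θ r B l x))) := by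
  classical
  have hN : Measurable (pointCount (𝓗.X i) B) := measurable_pointCount (𝓗.measurable_X i) hB
  have hNA : Measurable fun ω => A.indicator (fun _ => (1 : ℝ≥0∞)) (pointCount (𝓗.X i) B ω) :=
    (Measurable.of_discrete (f := A.indicator fun _ => (1 : ℝ≥0∞))).comp hN
  have hXB : ∀ k, Measurable fun ω => B.indicator (fun _ => (1 : ℝ≥0∞)) (𝓗.X i k ω) := fun k =>
    (measurable_const.indicator hB).comp (𝓗.measurable_X i k)
  have hf : ∀ a : Fin N × ℕ, Measurable fun ω =>
      negLog (𝓗.factor i j θ r B a.1 (𝓗.X a.1 a.2 ω)) := fun a =>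
    measurable_negLog.comp ((𝓗.measurable_factor hB a.1).comp (𝓗.measurable_X a.1 a.2))
  have hF : Measurable fun ω => expNeg (𝓗.threshold i θ r * ENNReal.ofReal (𝓗.σ ^ 2) +
      ∑' a : Fin N × ℕ, negLog (𝓗.factor i j θ r B a.1 (𝓗.X a.1 a.2 ω))) :=
    measurable_expNeg.comp (measurable_const_add_tsum hf _)
  have hmean : ∫⁻ ω, A.indicator (fun n => (n : ℝ≥0∞)) (pointCount (𝓗.X i) B ω) ∂P ≠ ∞ := by
    refine ne_top_of_le_ne_top ?_ (lintegral_mono fun ω =>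
      indicator_le_self' (fun _ _ => zero_le) _)
    rw [(𝓗.ppp i).lintegral_pointCount_id hB hv]
    exact ENNReal.mul_ne_top ENNReal.ofReal_ne_top hv
  have hm : ∀ l, Measurable fun ω => 𝓗.tierFunctional i j θ r B
      (A.indicator fun n => (n : ℝ≥0∞)) l (𝓗.pos ω l) := fun l =>
    (𝓗.measurable_tierFunctional hB _ l).comp ((measurable_pi_apply l).comp 𝓗.measurable_pos)
  have hterm : ∀ k, Measurable fun ω =>
      A.indicator (fun _ => (1 : ℝ≥0∞)) (pointCount (𝓗.X i) B ω) *
        B.indicator (fun _ => 1) (𝓗.X i k ω) * (ENNReal.ofReal (𝓗.p i j) *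
          expNeg (𝓗.threshold i θ r * ENNReal.ofReal (𝓗.σ ^ 2) +
            ∑' a : Fin N × ℕ, negLog (𝓗.factor i j θ r B a.1 (𝓗.X a.1 a.2 ω)))) := fun k =>
    (hNA.mul (hXB k)).mul (hF.const_mul _)
  simp_rw [𝓗.measure_candidate hB]
  rw [← lintegral_tsum fun k => (hterm k).aemeasurable]
  simp_rw [𝓗.tsum_candidate_density]
  rw [lintegral_const_mul _ (Finset.measurable_prod _ fun l _ => hm l),
    lintegral_prod_eq_prod_lintegral_of_indepFun _
      (fun l ω => 𝓗.tierFunctional i j θ r B (A.indicator fun n => (n : ℝ≥0∞)) l (𝓗.pos ω l))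
      (𝓗.iIndepFun_pos.comp _ fun l => 𝓗.measurable_tierFunctional hB _ l) hm,
    Finset.prod_congr rfl fun l _ => 𝓗.lintegral_tierFunctional hB hv hmean l,
    Finset.prod_mul_distrib, Finset.prod_eq_single i (fun l _ hl => if_neg hl) (by simp),
    if_pos rfl, ← expNeg_sum]
  simp_rw [expNeg_add]
  ring

end HetNet

/-! ### Candidates and the serving station -/

namespace HetNet

variable {N M : ℕ} {Ω : Type*} [MeasurableSpace Ω] {P : Measure Ω} (𝓗 : HetNet N M P)

/-- The user is associated with tier `i` for file `j`, and the received power exceeds `θ` times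
the noise plus interference. -/
def served (i : Fin N) (j : Fin M) (θ : ℝ) : Set Ω :=
  𝓗.assoc i j ∩ {ω | ENNReal.ofReal θ * (ENNReal.ofReal (𝓗.σ ^ 2) + ∑ l, 𝓗.interference i j l ω) <
    ENNReal.ofReal (𝓗.S i) * ‖𝓗.h i (𝓗.serving i j ω) ω‖ₑ ^ 2 * 𝓗.dist i j ω ^ (-𝓗.β)}

/-- The annulus of the points at distance at least `a` and less than `b` from the origin. -/
def annulus (a b : ℝ) : Set Plane := {x | ENNReal.ofReal a ≤ ‖x‖ₑ ∧ ‖x‖ₑ < ENNReal.ofReal b}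

variable {i : Fin N} {j : Fin M} {θ r a b : ℝ} {ω : Ω} {k : ℕ}

lemma β_pos : 0 < 𝓗.β := by linarith [𝓗.two_lt_β]

lemma ratio_pos (i l : Fin N) : 0 < 𝓗.ratio i l :=
  Real.rpow_pos_of_pos (div_pos (𝓗.S_pos l) (𝓗.S_pos i)) _

lemma ratio_self (i : Fin N) : 𝓗.ratio i i = 1 := by
  rw [ratio, div_self (𝓗.S_pos i).ne', Real.one_rpow]

lemma ratio_rpow (i l : Fin N) : 𝓗.ratio i l ^ 𝓗.β = 𝓗.S l / 𝓗.S i := by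
  rw [ratio, ← Real.rpow_mul (div_pos (𝓗.S_pos l) (𝓗.S_pos i)).le, one_div,
    inv_mul_cancel₀ 𝓗.β_pos.ne', Real.rpow_one]

lemma ratio_sq (i l : Fin N) : 𝓗.ratio i l ^ 2 = (𝓗.S l / 𝓗.S i) ^ (2 / 𝓗.β) := by
  rw [ratio, ← Real.rpow_natCast, ← Real.rpow_mul (div_pos (𝓗.S_pos l) (𝓗.S_pos i)).le]
  congr 1
  push_cast
  ring

/-- Comparison of the average received powers in terms of distances. -/
lemma power_lt_power_iff (i l : Fin N) (x y : ℝ≥0∞) :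
    ENNReal.ofReal (𝓗.S l) * y ^ (-𝓗.β) < ENNReal.ofReal (𝓗.S i) * x ^ (-𝓗.β) ↔
      ENNReal.ofReal (𝓗.ratio i l) * x < y := by
  have hβ := 𝓗.β_pos
  have hρ := 𝓗.ratio_pos i l
  have hS : ENNReal.ofReal (𝓗.S l) =
      ENNReal.ofReal (𝓗.S i) * ENNReal.ofReal (𝓗.ratio i l) ^ 𝓗.β := by
    rw [ENNReal.ofReal_rpow_of_pos hρ, ratio_rpow, ← ENNReal.ofReal_mul (𝓗.S_pos i).le,
      mul_div_cancel₀ _ (𝓗.S_pos i).ne']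
  have hρ0 : ENNReal.ofReal (𝓗.ratio i l) ≠ 0 := by simpa using hρ
  have hy : ENNReal.ofReal (𝓗.S l) * y ^ (-𝓗.β) =
      ENNReal.ofReal (𝓗.S i) * ((y / ENNReal.ofReal (𝓗.ratio i l)) ^ 𝓗.β)⁻¹ := by
    rw [hS, mul_assoc, ENNReal.div_rpow_of_nonneg _ _ hβ.le, ENNReal.inv_div
      (Or.inl (by simp [hβ.le])) (Or.inl (by simp [hρ, hβ])),
      ENNReal.rpow_neg, div_eq_mul_inv]
  rw [hy, ENNReal.rpow_neg, ENNReal.mul_lt_mul_iff_right (by simpa using 𝓗.S_pos i)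
    ENNReal.ofReal_ne_top, ENNReal.inv_lt_inv, ENNReal.rpow_lt_rpow_iff hβ,
    ENNReal.lt_div_iff_mul_lt (Or.inl hρ0) (Or.inl ENNReal.ofReal_ne_top), mul_comm]

lemma dist_le {l : Fin N} (hk : j ∈ 𝓗.cache l k ω) : 𝓗.dist l j ω ≤ ‖𝓗.X l k ω‖ₑ :=
  iInf₂_le k hk

/-- If the serving station lies in `B`, its power is excluded from the load, as it is from the
interference. -/
lemma tsum_weight_mul_le (i : Fin N) (j : Fin M) (θ r : ℝ) (B : Set Plane) (ω : Ω)
    (hB : 𝓗.X i (𝓗.serving i j ω) ω ∈ B) :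
    ∑' a : Fin N × ℕ, 𝓗.weight i θ r B a.1 (𝓗.X a.1 a.2 ω) * ‖𝓗.h a.1 a.2 ω‖ₑ ^ 2 ≤
      𝓗.threshold i θ r * ∑ l, 𝓗.interference i j l ω := by
  classical
  rw [ENNReal.tsum_prod (f := fun l m => 𝓗.weight i θ r B l (𝓗.X l m ω) * ‖𝓗.h l m ω‖ₑ ^ 2),
    tsum_fintype, Finset.mul_sum]
  refine Finset.sum_le_sum fun l _ => ?_
  rw [interference, ← ENNReal.tsum_mul_left]
  refine ENNReal.tsum_le_tsum fun m => ?_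
  rw [weight]
  split_ifs with h1 h2 h2
  · simp
  · simp
  · obtain ⟨rfl, rfl⟩ := h2
    exact absurd ⟨rfl, hB⟩ h1
  · exact le_of_eq (by ring)

/-- If no other base station of tier `i` lies in `B`, the load counts the whole interference. -/
lemma le_tsum_weight_mul (i : Fin N) (j : Fin M) (θ r : ℝ) {B : Set Plane} {ω : Ω}
    (hB : ∀ m, 𝓗.X i m ω ∈ B → m = 𝓗.serving i j ω) :
    𝓗.threshold i θ r * ∑ l, 𝓗.interference i j l ω ≤
      ∑' a : Fin N × ℕ, 𝓗.weight i θ r B a.1 (𝓗.X a.1 a.2 ω) * ‖𝓗.h a.1 a.2 ω‖ₑ ^ 2 := by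
  classical
  rw [ENNReal.tsum_prod (f := fun l m => 𝓗.weight i θ r B l (𝓗.X l m ω) * ‖𝓗.h l m ω‖ₑ ^ 2),
    tsum_fintype, Finset.mul_sum]
  refine Finset.sum_le_sum fun l _ => ?_
  rw [interference, ← ENNReal.tsum_mul_left]
  refine ENNReal.tsum_le_tsum fun m => ?_
  rw [weight]
  split_ifs with h1 h2 h2
  · simp
  · simp
  · exact absurd ⟨h2.1, hB m (h2.1 ▸ h2.2)⟩ h1
  · exact le_of_eq (by ring)

lemma threshold_mul_eq (hθ : 0 ≤ θ) (hr : 0 ≤ r) :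
    𝓗.threshold i θ r * ENNReal.ofReal (𝓗.S i) = ENNReal.ofReal θ * ENNReal.ofReal r ^ 𝓗.β := by
  rw [threshold, ← ENNReal.ofReal_mul (by have := 𝓗.S_pos i; positivity),
    div_mul_cancel₀ _ (𝓗.S_pos i).ne', ENNReal.ofReal_mul hθ,
    ENNReal.ofReal_rpow_of_nonneg hr 𝓗.β_pos.le]

/-- A candidate at distance less than `b` whose annulus contains no other base station of its tier
is the serving station, and the transmission succeeds. -/
lemma served_of_candidate (hθ : 0 ≤ θ) (hb : 0 < b)
    (hN : pointCount (𝓗.X i) (annulus a b) ω = 1) (hk : ω ∈ 𝓗.candidate i j θ b (annulus a b) k) :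
    ω ∈ 𝓗.served i j θ ∧ ENNReal.ofReal a ≤ 𝓗.dist i j ω ∧
      𝓗.dist i j ω < ENNReal.ofReal b := by
  obtain ⟨hkB, hload⟩ := hk
  have huniq : ∀ m, 𝓗.X i m ω ∈ annulus a b → m = k := by
    obtain ⟨m₀, hm₀⟩ := encard_eq_one.1 hN
    intro m hm
    have h1 : m ∈ ({m₀} : Set ℕ) := hm₀ ▸ hm
    have h2 : k ∈ ({m₀} : Set ℕ) := hm₀ ▸ hkB
    rw [mem_singleton_iff] at h1 h2
    rw [h1, h2]
  -- the load is finite, so no cache penalty is infinite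
  have hpen : ∀ c : Fin N × ℕ, cachePenalty j (i, k)
      {c | 𝓗.IsNear i b (annulus a b) c.1 (𝓗.pos ω c.1 c.2)} c (𝓗.cache c.1 c.2 ω) ≠ ∞ := by
    intro c hc
    refine hload.ne_top (top_unique ?_)
    refine (hc.symm.le.trans (ENNReal.le_tsum c)).trans (le_self_add.trans le_add_self)
  have hcache : j ∈ 𝓗.cache i k ω := by
    by_contra h
    exact hpen (i, k) (by simp [cachePenalty, h])
  have hfar : ∀ l m, (l, m) ≠ (i, k) → j ∈ 𝓗.cache l m ω →
      ENNReal.ofReal (𝓗.ratio i l * b) ≤ ‖𝓗.X l m ω‖ₑ := by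
    intro l m hne hm
    by_contra! hlt
    have hout : ¬(l = i ∧ 𝓗.X l m ω ∈ annulus a b) := by
      rintro ⟨rfl, hmB⟩
      exact hne (by rw [huniq m hmB])
    refine hpen (l, m) ?_
    rw [cachePenalty, if_neg hne, if_pos ⟨⟨hout, hlt⟩, hm⟩]
  have hfar' : ∀ m, m ≠ k → j ∈ 𝓗.cache i m ω → ENNReal.ofReal b ≤ ‖𝓗.X i m ω‖ₑ := by
    intro m hne hm
    have := hfar i m (by simpa using hne) hm
    rwa [ratio_self, one_mul] at this
  have hdist : 𝓗.dist i j ω = ‖𝓗.X i k ω‖ₑ := by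
    refine le_antisymm (𝓗.dist_le hcache) (le_iInf₂ fun m hm => ?_)
    by_cases hmk : m = k
    · rw [hmk]
    · exact hkB.2.le.trans (hfar' m hmk hm)
  have hserv : 𝓗.serving i j ω = k := by
    have : {m | j ∈ 𝓗.cache i m ω ∧ ‖𝓗.X i m ω‖ₑ = 𝓗.dist i j ω} = {k} := by
      ext m
      refine ⟨fun hm => ?_, ?_⟩
      · by_contra hmk
        exact absurd (hfar' m hmk hm.1) (by rw [hm.2, hdist]; exact not_le.2 hkB.2)
      · rintro rfl
        exact ⟨hcache, hdist.symm⟩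
    rw [serving, this, csInf_singleton]
  refine ⟨⟨⟨⟨k, hcache⟩, fun l hl => ?_⟩, ?_⟩, hdist ▸ hkB⟩
  · rw [power_lt_power_iff, hdist]
    refine lt_of_lt_of_le ?_ (le_iInf₂ fun m hm => hfar l m (by simp [hl]) hm)
    rw [ENNReal.ofReal_mul (𝓗.ratio_pos i l).le]
    exact (ENNReal.mul_lt_mul_iff_right (by simpa using 𝓗.ratio_pos i l)
      ENNReal.ofReal_ne_top).2 hkB.2
  · have h1 : 𝓗.threshold i θ b * (ENNReal.ofReal (𝓗.σ ^ 2) + ∑ l, 𝓗.interference i j l ω) <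
        ‖𝓗.h i k ω‖ₑ ^ 2 := by
      refine lt_of_le_of_lt ?_ hload
      rw [mul_add]
      refine add_le_add le_rfl ((𝓗.le_tsum_weight_mul i j θ b
        (fun m hm => (huniq m hm).trans hserv.symm)).trans le_add_self)
    have hb0 : ENNReal.ofReal b ≠ 0 := by simpa using hb
    have hbpow : ENNReal.ofReal b ^ 𝓗.β * ENNReal.ofReal b ^ (-𝓗.β) = 1 := by
      rw [← ENNReal.rpow_add _ _ hb0 ENNReal.ofReal_ne_top, add_neg_cancel, ENNReal.rpow_zero]
    have hc0 : ENNReal.ofReal (𝓗.S i) * ENNReal.ofReal b ^ (-𝓗.β) ≠ 0 := by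
      refine mul_ne_zero (by simpa using 𝓗.S_pos i) ?_
      intro h
      rw [h, mul_zero] at hbpow
      exact zero_ne_one hbpow
    have hct : ENNReal.ofReal (𝓗.S i) * ENNReal.ofReal b ^ (-𝓗.β) ≠ ∞ :=
      ENNReal.mul_ne_top ENNReal.ofReal_ne_top (ENNReal.rpow_ne_top_of_ne_zero hb0
        ENNReal.ofReal_ne_top)
    have h2 := (ENNReal.mul_lt_mul_iff_right hc0 hct).2 h1
    rw [mem_ofPred_eq, hserv, hdist]
    calc ENNReal.ofReal θ * (ENNReal.ofReal (𝓗.σ ^ 2) + ∑ l, 𝓗.interference i j l ω)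
        = ENNReal.ofReal (𝓗.S i) * ENNReal.ofReal b ^ (-𝓗.β) * (𝓗.threshold i θ b *
          (ENNReal.ofReal (𝓗.σ ^ 2) + ∑ l, 𝓗.interference i j l ω)) := by
          rw [← mul_assoc, mul_right_comm (ENNReal.ofReal (𝓗.S i)),
            mul_comm (ENNReal.ofReal (𝓗.S i)), 𝓗.threshold_mul_eq hθ hb.le,
            mul_assoc (ENNReal.ofReal θ) (_ ^ _), hbpow, mul_one]
      _ < ENNReal.ofReal (𝓗.S i) * ENNReal.ofReal b ^ (-𝓗.β) * ‖𝓗.h i k ω‖ₑ ^ 2 := h2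
      _ ≤ ENNReal.ofReal (𝓗.S i) * ‖𝓗.h i k ω‖ₑ ^ 2 * ‖𝓗.X i k ω‖ₑ ^ (-𝓗.β) := by
          rw [mul_right_comm, ENNReal.rpow_neg, ENNReal.rpow_neg]
          exact mul_le_mul_right
            (ENNReal.inv_le_inv.2 (ENNReal.rpow_le_rpow hkB.2.le 𝓗.β_pos.le)) _

/-- The serving station is a candidate. -/
lemma exists_candidate_of_served (hθ : 0 ≤ θ) (ha : 0 ≤ a) (hω : ω ∈ 𝓗.served i j θ)
    (hat : ∃ k, j ∈ 𝓗.cache i k ω ∧ ‖𝓗.X i k ω‖ₑ = 𝓗.dist i j ω)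
    (hda : ENNReal.ofReal a ≤ 𝓗.dist i j ω) (hdb : 𝓗.dist i j ω < ENNReal.ofReal b) :
    ∃ k, ω ∈ 𝓗.candidate i j θ a (annulus a b) k := by
  obtain ⟨hassoc, hsucc⟩ := hω
  have hs : j ∈ 𝓗.cache i (𝓗.serving i j ω) ω ∧
      ‖𝓗.X i (𝓗.serving i j ω) ω‖ₑ = 𝓗.dist i j ω := Nat.sInf_mem hat
  have hB : 𝓗.X i (𝓗.serving i j ω) ω ∈ annulus a b := by
    rw [annulus, mem_ofPred_eq, hs.2]
    exact ⟨hda, hdb⟩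
  refine ⟨𝓗.serving i j ω, hB, ?_⟩
  have hpen : ∀ c : Fin N × ℕ, cachePenalty j (i, 𝓗.serving i j ω)
      {c | 𝓗.IsNear i a (annulus a b) c.1 (𝓗.pos ω c.1 c.2)} c (𝓗.cache c.1 c.2 ω) = 0 := by
    rintro ⟨l, m⟩
    rw [cachePenalty]
    split_ifs with h1 h2 h3
    · rfl
    · rw [Prod.ext_iff] at h1
      obtain ⟨rfl, rfl⟩ : l = i ∧ m = 𝓗.serving i j ω := h1
      exact absurd hs.1 h2
    · exfalso
      obtain ⟨⟨-, hlt⟩, hm⟩ := h3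
      have hle : 𝓗.dist l j ω ≤ ‖𝓗.X l m ω‖ₑ := 𝓗.dist_le hm
      have hlt' : ‖𝓗.X l m ω‖ₑ < ENNReal.ofReal (𝓗.ratio i l) * ENNReal.ofReal a := by
        rw [← ENNReal.ofReal_mul (𝓗.ratio_pos i l).le]; exact hlt
      by_cases hl : l = i
      · subst hl
        rw [ratio_self, ENNReal.ofReal_one, one_mul] at hlt'
        exact absurd (hda.trans hle) (not_le.2 hlt')
      · have := (𝓗.power_lt_power_iff i l _ _).1 (hassoc.2 l hl)
        refine absurd (hlt'.trans_le ?_) (not_lt.2 (this.le.trans hle))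
        gcongr
    · rfl
  have hh : ‖𝓗.h i (𝓗.serving i j ω) ω‖ₑ ^ 2 ≠ 0 := by
    intro h0
    rw [mem_ofPred_eq, h0, mul_zero, zero_mul] at hsucc
    exact not_lt_zero hsucc
  have h1 : 𝓗.candidateLoad i j θ a (annulus a b) (𝓗.serving i j ω) (𝓗.pos ω, 𝓗.marks ω) ≤
      𝓗.threshold i θ a * (ENNReal.ofReal (𝓗.σ ^ 2) + ∑ l, 𝓗.interference i j l ω) := by
    rw [mul_add]
    refine add_le_add le_rfl ?_
    refine le_trans (le_of_eq ?_) (𝓗.tsum_weight_mul_le i j θ a (annulus a b) ω hB)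
    exact (congrArg (· + _) (ENNReal.tsum_eq_zero.2 hpen)).trans (zero_add _)
  refine h1.trans_lt ?_
  rcases ha.eq_or_lt with rfl | ha
  · rw [threshold, Real.zero_rpow 𝓗.β_pos.ne', mul_zero, zero_div, ENNReal.ofReal_zero, zero_mul]
    exact pos_iff_ne_zero.2 hh
  · have ha0 : ENNReal.ofReal a ≠ 0 := by simpa using ha
    have hS0 : ENNReal.ofReal (𝓗.S i) ≠ 0 := by simpa using 𝓗.S_pos i
    have hap0 : ENNReal.ofReal a ^ 𝓗.β ≠ 0 := by simp [ha0]
    have hapt : ENNReal.ofReal a ^ 𝓗.β ≠ ∞ := by simp [𝓗.β_pos.le]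
    have h2 := (ENNReal.mul_lt_mul_iff_right hap0 hapt).2 hsucc
    rw [← ENNReal.mul_lt_mul_iff_right hS0 ENNReal.ofReal_ne_top]
    calc ENNReal.ofReal (𝓗.S i) * (𝓗.threshold i θ a *
          (ENNReal.ofReal (𝓗.σ ^ 2) + ∑ l, 𝓗.interference i j l ω))
        = ENNReal.ofReal a ^ 𝓗.β * (ENNReal.ofReal θ *
          (ENNReal.ofReal (𝓗.σ ^ 2) + ∑ l, 𝓗.interference i j l ω)) := by
          rw [← mul_assoc, mul_comm (ENNReal.ofReal (𝓗.S i)), 𝓗.threshold_mul_eq hθ ha.le]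
          ring
      _ < _ := h2
      _ = ENNReal.ofReal (𝓗.S i) * ‖𝓗.h i (𝓗.serving i j ω) ω‖ₑ ^ 2 *
          (ENNReal.ofReal a ^ 𝓗.β / 𝓗.dist i j ω ^ 𝓗.β) := by
          rw [ENNReal.rpow_neg, div_eq_mul_inv]
          ring
      _ ≤ ENNReal.ofReal (𝓗.S i) * ‖𝓗.h i (𝓗.serving i j ω) ω‖ₑ ^ 2 * 1 := by
          gcongr
          exact ENNReal.div_le_of_le_mul (by
            rw [one_mul]; exact ENNReal.rpow_le_rpow hda 𝓗.β_pos.le)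
      _ = _ := mul_one _

end HetNet

/-! ### Measurability of the events -/

lemma measurable_sInf_nat {α : Type*} [MeasurableSpace α] {R : ℕ → Set α}
    (hR : ∀ k, MeasurableSet (R k)) : Measurable fun x => sInf {k | x ∈ R k} := by
  have hle : ∀ x n, n < sInf {k | x ∈ R k} ↔
      (∃ k, x ∈ R k) ∧ ∀ k ≤ n, x ∉ R k := fun x n => by
    constructor
    · intro h
      refine ⟨?_, fun k hk hx => absurd (Nat.sInf_le (s := {k | x ∈ R k}) hx) (by omega)⟩
      by_contra! hne
      have : {k | x ∈ R k} = ∅ := by ext k; simpa using hne k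
      rw [this, Nat.sInf_empty] at h
      omega
    · rintro ⟨hne, h⟩
      by_contra! hlt
      exact h _ hlt (Nat.sInf_mem hne)
  refine measurable_of_Ioi fun n => ?_
  have : (fun x => sInf {k | x ∈ R k}) ⁻¹' Ioi n = (⋃ k, R k) ∩ ⋂ k, ⋂ (_ : k ≤ n), (R k)ᶜ := by
    ext x
    simpa using hle x n
  rw [this]
  exact (MeasurableSet.iUnion hR).inter
    (MeasurableSet.iInter fun k => MeasurableSet.iInter fun _ => (hR k).compl)

namespace HetNet

variable {N M : ℕ}

section Configuration

/-- The distance to the nearest base station of tier `l` storing `j`, as a function of the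
configuration. -/
def confDist (l : Fin N) (j : Fin M) (q : Configuration N M) : ℝ≥0∞ :=
  ⨅ (k : ℕ) (_ : j ∈ q.2.1 (l, k)), ‖q.1 l k‖ₑ

/-- The number of the serving base station, as a function of the configuration. -/
def confServing (i : Fin N) (j : Fin M) (q : Configuration N M) : ℕ :=
  sInf {k | j ∈ q.2.1 (i, k) ∧ ‖q.1 i k‖ₑ = confDist i j q}

lemma measurable_conf_pos (a : Fin N × ℕ) : Measurable fun q : Configuration N M => q.1 a.1 a.2 :=
  (measurable_pi_apply a.2).comp ((measurable_pi_apply a.1).comp measurable_fst)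

lemma measurable_conf_fading (a : Fin N × ℕ) : Measurable fun q : Configuration N M => q.2.2 a :=
  (measurable_pi_apply a).comp (measurable_snd.comp measurable_snd)

lemma measurableSet_conf_cache (j : Fin M) (a : Fin N × ℕ) :
    MeasurableSet {q : Configuration N M | j ∈ q.2.1 a} :=
  measurableSet_setOfPred.2 ((measurable_set_mem j).comp ((measurable_pi_apply a).comp
    (measurable_fst.comp measurable_snd)))

lemma measurable_confDist (l : Fin N) (j : Fin M) :
    Measurable (confDist l j : Configuration N M → ℝ≥0∞) := by
  classical
  refine Measurable.iInf fun k => ?_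
  simp_rw [iInf_eq_if]
  exact Measurable.ite (measurableSet_conf_cache j (l, k)) (measurable_conf_pos (l, k)).enorm
    measurable_const

lemma measurable_confServing (i : Fin N) (j : Fin M) :
    Measurable (confServing i j : Configuration N M → ℕ) :=
  measurable_sInf_nat (R := fun k =>
    {q : Configuration N M | j ∈ q.2.1 (i, k) ∧ ‖q.1 i k‖ₑ = confDist i j q}) fun k =>
    (measurableSet_conf_cache j (i, k)).inter
      (measurableSet_eq_fun (measurable_conf_pos (i, k)).enorm (measurable_confDist i j))

end Configuration

variable {Ω : Type*} [MeasurableSpace Ω] {P : Measure Ω} (𝓗 : HetNet N M P)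
variable {i : Fin N} {j : Fin M} {θ r a b : ℝ} {ω : Ω} {k : ℕ}

open Classical in
/-- The interference from tier `l`, as a function of the configuration. -/
def confInterference (i : Fin N) (j : Fin M) (l : Fin N) (q : Configuration N M) : ℝ≥0∞ :=
  ∑' k : ℕ, if l = i ∧ k = confServing i j q then 0 else
    ENNReal.ofReal (𝓗.S l) * ‖q.2.2 (l, k)‖ₑ ^ 2 * ‖q.1 l k‖ₑ ^ (-𝓗.β)

/-- Association with tier `i`, as a set of configurations. -/
def confAssoc (i : Fin N) (j : Fin M) : Set (Configuration N M) :=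
  {q | (∃ k, j ∈ q.2.1 (i, k)) ∧ ∀ l, l ≠ i →
    ENNReal.ofReal (𝓗.S l) * confDist l j q ^ (-𝓗.β) <
      ENNReal.ofReal (𝓗.S i) * confDist i j q ^ (-𝓗.β)}

/-- The success condition of `served`, as a set of configurations. -/
def confSuccess (i : Fin N) (j : Fin M) (θ : ℝ) : Set (Configuration N M) :=
  {q | ENNReal.ofReal θ * (ENNReal.ofReal (𝓗.σ ^ 2) + ∑ l, 𝓗.confInterference i j l q) <
    ENNReal.ofReal (𝓗.S i) * ‖q.2.2 (i, confServing i j q)‖ₑ ^ 2 * confDist i j q ^ (-𝓗.β)}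

lemma measurable_confInterference (i : Fin N) (j : Fin M) (l : Fin N) :
    Measurable (𝓗.confInterference i j l) := by
  classical
  refine Measurable.tsum fun k => Measurable.ite ?_ measurable_const ?_
  · exact (MeasurableSet.const (l = i)).inter
      (measurableSet_eq_fun measurable_const (measurable_confServing i j))
  · have h1 := measurable_conf_fading (M := M) (l, k)
    have h2 := measurable_conf_pos (M := M) (l, k)
    fun_prop

lemma measurableSet_confAssoc (i : Fin N) (j : Fin M) : MeasurableSet (𝓗.confAssoc i j) := by
  have h1 : 𝓗.confAssoc i j = (⋃ k, {q | j ∈ q.2.1 (i, k)}) ∩ ⋂ l, ⋂ (_ : l ≠ i),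
      {q | ENNReal.ofReal (𝓗.S l) * confDist l j q ^ (-𝓗.β) <
        ENNReal.ofReal (𝓗.S i) * confDist i j q ^ (-𝓗.β)} := by
    ext q
    simp [confAssoc]
  rw [h1]
  refine (MeasurableSet.iUnion fun k => measurableSet_conf_cache j (i, k)).inter
    (MeasurableSet.iInter fun l => MeasurableSet.iInter fun _ => ?_)
  exact measurableSet_lt (((measurable_confDist l j).pow_const _).const_mul _)
    (((measurable_confDist i j).pow_const _).const_mul _)

lemma measurableSet_confSuccess (i : Fin N) (j : Fin M) (θ : ℝ) :
    MeasurableSet (𝓗.confSuccess i j θ) := by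
  refine measurableSet_lt (((Finset.measurable_sum _ fun l _ =>
    𝓗.measurable_confInterference i j l).const_add _).const_mul _) ?_
  refine Measurable.mul (Measurable.const_mul ?_ _) ((measurable_confDist i j).pow_const _)
  have h1 : Measurable fun q : Configuration N M × ℕ => q.1.2.2 (i, q.2) :=
    measurable_from_prod_countable_left fun k => measurable_conf_fading (i, k)
  exact ((h1.comp (measurable_id.prodMk (measurable_confServing i j))).enorm).pow_const 2

lemma measurable_configuration : Measurable fun ω => (𝓗.pos ω, 𝓗.marks ω) :=
  𝓗.measurable_pos.prodMk 𝓗.measurable_marks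

lemma assoc_eq_preimage (i : Fin N) (j : Fin M) :
    𝓗.assoc i j = (fun ω => (𝓗.pos ω, 𝓗.marks ω)) ⁻¹' 𝓗.confAssoc i j := rfl

lemma served_eq_preimage (i : Fin N) (j : Fin M) (θ : ℝ) : 𝓗.served i j θ =
    (fun ω => (𝓗.pos ω, 𝓗.marks ω)) ⁻¹' (𝓗.confAssoc i j ∩ 𝓗.confSuccess i j θ) := rfl

lemma dist_eq_comp (l : Fin N) (j : Fin M) :
    𝓗.dist l j = confDist l j ∘ fun ω => (𝓗.pos ω, 𝓗.marks ω) := rfl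

lemma measurable_dist (l : Fin N) (j : Fin M) : Measurable (𝓗.dist l j) := by
  rw [dist_eq_comp]
  exact (measurable_confDist l j).comp 𝓗.measurable_configuration

lemma measurableSet_assoc (i : Fin N) (j : Fin M) : MeasurableSet (𝓗.assoc i j) := by
  rw [assoc_eq_preimage]
  exact 𝓗.measurable_configuration (𝓗.measurableSet_confAssoc i j)

lemma measurableSet_served (i : Fin N) (j : Fin M) (θ : ℝ) : MeasurableSet (𝓗.served i j θ) := by
  rw [served_eq_preimage]
  exact 𝓗.measurable_configuration
    ((𝓗.measurableSet_confAssoc i j).inter (𝓗.measurableSet_confSuccess i j θ))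

lemma success_eq_preimage (i : Fin N) (j : Fin M) : 𝓗.success i j =
    (fun ω => (𝓗.pos ω, 𝓗.marks ω)) ⁻¹' 𝓗.confSuccess i j 𝓗.τ := by
  ext ω
  exact ENNReal.lt_div_iff_mul_lt (Or.inr ENNReal.ofReal_ne_top)
    (Or.inr (by simpa using 𝓗.τ_pos))

lemma measurableSet_success (i : Fin N) (j : Fin M) : MeasurableSet (𝓗.success i j) := by
  rw [success_eq_preimage]
  exact 𝓗.measurable_configuration (𝓗.measurableSet_confSuccess i j _)

lemma served_τ (i : Fin N) (j : Fin M) : 𝓗.served i j 𝓗.τ = 𝓗.assoc i j ∩ 𝓗.success i j := by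
  rw [success_eq_preimage]
  rfl

lemma dist_lt_top_of_assoc (hω : ω ∈ 𝓗.assoc i j) : 𝓗.dist i j ω < ∞ := by
  obtain ⟨k, hk⟩ := hω.1
  exact (𝓗.dist_le hk).trans_lt enorm_lt_top

/-- The user is associated with at most one tier. -/
lemma assoc_unique {i' : Fin N} (h : ω ∈ 𝓗.assoc i j) (h' : ω ∈ 𝓗.assoc i' j) : i = i' := by
  by_contra hne
  exact lt_asymm (h.2 i' (Ne.symm hne)) (h'.2 i hne)

variable [IsProbabilityMeasure P]

lemma ae_fading_ne_zero : ∀ᵐ ω ∂P, ∀ i k, 𝓗.h i k ω ≠ 0 := by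
  refine ae_all_iff.2 fun i => ae_all_iff.2 fun k => ?_
  have h1 := 𝓗.measure_lt_fading (i, k) 0
  rw [expNeg_zero] at h1
  have hm : MeasurableSet {ω | 0 < ‖𝓗.h i k ω‖ₑ ^ 2} := by
    have := 𝓗.measurable_h i k
    exact measurableSet_lt measurable_const (by fun_prop)
  have h2 := (mem_ae_iff_prob_eq_one hm).2 h1
  filter_upwards [h2] with ω hω h0
  simp [h0] at hω

/-- With threshold zero the transmission almost surely succeeds. -/
lemma served_zero_ae (i : Fin N) (j : Fin M) : 𝓗.served i j 0 =ᵐ[P] 𝓗.assoc i j := by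
  filter_upwards [𝓗.ae_fading_ne_zero] with ω hω
  refine propext ⟨fun h => h.1, fun h => ⟨h, ?_⟩⟩
  rw [mem_ofPred_eq, ENNReal.ofReal_zero, zero_mul, pos_iff_ne_zero]
  refine mul_ne_zero (mul_ne_zero (by simpa using 𝓗.S_pos i) (by simpa using hω i _)) ?_
  rw [ENNReal.rpow_neg]
  refine ENNReal.inv_ne_zero.2 ?_
  exact (ENNReal.rpow_lt_top_of_nonneg 𝓗.β_pos.le (𝓗.dist_lt_top_of_assoc h).ne).ne

/-- Almost surely the distance to the nearest base station storing `j` is attained, because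
bounded regions contain finitely many base stations. -/
lemma ae_dist_attained (i : Fin N) (j : Fin M) : ∀ᵐ ω ∂P, (∃ k, j ∈ 𝓗.cache i k ω) →
    ∃ k, j ∈ 𝓗.cache i k ω ∧ ‖𝓗.X i k ω‖ₑ = 𝓗.dist i j ω := by
  have hfin : ∀ᵐ ω ∂P, ∀ n : ℕ, {k | 𝓗.X i k ω ∈ Metric.ball (0 : Plane) n}.Finite := by
    refine ae_all_iff.2 fun n => ?_
    have hv : volume (Metric.ball (0 : Plane) n) ≠ ∞ := measure_ball_lt_top.ne
    have h1 : ∫⁻ ω, (pointCount (𝓗.X i) (Metric.ball 0 n) ω : ℝ≥0∞) ∂P ≠ ∞ := by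
      rw [(𝓗.ppp i).lintegral_pointCount_id measurableSet_ball hv]
      exact ENNReal.mul_ne_top ENNReal.ofReal_ne_top hv
    have hm := measurable_pointCount (𝓗.measurable_X i) (measurableSet_ball (x := (0 : Plane))
      (ε := n))
    filter_upwards [ae_lt_top (Measurable.of_discrete.comp hm) h1] with ω hω
    rw [← encard_lt_top_iff]
    exact ENat.toENNReal_lt_top.1 hω
  filter_upwards [hfin] with ω hω
  rintro ⟨k₀, hk₀⟩
  obtain ⟨n, hn⟩ := exists_nat_gt ‖𝓗.X i k₀ ω‖
  have hmem : k₀ ∈ {k | 𝓗.X i k ω ∈ Metric.ball (0 : Plane) n} ∩ {k | j ∈ 𝓗.cache i k ω} :=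
    ⟨mem_ball_zero_iff.2 hn, hk₀⟩
  obtain ⟨k, hk, hmin⟩ := exists_min_image _ (fun k => ‖𝓗.X i k ω‖ₑ) ((hω n).inter_of_left _)
    ⟨k₀, hmem⟩
  refine ⟨k, hk.2, le_antisymm (le_iInf₂ fun m hm => ?_) (𝓗.dist_le hk.2)⟩
  by_cases hmn : 𝓗.X i m ω ∈ Metric.ball (0 : Plane) n
  · exact hmin m ⟨hmn, hm⟩
  · refine (hmin k₀ hmem).trans ?_
    rw [enorm_le_iff_norm_le]
    exact hn.le.trans (not_lt.1 fun h => hmn (mem_ball_zero_iff.2 h))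

end HetNet

/-! ### The radial integrals -/

/-- One minus the mean factor by which a base station at distance `y` reduces the success
probability. The unit of length is the distance below which the base station is preferred to the
serving one: for `y < 1` it must not store the file, which has probability `1 - p`, and its
interference contributes the factor `(1 + θ y^(-β))⁻¹`. -/
def radialDefect (p θ β y : ℝ) : ℝ := 1 - (if y < 1 then 1 - p else 1) * (1 + θ * y ^ (-β))⁻¹

/-- The integral of the radial defect over the plane, divided by `π`. -/
def areaCoef (p θ β : ℝ) : ℝ := 2 * ∫ y in Ioi (0 : ℝ), y * radialDefect p θ β y

section

variable {p θ β y : ℝ}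

lemma radialDefect_nonneg (hp : 0 ≤ p) (hθ : 0 ≤ θ) (hy : 0 < y) :
    0 ≤ radialDefect p θ β y := by
  have h1 : 0 ≤ θ * y ^ (-β) := mul_nonneg hθ (Real.rpow_nonneg hy.le _)
  rw [radialDefect, sub_nonneg]
  refine mul_le_one₀ ?_ (inv_nonneg.2 (by linarith)) (inv_le_one_of_one_le₀ (by linarith))
  split_ifs <;> linarith

lemma radialDefect_le_one (hp1 : p ≤ 1) (hθ : 0 ≤ θ) (hy : 0 < y) :
    radialDefect p θ β y ≤ 1 := by
  have h1 : 0 ≤ θ * y ^ (-β) := mul_nonneg hθ (Real.rpow_nonneg hy.le _)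
  rw [radialDefect, sub_le_self_iff]
  refine mul_nonneg ?_ (inv_nonneg.2 (by linarith))
  split_ifs <;> linarith

lemma radialDefect_le_rpow (hθ : 0 ≤ θ) (hy : 1 ≤ y) :
    radialDefect p θ β y ≤ θ * y ^ (-β) := by
  have h1 : 0 ≤ θ * y ^ (-β) := mul_nonneg hθ (Real.rpow_nonneg (by linarith) _)
  rw [radialDefect, if_neg (not_lt.2 hy), one_mul, sub_le_iff_le_add]
  have h2 : (1 + θ * y ^ (-β)) * (1 + θ * y ^ (-β))⁻¹ = 1 := mul_inv_cancel₀ (by linarith)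
  have h3 : 0 < (1 + θ * y ^ (-β))⁻¹ := inv_pos.2 (by linarith)
  have h4 : (1 + θ * y ^ (-β))⁻¹ ≤ 1 := inv_le_one_of_one_le₀ (by linarith)
  nlinarith

lemma measurable_radialDefect : Measurable (radialDefect p θ β) := by
  unfold radialDefect
  refine measurable_const.sub (Measurable.mul (Measurable.ite measurableSet_Iio
    measurable_const measurable_const) ?_)
  fun_prop

lemma integrableOn_mul_radialDefect (hp : 0 ≤ p) (hp1 : p ≤ 1) (hθ : 0 ≤ θ) (hβ : 2 < β) :
    IntegrableOn (fun y => y * radialDefect p θ β y) (Ioi 0) := by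
  have hm : Measurable fun y => y * radialDefect p θ β y :=
    measurable_id.mul measurable_radialDefect
  rw [← Ioc_union_Ioi_eq_Ioi zero_le_one]
  refine IntegrableOn.union ?_ ?_
  · refine Integrable.mono' (g := fun _ => (1 : ℝ)) (by simp) hm.aestronglyMeasurable
      ((ae_restrict_iff' measurableSet_Ioc).2 (ae_of_all _ fun y hy => ?_))
    rw [Real.norm_of_nonneg (mul_nonneg hy.1.le (radialDefect_nonneg hp hθ hy.1))]
    exact mul_le_one₀ hy.2 (radialDefect_nonneg hp hθ hy.1) (radialDefect_le_one hp1 hθ hy.1)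
  · refine Integrable.mono' (g := fun y => θ * y ^ (1 - β))
      ((integrableOn_Ioi_rpow_of_lt (by linarith) one_pos).const_mul θ) hm.aestronglyMeasurable
      ((ae_restrict_iff' measurableSet_Ioi).2 (ae_of_all _ fun y (hy : 1 < y) => ?_))
    have hy0 : 0 < y := by linarith
    rw [Real.norm_of_nonneg (mul_nonneg hy0.le (radialDefect_nonneg hp hθ hy0)),
      sub_eq_add_neg, Real.rpow_add hy0, Real.rpow_one]
    have := mul_le_mul_of_nonneg_left (radialDefect_le_rpow (p := p) (β := β) hθ hy.le) hy0.le
    linarith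

lemma areaCoef_nonneg (hp : 0 ≤ p) (hθ : 0 ≤ θ) : 0 ≤ areaCoef p θ β :=
  mul_nonneg zero_le_two (setIntegral_nonneg measurableSet_Ioi fun _ hy =>
    mul_nonneg (le_of_lt hy) (radialDefect_nonneg hp hθ hy))

/-- Integration of a scaled radial defect in polar coordinates. -/
lemma lintegral_radialDefect (hp : 0 ≤ p) (hp1 : p ≤ 1) (hθ : 0 ≤ θ) (hβ : 2 < β) {c : ℝ}
    (hc : 0 < c) : ∫⁻ x : Plane, ENNReal.ofReal (radialDefect p θ β (c⁻¹ * ‖x‖)) =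
      ENNReal.ofReal (Real.pi * c ^ 2 * areaCoef p θ β) := by
  have hscale : ∀ y : ℝ, y * radialDefect p θ β (c⁻¹ * y) =
      c * (fun y => y * radialDefect p θ β y) (c⁻¹ * y) := fun y => by
    rw [← mul_assoc, ← mul_assoc, mul_inv_cancel₀ hc.ne', one_mul]
  have hint : Integrable fun x : Plane => radialDefect p θ β (c⁻¹ * ‖x‖) := by
    rw [integrable_fun_norm_addHaar volume (f := fun s => radialDefect p θ β (c⁻¹ * s))]
    simp only [finrank_euclideanSpace, Fintype.card_fin, Nat.add_one_sub_one, pow_one, smul_eq_mul]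
    simp_rw [hscale]
    refine Integrable.const_mul ?_ c
    have := integrableOn_Ioi_comp_mul_left_iff (fun y => y * radialDefect p θ β y) 0
      (inv_pos.2 hc)
    rw [mul_zero] at this
    exact this.2 (integrableOn_mul_radialDefect hp hp1 hθ hβ)
  have hnn : ∀ᵐ x : Plane, 0 ≤ radialDefect p θ β (c⁻¹ * ‖x‖) := by
    filter_upwards [Measure.ae_ne volume (0 : Plane)] with x hx
    exact radialDefect_nonneg hp hθ (mul_pos (inv_pos.2 hc) (norm_pos_iff.2 hx))
  rw [← ofReal_integral_eq_lintegral_ofReal hint hnn,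
    integral_fun_norm_addHaar volume (fun s => radialDefect p θ β (c⁻¹ * s))]
  congr 1
  have hball : volume.real (Metric.ball (0 : Plane) 1) = Real.pi := by
    rw [measureReal_def, EuclideanSpace.volume_ball_fin_two]
    simp [Real.pi_pos.le]
  simp only [finrank_euclideanSpace, Fintype.card_fin, Nat.add_one_sub_one, pow_one, smul_eq_mul,
    hball, nsmul_eq_mul, Nat.cast_ofNat]
  simp_rw [hscale]
  rw [integral_const_mul, integral_comp_mul_left_Ioi (fun y => y * radialDefect p θ β y) 0
    (inv_pos.2 hc), mul_zero, inv_inv, smul_eq_mul, areaCoef]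
  ring

end

namespace HetNet

variable {N M : ℕ} {Ω : Type*} [MeasurableSpace Ω] {P : Measure Ω} (𝓗 : HetNet N M P)
variable {i : Fin N} {j : Fin M} {θ r a b : ℝ}

lemma factor_empty_eq [IsProbabilityMeasure P] (hθ : 0 ≤ θ) (hr : 0 < r) (l : Fin N) {x : Plane}
    (hx : x ≠ 0) : 1 - 𝓗.factor i j θ r ∅ l x =
      ENNReal.ofReal (radialDefect (𝓗.p l j) θ 𝓗.β ((𝓗.ratio i l * r)⁻¹ * ‖x‖)) := by
  have hρ := 𝓗.ratio_pos i l
  have hc : 0 < 𝓗.ratio i l * r := mul_pos hρ hr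
  have hx' : 0 < ‖x‖ := norm_pos_iff.2 hx
  have hnear : 𝓗.IsNear i r ∅ l x ↔ (𝓗.ratio i l * r)⁻¹ * ‖x‖ < 1 := by
    rw [IsNear, ← ofReal_norm, ENNReal.ofReal_lt_ofReal_iff_of_nonneg hx'.le,
      inv_mul_lt_iff₀ hc, mul_one]
    simp
  have hw : 𝓗.weight i θ r ∅ l x =
      ENNReal.ofReal (θ * ((𝓗.ratio i l * r)⁻¹ * ‖x‖) ^ (-𝓗.β)) := by
    rw [weight, if_neg (by simp), threshold, ← ofReal_norm, ENNReal.ofReal_rpow_of_pos hx',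
      ← ENNReal.ofReal_mul (𝓗.S_pos l).le,
      ← ENNReal.ofReal_mul (by have := 𝓗.S_pos i; positivity)]
    congr 1
    rw [Real.mul_rpow (inv_nonneg.2 hc.le) hx'.le, Real.inv_rpow hc.le, Real.rpow_neg hc.le,
      inv_inv, Real.mul_rpow hρ.le hr.le, ratio_rpow]
    ring
  have hu : 0 ≤ θ * ((𝓗.ratio i l * r)⁻¹ * ‖x‖) ^ (-𝓗.β) := by positivity
  rw [factor, stationFactor, hw, radialDefect]
  have h1 : (1 + ENNReal.ofReal (θ * ((𝓗.ratio i l * r)⁻¹ * ‖x‖) ^ (-𝓗.β)))⁻¹ =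
      ENNReal.ofReal (1 + θ * ((𝓗.ratio i l * r)⁻¹ * ‖x‖) ^ (-𝓗.β))⁻¹ := by
    rw [ENNReal.ofReal_inv_of_pos (by linarith), ENNReal.ofReal_add zero_le_one hu,
      ENNReal.ofReal_one]
  have h2 : (0 : ℝ) ≤ 1 - 𝓗.p l j := by linarith [𝓗.p_le_one l j]
  have h3 : 0 ≤ (1 + θ * ((𝓗.ratio i l * r)⁻¹ * ‖x‖) ^ (-𝓗.β))⁻¹ := inv_nonneg.2 (by linarith)
  rw [h1]
  simp only [hnear]
  split_ifs
  · rw [← ENNReal.ofReal_mul h2, ENNReal.ofReal_sub _ (mul_nonneg h2 h3), ENNReal.ofReal_one]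
  · rw [one_mul, one_mul, ENNReal.ofReal_sub _ h3, ENNReal.ofReal_one]

lemma lintegral_factor_empty [IsProbabilityMeasure P] (hθ : 0 ≤ θ) (hr : 0 ≤ r) (l : Fin N) :
    ∫⁻ x, (1 - 𝓗.factor i j θ r ∅ l x) =
      ENNReal.ofReal (Real.pi * (𝓗.ratio i l * r) ^ 2 * areaCoef (𝓗.p l j) θ 𝓗.β) := by
  rcases hr.eq_or_lt with rfl | hr
  · -- at radius zero no base station is near and the threshold vanishes, so each factor is `1`
    have : ∀ x, 1 - 𝓗.factor i j θ 0 ∅ l x = 0 := fun x => by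
      simp [factor, stationFactor, IsNear, weight, threshold, Real.zero_rpow 𝓗.β_pos.ne']
    simp [this]
  · rw [← lintegral_radialDefect (𝓗.p_nonneg l j) (𝓗.p_le_one l j) hθ 𝓗.two_lt_β
      (mul_pos (𝓗.ratio_pos i l) hr)]
    refine lintegral_congr_ae ?_
    filter_upwards [Measure.ae_ne volume (0 : Plane)] with x hx
    exact 𝓗.factor_empty_eq hθ hr l hx

lemma factor_empty_le (l : Fin N) (B : Set Plane) (x : Plane) [IsProbabilityMeasure P] :
    𝓗.factor i j θ r ∅ l x ≤ 𝓗.factor i j θ r B l x := by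
  by_cases h : l = i ∧ x ∈ B
  · obtain ⟨rfl, hx⟩ := h
    rw [𝓗.factor_eq_one_of_mem hx]
    exact 𝓗.factor_le_one l x
  · simp [factor, stationFactor, IsNear, weight, h]

lemma one_sub_factor_empty_le (l : Fin N) (B : Set Plane) (x : Plane) [IsProbabilityMeasure P]
    [Decidable (l = i)] :
    1 - 𝓗.factor i j θ r ∅ l x ≤
      (1 - 𝓗.factor i j θ r B l x) + if l = i then B.indicator 1 x else 0 := by
  by_cases h : l = i ∧ x ∈ B
  · rw [if_pos h.1, indicator_of_mem h.2]
    exact tsub_le_self.trans le_add_self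
  · have : 𝓗.factor i j θ r ∅ l x = 𝓗.factor i j θ r B l x := by
      simp [factor, stationFactor, IsNear, weight, h]
    rw [this]
    exact le_self_add

end HetNet

/-! ### Evaluation of the radial integrals -/

section

variable {p τ β : ℝ}

lemma image_rpow_neg_Ioi_one (hβ : 0 < β) : (fun y : ℝ => y ^ (-β)) '' Ioi 1 = Ioo 0 1 := by
  ext t
  constructor
  · rintro ⟨y, hy, rfl⟩
    exact ⟨Real.rpow_pos_of_pos (zero_lt_one.trans hy) _,
      Real.rpow_lt_one_of_one_lt_of_neg hy (neg_lt_zero.2 hβ)⟩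
  · rintro ⟨h0, h1⟩
    refine ⟨t ^ (-β)⁻¹, Real.one_lt_rpow_of_pos_of_lt_one_of_neg h0 h1
      (inv_lt_zero.2 (neg_lt_zero.2 hβ)), ?_⟩
    exact Real.rpow_inv_rpow h0.le (neg_ne_zero.2 hβ.ne')

lemma image_div_add_rpow (hτ : 0 < τ) (hβ : 0 < β) :
    (fun y : ℝ => y ^ β / (y ^ β + τ)) '' Ioi 0 = Ioo 0 1 := by
  ext u
  constructor
  · rintro ⟨y, hy, rfl⟩
    have h := Real.rpow_pos_of_pos hy β
    exact ⟨by positivity, (div_lt_one (by positivity)).2 (by linarith)⟩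
  · rintro ⟨h0, h1⟩
    have h2 : 0 < 1 - u := sub_pos.2 h1
    have h3 : 0 < τ * u / (1 - u) := by positivity
    refine ⟨(τ * u / (1 - u)) ^ β⁻¹, Real.rpow_pos_of_pos h3 _, ?_⟩
    simp only [Real.rpow_inv_rpow h3.le hβ.ne']
    field_simp
    ring

lemma injOn_div_add_rpow (hτ : 0 < τ) (hβ : 0 < β) :
    InjOn (fun y : ℝ => y ^ β / (y ^ β + τ)) (Ioi 0) := by
  intro x hx y hy h
  have h1 := Real.rpow_pos_of_pos hx β
  have h2 := Real.rpow_pos_of_pos hy β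
  refine Real.rpow_left_injOn hβ.ne' hx.out.le hy.out.le ?_
  simp only at h ⊢
  rw [div_eq_div_iff (by positivity) (by positivity)] at h
  nlinarith

lemma one_sub_inv_one_add_mul_rpow_neg (hτ : 0 < τ) {y : ℝ} (hy : 0 < y) :
    1 - (1 + τ * y ^ (-β))⁻¹ = τ / (y ^ β + τ) := by
  have h := Real.rpow_pos_of_pos hy β
  rw [Real.rpow_neg hy.le]
  field_simp
  ring

/-- Interference without any association constraint: the integral over the plane is a Beta
integral. -/
lemma areaCoef_zero_left (hτ : 0 < τ) (hβ : 2 < β) : areaCoef 0 τ β = coefD τ β := by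
  have hβ0 : 0 < β := by linarith
  have h1 : betaFunction (2 / β) (1 - 2 / β) =
      β * τ ^ (-(2 / β)) * ∫ y in Ioi 0, y * radialDefect 0 τ β y := by
    -- the substitution `μ = y ^ β / (y ^ β + τ)`
    rw [betaFunction, intervalIntegral.integral_of_le zero_le_one, integral_Ioc_eq_integral_Ioo,
      ← image_div_add_rpow hτ hβ0, integral_image_eq_integral_abs_deriv_smul measurableSet_Ioi
        (f' := fun y => β * y ^ (β - 1) * τ / (y ^ β + τ) ^ 2) _ (injOn_div_add_rpow hτ hβ0),
      ← integral_const_mul]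
    · refine setIntegral_congr_fun measurableSet_Ioi fun y (hy : 0 < y) => ?_
      have hyβ := Real.rpow_pos_of_pos hy β
      have hs : 0 < y ^ β + τ := by positivity
      have h2 : 1 - y ^ β / (y ^ β + τ) = τ / (y ^ β + τ) := by
        field_simp
        ring
      have h3 : radialDefect 0 τ β y = τ / (y ^ β + τ) := by
        rw [← one_sub_inv_one_add_mul_rpow_neg hτ hy, radialDefect]
        simp
      have h4 : 0 ≤ β * y ^ (β - 1) * τ / (y ^ β + τ) ^ 2 := by positivity
      have h5 : (y ^ β) ^ (2 / β - 1) = y ^ (2 - β) := by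
        rw [← Real.rpow_mul hy.le]
        congr 1
        field_simp
      have h6 : (y ^ β + τ) ^ (2 / β - 1) * (y ^ β + τ) ^ (1 - 2 / β - 1) = (y ^ β + τ)⁻¹ := by
        rw [← Real.rpow_add hs, ← Real.rpow_neg_one]
        ring_nf
      have h7 : y ^ (β - 1) * y ^ (2 - β) = y := by
        rw [← Real.rpow_add hy, show β - 1 + (2 - β) = 1 by ring, Real.rpow_one]
      have h8 : τ ^ (1 - 2 / β - 1) = τ ^ (-(2 / β)) := by ring_nf
      rw [abs_of_nonneg h4, smul_eq_mul, h2, h3, Real.div_rpow hyβ.le hs.le,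
        Real.div_rpow hτ.le hs.le, h5, h8]
      have h9 := Real.rpow_pos_of_pos hs (2 / β - 1)
      have h10 := Real.rpow_pos_of_pos hs (1 - 2 / β - 1)
      have h11 : (y ^ β + τ) ^ (2 / β - 1) * (y ^ β + τ) ^ (1 - 2 / β - 1) * (y ^ β + τ) = 1 := by
        rw [h6, inv_mul_cancel₀ hs.ne']
      rw [div_mul_div_comm, div_mul_div_comm, mul_div_assoc', mul_div_assoc',
        div_eq_div_iff (by positivity) (by positivity)]
      linear_combination (β * τ * τ ^ (-(2 / β)) * (y ^ β + τ)) * h7 -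
        (β * τ * τ ^ (-(2 / β)) * (y ^ β + τ) * y) * h11
    · intro y (hy : 0 < y)
      have hyβ := Real.rpow_pos_of_pos hy β
      have h2 := Real.hasDerivAt_rpow_const (x := y) (p := β) (Or.inl hy.ne')
      refine ((h2.div (h2.add_const τ) (by positivity)).congr_deriv ?_).hasDerivWithinAt
      ring
  have h2 : τ ^ (2 / β) * τ ^ (-(2 / β)) = 1 := by
    rw [← Real.rpow_add hτ, add_neg_cancel, Real.rpow_zero]
  rw [coefD, h1, areaCoef]
  have h3 : 2 / β * β = 2 := div_mul_cancel₀ 2 hβ0.ne'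
  linear_combination (-(∫ y in Ioi 0, y * radialDefect 0 τ β y) * (2 / β * β)) * h2 -
    (∫ y in Ioi 0, y * radialDefect 0 τ β y) * h3

/-- The interference from outside of a disc is a hypergeometric integral. -/
lemma integral_Ioi_one_radialDefect (hτ : 0 < τ) (hβ : 2 < β) :
    2 * ∫ y in Ioi 1, y * radialDefect p τ β y = coefH τ β := by
  have hβ0 : 0 < β := by linarith
  have hb : 0 < 1 - 2 / β := sub_pos.2 ((div_lt_one hβ0).2 hβ)
  -- the substitution `t = y ^ (-β)` in Euler's integral
  rw [coefH, show 2 - 2 / β = 1 - 2 / β + 1 by ring,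
    gaussHypergeometric_eq_eulerIntegral hb (by linarith : -τ < 1), integral_Ioc_eq_integral_Ioo,
    ← image_rpow_neg_Ioi_one hβ0, integral_image_eq_integral_abs_deriv_smul measurableSet_Ioi
      (f' := fun y => -β * y ^ (-β - 1)), ← integral_const_mul, ← integral_const_mul,
      ← integral_const_mul]
  · refine setIntegral_congr_fun measurableSet_Ioi fun y (hy : 1 < y) => ?_
    have hy0 : 0 < y := by linarith
    have hyβ := Real.rpow_pos_of_pos hy0 β
    have h3 : radialDefect p τ β y = τ / (y ^ β + τ) := by
      rw [← one_sub_inv_one_add_mul_rpow_neg hτ hy0, radialDefect, if_neg (not_lt.2 hy.le), one_mul]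
    have h4 : |(-β) * y ^ (-β - 1)| = β * y ^ (-β - 1) := by
      rw [abs_mul, abs_neg, abs_of_pos hβ0, abs_of_pos (Real.rpow_pos_of_pos hy0 _)]
    have h5 : (1 - -τ * y ^ (-β))⁻¹ = y ^ β / (y ^ β + τ) := by
      rw [Real.rpow_neg hy0.le, neg_mul, sub_neg_eq_add, ← div_eq_mul_inv, ← inv_div]
      field_simp
    have h6 : (y ^ (-β)) ^ (1 - 2 / β - 1) = y ^ (2 : ℝ) := by
      rw [← Real.rpow_mul hy0.le]
      congr 1
      field_simp
      ring
    have h7 : y ^ (-β - 1) * (y ^ (2 : ℝ) * y ^ β) = y := by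
      rw [← Real.rpow_add hy0, ← Real.rpow_add hy0, show -β - 1 + (2 + β) = 1 by ring,
        Real.rpow_one]
    rw [h3, h4, h5, h6, smul_eq_mul]
    have hβ2 : β - 2 ≠ 0 := by linarith
    have h8 : 2 * τ / (β - 2) * ((1 - 2 / β) * β) = 2 * τ := by
      field_simp
    have h9 : (y ^ β + τ) ≠ 0 := by positivity
    calc 2 * (y * (τ / (y ^ β + τ))) = (2 * τ) * (y / (y ^ β + τ)) := by ring
      _ = (2 * τ / (β - 2) * ((1 - 2 / β) * β)) *
        ((y ^ (-β - 1) * (y ^ (2 : ℝ) * y ^ β)) / (y ^ β + τ)) := by rw [h7, h8]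
      _ = _ := by ring
  · intro y (hy : 1 < y)
    exact (Real.hasDerivAt_rpow_const (Or.inl (by linarith))).hasDerivWithinAt
  · intro x (hx : 1 < x) y (hy : 1 < y) h
    exact Real.rpow_left_injOn (neg_ne_zero.2 hβ0.ne') (by simp; linarith) (by simp; linarith) h

/-- If every base station stores the file, the unit disc must be empty. -/
lemma integral_Ioc_radialDefect_one {θ : ℝ} :
    2 * ∫ y in Ioc 0 1, y * radialDefect 1 θ β y = 1 := by
  have h1 : ∫ y in Ioc (0 : ℝ) 1, y * radialDefect 1 θ β y = ∫ y in Ioc (0 : ℝ) 1, y := by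
    rw [integral_Ioc_eq_integral_Ioo, integral_Ioc_eq_integral_Ioo]
    refine setIntegral_congr_fun measurableSet_Ioo fun y hy => ?_
    simp [radialDefect, hy.2]
  rw [h1, ← intervalIntegral.integral_of_le zero_le_one, integral_id]
  norm_num

lemma areaCoef_eq_interpolation {θ : ℝ} (hθ : 0 ≤ θ) (hβ : 2 < β) :
    areaCoef p θ β = (1 - p) * areaCoef 0 θ β + p * areaCoef 1 θ β := by
  have h0 := integrableOn_mul_radialDefect (p := 0) le_rfl zero_le_one hθ hβ
  have h1 := integrableOn_mul_radialDefect (p := 1) zero_le_one le_rfl hθ hβ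
  have h : ∀ y, y * radialDefect p θ β y =
      (1 - p) * (y * radialDefect 0 θ β y) + p * (y * radialDefect 1 θ β y) := fun y => by
    simp only [radialDefect]
    split_ifs <;> ring
  simp_rw [areaCoef, h]
  rw [integral_add (h0.const_mul _) (h1.const_mul _), integral_const_mul, integral_const_mul]
  ring

lemma areaCoef_eq (hτ : 0 < τ) (hβ : 2 < β) :
    areaCoef p τ β = p * coefH τ β + (1 - p) * coefD τ β + p := by
  have h1 : areaCoef 1 τ β = 1 + coefH τ β := by
    have h := integrableOn_mul_radialDefect (p := 1) zero_le_one le_rfl hτ.le hβ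
    rw [areaCoef, ← Ioc_union_Ioi_eq_Ioi zero_le_one, setIntegral_union Ioc_disjoint_Ioi_same
      measurableSet_Ioi (h.mono_set Ioc_subset_Ioi_self)
      (h.mono_set (Ioi_subset_Ioi zero_le_one)), mul_add, integral_Ioc_radialDefect_one,
      integral_Ioi_one_radialDefect hτ hβ]
  rw [areaCoef_eq_interpolation hτ.le hβ, h1, areaCoef_zero_left hτ hβ]
  ring

/-- At threshold zero only the association constraint remains, inside the unit disc. -/
lemma areaCoef_zero_right (hβ : 2 < β) : areaCoef p 0 β = p := by
  have h0 : areaCoef 0 0 β = 0 := by simp [areaCoef, radialDefect]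
  have h1 : areaCoef 1 0 β = 1 := by
    have h := integrableOn_mul_radialDefect (p := 1) zero_le_one le_rfl le_rfl hβ
    have h2 : ∫ y in Ioi (1 : ℝ), y * radialDefect 1 0 β y = 0 := by
      refine setIntegral_eq_zero_of_forall_eq_zero fun y (hy : 1 < y) => ?_
      simp [radialDefect, not_lt.2 hy.le]
    rw [areaCoef, ← Ioc_union_Ioi_eq_Ioi zero_le_one, setIntegral_union Ioc_disjoint_Ioi_same
      measurableSet_Ioi (h.mono_set Ioc_subset_Ioi_self)
      (h.mono_set (Ioi_subset_Ioi zero_le_one)), mul_add, integral_Ioc_radialDefect_one, h2,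
      mul_zero, add_zero]
  rw [areaCoef_eq_interpolation le_rfl hβ, h0, h1]
  ring

lemma areaCoef_pos (hp : 0 ≤ p) (hp1 : p ≤ 1) (hτ : 0 < τ) (hβ : 2 < β) : 0 < areaCoef p τ β := by
  have hpos : ∀ y : ℝ, 0 < y → 0 < radialDefect p τ β y := fun y hy => by
    have h1 := mul_pos hτ (Real.rpow_pos_of_pos hy (-β))
    have h2 : (1 + τ * y ^ (-β))⁻¹ < 1 := inv_lt_one_of_one_lt₀ (by linarith)
    have h3 : 0 < (1 + τ * y ^ (-β))⁻¹ := inv_pos.2 (by linarith)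
    rw [radialDefect]
    split_ifs
    · nlinarith
    · linarith
  refine mul_pos two_pos ?_
  rw [setIntegral_pos_iff_support_of_nonneg_ae
    ((ae_restrict_iff' measurableSet_Ioi).2 (ae_of_all _ fun y hy =>
      (mul_pos hy (hpos y hy)).le)) (integrableOn_mul_radialDefect hp hp1 hτ.le hβ)]
  have hsupp : Ioi 0 ⊆ Function.support fun y => y * radialDefect p τ β y := fun y hy =>
    (mul_pos hy (hpos y hy)).ne'
  rw [inter_eq_right.2 hsupp, Real.volume_Ioi]
  exact ENNReal.zero_lt_top

end

/-! ### The probability of service from an annulus -/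

namespace HetNet

variable {N M : ℕ} {Ω : Type*} [MeasurableSpace Ω] {P : Measure Ω} (𝓗 : HetNet N M P)
variable {i : Fin N} {j : Fin M} {θ r a b : ℝ}

lemma measurableSet_annulus (a b : ℝ) : MeasurableSet (annulus a b) :=
  (measurableSet_le measurable_const measurable_enorm).inter
    (measurableSet_lt measurable_enorm measurable_const)

lemma volume_annulus (ha : 0 ≤ a) (hab : a ≤ b) :
    volume (annulus a b) = ENNReal.ofReal (Real.pi * (b ^ 2 - a ^ 2)) := by
  have h1 : annulus a b = Metric.ball 0 b \ Metric.ball 0 a := by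
    ext x
    rw [annulus, mem_ofPred_eq, ← ofReal_norm, ENNReal.ofReal_le_ofReal_iff (norm_nonneg _),
      ENNReal.ofReal_lt_ofReal_iff_of_nonneg (norm_nonneg _), Set.mem_sdiff, mem_ball_zero_iff,
      mem_ball_zero_iff, not_lt, and_comm]
  rw [h1, measure_sdiff (Metric.ball_subset_ball hab) measurableSet_ball.nullMeasurableSet
    measure_ball_lt_top.ne, EuclideanSpace.volume_ball_fin_two, EuclideanSpace.volume_ball_fin_two,
    ← ENNReal.ofReal_pow (ha.trans hab), ← ENNReal.ofReal_pow ha,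
    ← ENNReal.ofReal_mul (by positivity), ← ENNReal.ofReal_mul (by positivity),
    ← ENNReal.ofReal_sub _ (by positivity)]
  congr 1
  ring

/-- The sum over the tiers of `λ_l (S_l / S_i)^(2/β)` times the area coefficient: the constraints on
the other base stations are met with probability `exp (-π * meanArea * r²)` when the serving base
station is at distance `r`. -/
def meanArea (i : Fin N) (j : Fin M) (θ : ℝ) : ℝ :=
  ∑ l, 𝓗.lam l * (𝓗.ratio i l ^ 2 * areaCoef (𝓗.p l j) θ 𝓗.β)

/-- The probability that a base station at distance `r` storing the file is preferred to all others
and that its transmission succeeds with threshold `θ`. -/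
def servedProb (i : Fin N) (j : Fin M) (θ r : ℝ) : ℝ :=
  Real.exp (-(θ * r ^ 𝓗.β / 𝓗.S i * 𝓗.σ ^ 2 + Real.pi * 𝓗.meanArea i j θ * r ^ 2))

lemma lam_pos (l : Fin N) : 0 < 𝓗.lam l := (𝓗.ppp l).lam_pos

/-- The probability of service from a distance less than `R`. -/
def servedMass (i : Fin N) (j : Fin M) (θ R : ℝ) : ℝ :=
  P.real (𝓗.served i j θ ∩ {ω | 𝓗.dist i j ω < ENNReal.ofReal R})

lemma meanArea_nonneg (hθ : 0 ≤ θ) : 0 ≤ 𝓗.meanArea i j θ :=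
  Finset.sum_nonneg fun l _ => mul_nonneg (𝓗.lam_pos l).le
    (mul_nonneg (sq_nonneg _) (areaCoef_nonneg (𝓗.p_nonneg l j) hθ))

variable [IsProbabilityMeasure P]

lemma expNeg_factor_empty (hθ : 0 ≤ θ) (hr : 0 ≤ r) :
    expNeg (𝓗.threshold i θ r * ENNReal.ofReal (𝓗.σ ^ 2) +
      ∑ l, ENNReal.ofReal (𝓗.lam l) * ∫⁻ x, (1 - 𝓗.factor i j θ r ∅ l x)) =
      ENNReal.ofReal (𝓗.servedProb i j θ r) := by
  have hS := 𝓗.S_pos i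
  have h1 : ∀ l, 0 ≤ 𝓗.lam l *
      (Real.pi * (𝓗.ratio i l * r) ^ 2 * areaCoef (𝓗.p l j) θ 𝓗.β) := fun l =>
    mul_nonneg (𝓗.lam_pos l).le (mul_nonneg (mul_nonneg Real.pi_pos.le (sq_nonneg _))
      (areaCoef_nonneg (𝓗.p_nonneg l j) hθ))
  have h2 : ∑ l, 𝓗.lam l * (Real.pi * (𝓗.ratio i l * r) ^ 2 * areaCoef (𝓗.p l j) θ 𝓗.β) =
      Real.pi * 𝓗.meanArea i j θ * r ^ 2 := by
    rw [meanArea, Finset.mul_sum, Finset.sum_mul]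
    refine Finset.sum_congr rfl fun l _ => ?_
    ring
  simp_rw [𝓗.lintegral_factor_empty hθ hr, ← ENNReal.ofReal_mul (𝓗.lam_pos _).le]
  rw [← ENNReal.ofReal_sum_of_nonneg fun l _ => h1 l, threshold,
    ← ENNReal.ofReal_mul (by positivity), ← ENNReal.ofReal_add (by positivity)
    (Finset.sum_nonneg fun l _ => h1 l), expNeg_ofReal (add_nonneg (by positivity)
    (Finset.sum_nonneg fun l _ => h1 l)), h2, servedProb]

/-- Ignoring the base stations of tier `i` in `B` costs at most the probability that `B` contains
none of them. -/
lemma expNeg_factor_le (hθ : 0 ≤ θ) (hr : 0 ≤ r) {B : Set Plane} (hB : MeasurableSet B) :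
    expNeg (𝓗.threshold i θ r * ENNReal.ofReal (𝓗.σ ^ 2) +
      ∑ l, ENNReal.ofReal (𝓗.lam l) * ∫⁻ x, (1 - 𝓗.factor i j θ r B l x)) *
        expNeg (ENNReal.ofReal (𝓗.lam i) * volume B) ≤
      ENNReal.ofReal (𝓗.servedProb i j θ r) := by
  classical
  rw [← 𝓗.expNeg_factor_empty hθ hr, ← expNeg_add, add_assoc]
  refine expNeg_antitone (add_le_add le_rfl ?_)
  have h1 : ENNReal.ofReal (𝓗.lam i) * volume B =
      ∑ l, ENNReal.ofReal (𝓗.lam l) * if l = i then volume B else 0 := by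
    simp
  rw [h1, ← Finset.sum_add_distrib]
  refine Finset.sum_le_sum fun l _ => ?_
  rw [← mul_add]
  gcongr
  refine (lintegral_mono fun x => 𝓗.one_sub_factor_empty_le l B x).trans ?_
  have hm : Measurable fun x => 1 - 𝓗.factor i j θ r B l x :=
    measurable_const.sub (𝓗.measurable_factor hB l)
  rw [lintegral_add_left hm]
  split_ifs
  · rw [lintegral_indicator_one hB]
  · simp

lemma le_expNeg_factor (hθ : 0 ≤ θ) (hr : 0 ≤ r) (B : Set Plane) :
    ENNReal.ofReal (𝓗.servedProb i j θ r) ≤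
    expNeg (𝓗.threshold i θ r * ENNReal.ofReal (𝓗.σ ^ 2) +
      ∑ l, ENNReal.ofReal (𝓗.lam l) * ∫⁻ x, (1 - 𝓗.factor i j θ r B l x)) := by
  rw [← 𝓗.expNeg_factor_empty hθ hr]
  refine expNeg_antitone (add_le_add le_rfl (Finset.sum_le_sum fun l _ => ?_))
  gcongr
  exact 𝓗.factor_empty_le l B _

lemma servedMass_sub (hab : a ≤ b) : 𝓗.servedMass i j θ b - 𝓗.servedMass i j θ a =
    P.real (𝓗.served i j θ ∩ {ω | ENNReal.ofReal a ≤ 𝓗.dist i j ω ∧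
      𝓗.dist i j ω < ENNReal.ofReal b}) := by
  have hm : MeasurableSet {ω | 𝓗.dist i j ω < ENNReal.ofReal a} :=
    measurableSet_lt (𝓗.measurable_dist i j) measurable_const
  rw [servedMass, servedMass, ← measureReal_inter_add_sdiff
    (s := 𝓗.served i j θ ∩ {ω | 𝓗.dist i j ω < ENNReal.ofReal b}) hm]
  have h1 : (𝓗.served i j θ ∩ {ω | 𝓗.dist i j ω < ENNReal.ofReal b}) ∩
      {ω | 𝓗.dist i j ω < ENNReal.ofReal a} =
      𝓗.served i j θ ∩ {ω | 𝓗.dist i j ω < ENNReal.ofReal a} := by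
    ext ω
    exact ⟨fun h => ⟨h.1.1, h.2⟩, fun h => ⟨⟨h.1, lt_of_lt_of_le h.2
      (ENNReal.ofReal_le_ofReal hab)⟩, h.2⟩⟩
  have h2 : (𝓗.served i j θ ∩ {ω | 𝓗.dist i j ω < ENNReal.ofReal b}) \
      {ω | 𝓗.dist i j ω < ENNReal.ofReal a} = 𝓗.served i j θ ∩ {ω | ENNReal.ofReal a ≤
        𝓗.dist i j ω ∧ 𝓗.dist i j ω < ENNReal.ofReal b} := by
    ext ω
    exact ⟨fun h => ⟨h.1.1, not_lt.1 h.2, h.1.2⟩, fun h => ⟨⟨h.1, h.2.2⟩, not_lt.2 h.2.1⟩⟩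
  rw [h1, h2, add_sub_cancel_left]

/-- Upper bound for the probability of service from an annulus, by the mean number of candidates. -/
lemma servedMass_sub_le (hθ : 0 ≤ θ) (ha : 0 ≤ a) (hab : a ≤ b) :
    𝓗.servedMass i j θ b - 𝓗.servedMass i j θ a ≤
      𝓗.lam i * (Real.pi * (b ^ 2 - a ^ 2)) * 𝓗.p i j * 𝓗.servedProb i j θ a *
        Real.exp (𝓗.lam i * (Real.pi * (b ^ 2 - a ^ 2))) := by
  have hA : 0 ≤ Real.pi * (b ^ 2 - a ^ 2) :=
    mul_nonneg Real.pi_pos.le (by nlinarith)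
  have hlam := 𝓗.lam_pos i
  have hp := 𝓗.p_nonneg i j
  have hB := measurableSet_annulus a b
  have hvol := volume_annulus ha hab
  have hv : volume (annulus a b) ≠ ∞ := by rw [hvol]; exact ENNReal.ofReal_ne_top
  set V := 𝓗.served i j θ ∩ {ω | ENNReal.ofReal a ≤ 𝓗.dist i j ω ∧
      𝓗.dist i j ω < ENNReal.ofReal b} with hV
  have h1 : P V ≤ ∑' k, P ({ω | pointCount (𝓗.X i) (annulus a b) ω ∈ (univ : Set ℕ∞)} ∩
      𝓗.candidate i j θ a (annulus a b) k) := by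
    refine le_trans (measure_mono_ae ?_) (measure_iUnion_le _)
    filter_upwards [𝓗.ae_dist_attained i j] with ω hat hω
    obtain ⟨k, hk⟩ := 𝓗.exists_candidate_of_served hθ ha hω.1 (hat hω.1.1.1) hω.2.1 hω.2.2
    exact mem_iUnion.2 ⟨k, mem_univ _, hk⟩
  rw [𝓗.tsum_measure_candidate hB hv] at h1
  simp only [indicator_univ] at h1
  rw [(𝓗.ppp i).lintegral_pointCount_id hB hv] at h1
  have h2 : P V * expNeg (ENNReal.ofReal (𝓗.lam i) * volume (annulus a b)) ≤
      ENNReal.ofReal (𝓗.lam i) * volume (annulus a b) * (ENNReal.ofReal (𝓗.p i j) *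
        ENNReal.ofReal (𝓗.servedProb i j θ a)) := by
    refine (mul_le_mul_left h1 _).trans ?_
    rw [mul_assoc, mul_assoc (ENNReal.ofReal (𝓗.p i j))]
    gcongr
    exact 𝓗.expNeg_factor_le hθ ha hB
  rw [hvol, ← ENNReal.ofReal_mul hlam.le, expNeg_ofReal (by positivity), ← ENNReal.ofReal_mul hp,
    ← ENNReal.ofReal_mul (by positivity), ← ofReal_measureReal (μ := P) (s := V),
    ← ENNReal.ofReal_mul measureReal_nonneg, ENNReal.ofReal_le_ofReal_iff (by
      have := Real.exp_pos (-(θ * a ^ 𝓗.β / 𝓗.S i * 𝓗.σ ^ 2 +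
        Real.pi * 𝓗.meanArea i j θ * a ^ 2))
      exact mul_nonneg (by positivity) (mul_nonneg hp this.le))] at h2
  rw [𝓗.servedMass_sub hab, ← hV]
  have h3 := mul_le_mul_of_nonneg_right h2
    (Real.exp_pos (𝓗.lam i * (Real.pi * (b ^ 2 - a ^ 2)))).le
  rw [mul_assoc, ← Real.exp_add, neg_add_cancel, Real.exp_zero, mul_one] at h3
  linarith

/-- Lower bound for the probability of service from an annulus, by the candidates that are alone
in the annulus. -/
lemma le_servedMass_sub (hθ : 0 ≤ θ) (ha : 0 ≤ a) (hab : a < b) :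
    𝓗.lam i * (Real.pi * (b ^ 2 - a ^ 2)) * 𝓗.p i j * 𝓗.servedProb i j θ b *
        Real.exp (-(𝓗.lam i * (Real.pi * (b ^ 2 - a ^ 2)))) ≤
      𝓗.servedMass i j θ b - 𝓗.servedMass i j θ a := by
  have hA : 0 ≤ Real.pi * (b ^ 2 - a ^ 2) :=
    mul_nonneg Real.pi_pos.le (by nlinarith)
  have hlam := 𝓗.lam_pos i
  have hp := 𝓗.p_nonneg i j
  have hb : 0 < b := by linarith
  have hB := measurableSet_annulus a b
  have hvol := volume_annulus ha hab.le
  have hv : volume (annulus a b) ≠ ∞ := by rw [hvol]; exact ENNReal.ofReal_ne_top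
  have hN := measurable_pointCount (𝓗.measurable_X i) hB
  set V := 𝓗.served i j θ ∩ {ω | ENNReal.ofReal a ≤ 𝓗.dist i j ω ∧
      𝓗.dist i j ω < ENNReal.ofReal b} with hV
  have hdisj : Pairwise (Function.onFun Disjoint fun k =>
      {ω | pointCount (𝓗.X i) (annulus a b) ω ∈ ({1} : Set ℕ∞)} ∩
        𝓗.candidate i j θ b (annulus a b) k) := by
    intro k m hkm
    refine disjoint_left.2 fun ω hk hm => hkm ?_
    obtain ⟨n, hn⟩ := encard_eq_one.1 (show {k | 𝓗.X i k ω ∈ annulus a b}.encard = 1 from hk.1)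
    have h1 : k ∈ ({n} : Set ℕ) := hn ▸ hk.2.1
    have h2 : m ∈ ({n} : Set ℕ) := hn ▸ hm.2.1
    rw [mem_singleton_iff] at h1 h2
    rw [h1, h2]
  have h1 : ∑' k, P ({ω | pointCount (𝓗.X i) (annulus a b) ω ∈ ({1} : Set ℕ∞)} ∩
      𝓗.candidate i j θ b (annulus a b) k) ≤ P V := by
    rw [← measure_iUnion hdisj fun k => (hN (measurableSet_singleton _)).inter
      (𝓗.measurableSet_candidate hB k)]
    refine measure_mono (iUnion_subset fun k ω hω => ?_)
    exact 𝓗.served_of_candidate hθ hb hω.1 hω.2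
  have hone : ∫⁻ ω, ({1} : Set ℕ∞).indicator (fun n => (n : ℝ≥0∞))
      (pointCount (𝓗.X i) (annulus a b) ω) ∂P =
      ENNReal.ofReal (𝓗.lam i * (Real.pi * (b ^ 2 - a ^ 2)) *
        Real.exp (-(𝓗.lam i * (Real.pi * (b ^ 2 - a ^ 2))))) := by
    rw [(𝓗.ppp i).lintegral_pointCount hB hv, tsum_eq_single 1]
    · have h0 : ((1 : ℕ) : ℕ∞) ∈ ({1} : Set ℕ∞) := by simp
      rw [indicator_of_mem h0, poissonMeasure_singleton, hvol]
      simp only [Nat.cast_one, ENat.toENNReal_one, one_mul, pow_one, Nat.factorial_one, div_one,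
        NNReal.coe_mul, Real.coe_toNNReal _ hlam.le, ENNReal.coe_toNNReal_eq_toReal,
        ENNReal.toReal_ofReal hA]
      rw [mul_comm]
    · intro n hn
      rw [indicator_of_notMem (by simpa using hn), zero_mul]
  rw [𝓗.tsum_measure_candidate hB hv, hone] at h1
  have h2 : ENNReal.ofReal (𝓗.lam i * (Real.pi * (b ^ 2 - a ^ 2)) *
        Real.exp (-(𝓗.lam i * (Real.pi * (b ^ 2 - a ^ 2))))) * (ENNReal.ofReal (𝓗.p i j) *
        ENNReal.ofReal (𝓗.servedProb i j θ b)) ≤ P V := by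
    refine le_trans ?_ h1
    gcongr
    exact 𝓗.le_expNeg_factor hθ hb.le _
  rw [← ENNReal.ofReal_mul hp, ← ENNReal.ofReal_mul (by positivity),
    ← ofReal_measureReal (μ := P) (s := V), ENNReal.ofReal_le_ofReal_iff measureReal_nonneg] at h2
  rw [𝓗.servedMass_sub hab.le, ← hV]
  linarith

end HetNet

/-! ### The density of the distance to the serving station -/

namespace HetNet

variable {N M : ℕ} {Ω : Type*} [MeasurableSpace Ω] {P : Measure Ω} (𝓗 : HetNet N M P)
variable {i : Fin N} {j : Fin M} {θ : ℝ}

lemma continuous_servedProb : Continuous (𝓗.servedProb i j θ) := by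
  unfold servedProb
  have : Continuous fun r : ℝ => r ^ 𝓗.β := Real.continuous_rpow_const 𝓗.β_pos.le
  fun_prop

lemma servedProb_le (hθ : 0 ≤ θ) {r : ℝ} (hr : 0 ≤ r) :
    𝓗.servedProb i j θ r ≤ Real.exp (-(Real.pi * 𝓗.meanArea i j θ) * r ^ 2) := by
  have hS := 𝓗.S_pos i
  have : 0 ≤ θ * r ^ 𝓗.β / 𝓗.S i * 𝓗.σ ^ 2 := by positivity
  rw [servedProb]
  exact Real.exp_le_exp.2 (by linarith)

lemma integrableOn_mul_servedProb (hθ : 0 ≤ θ) (hm : 0 < 𝓗.meanArea i j θ) :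
    IntegrableOn (fun r => r * 𝓗.servedProb i j θ r) (Ioi 0) := by
  refine Integrable.mono' (integrable_mul_exp_neg_mul_sq
    (mul_pos Real.pi_pos hm)).integrableOn
    (continuous_id.mul 𝓗.continuous_servedProb).aestronglyMeasurable
    ((ae_restrict_iff' measurableSet_Ioi).2 (ae_of_all _ fun r (hr : 0 < r) => ?_))
  have h0 : 0 ≤ 𝓗.servedProb i j θ r := (Real.exp_pos _).le
  rw [Real.norm_of_nonneg (mul_nonneg hr.le h0)]
  exact mul_le_mul_of_nonneg_left (𝓗.servedProb_le hθ hr.le) hr.le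

lemma servedMass_zero : 𝓗.servedMass i j θ 0 = 0 := by
  simp [servedMass]

lemma servedProb_le_one (hθ : 0 ≤ θ) {r : ℝ} (hr : 0 ≤ r) : 𝓗.servedProb i j θ r ≤ 1 := by
  refine (𝓗.servedProb_le hθ hr).trans (Real.exp_le_one_iff.2 ?_)
  have := mul_nonneg (mul_nonneg Real.pi_pos.le (𝓗.meanArea_nonneg (i := i) (j := j) hθ))
    (sq_nonneg r)
  linarith

variable [IsProbabilityMeasure P]

/-- The two bounds for annuli determine the right derivative of the mass. -/
lemma hasDerivWithinAt_servedMass (hθ : 0 ≤ θ) {a : ℝ} (ha : 0 ≤ a) :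
    HasDerivWithinAt (𝓗.servedMass i j θ)
      (2 * Real.pi * 𝓗.p i j * 𝓗.lam i * (a * 𝓗.servedProb i j θ a)) (Ioi a) a := by
  rw [hasDerivWithinAt_iff_tendsto_slope' (by simp)]
  have hcont := 𝓗.continuous_servedProb (i := i) (j := j) (θ := θ)
  have hlow : Tendsto (fun b => 𝓗.lam i * Real.pi * (b + a) * 𝓗.p i j * 𝓗.servedProb i j θ b *
      Real.exp (-(𝓗.lam i * (Real.pi * (b ^ 2 - a ^ 2))))) (𝓝[>] a)
      (𝓝 (2 * Real.pi * 𝓗.p i j * 𝓗.lam i * (a * 𝓗.servedProb i j θ a))) := by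
    refine (Continuous.tendsto' (by fun_prop) _ _ ?_).mono_left nhdsWithin_le_nhds
    simp
    ring
  have hupp : Tendsto (fun b => 𝓗.lam i * Real.pi * (b + a) * 𝓗.p i j * 𝓗.servedProb i j θ a *
      Real.exp (𝓗.lam i * (Real.pi * (b ^ 2 - a ^ 2)))) (𝓝[>] a)
      (𝓝 (2 * Real.pi * 𝓗.p i j * 𝓗.lam i * (a * 𝓗.servedProb i j θ a))) := by
    refine (Continuous.tendsto' (by fun_prop) _ _ ?_).mono_left nhdsWithin_le_nhds
    simp
    ring
  refine tendsto_of_tendsto_of_tendsto_of_le_of_le' hlow hupp ?_ ?_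
  · filter_upwards [self_mem_nhdsWithin] with b hb
    have hb' : 0 < b - a := sub_pos.2 hb
    rw [slope_def_field, le_div_iff₀ hb']
    have := 𝓗.le_servedMass_sub (i := i) (j := j) hθ ha hb
    linarith
  · filter_upwards [self_mem_nhdsWithin] with b hb
    have hb' : 0 < b - a := sub_pos.2 hb
    rw [slope_def_field, div_le_iff₀ hb']
    have := 𝓗.servedMass_sub_le (i := i) (j := j) hθ ha (le_of_lt hb)
    linarith

lemma continuousOn_servedMass (hθ : 0 ≤ θ) (R : ℝ) :
    ContinuousOn (𝓗.servedMass i j θ) (Icc 0 R) := by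
  have hlam := (𝓗.lam_pos i).le
  have hpi := Real.pi_pos.le
  let G : ℝ × ℝ → ℝ := fun q => 𝓗.lam i * (Real.pi * |q.2 ^ 2 - q.1 ^ 2|) *
    Real.exp (𝓗.lam i * (Real.pi * |q.2 ^ 2 - q.1 ^ 2|))
  have hG : ∀ a b, 0 ≤ a → a ≤ b →
      |𝓗.servedMass i j θ b - 𝓗.servedMass i j θ a| ≤ G (a, b) := by
    intro a b ha hab
    have h1 : 0 ≤ b ^ 2 - a ^ 2 := by nlinarith
    rw [abs_of_nonneg (by rw [𝓗.servedMass_sub hab]; exact measureReal_nonneg)]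
    refine (𝓗.servedMass_sub_le hθ ha hab).trans ?_
    simp only [G, abs_of_nonneg h1]
    refine mul_le_mul_of_nonneg_right ?_ (Real.exp_pos _).le
    have h2 : 𝓗.p i j * 𝓗.servedProb i j θ a ≤ 1 :=
      mul_le_one₀ (𝓗.p_le_one i j) (Real.exp_pos _).le (𝓗.servedProb_le_one hθ ha)
    rw [mul_assoc]
    exact mul_le_of_le_one_right (by positivity) h2
  intro a ha
  rw [ContinuousWithinAt, tendsto_iff_dist_tendsto_zero]
  have hlim : Tendsto (fun b => G (a, b)) (𝓝[Icc 0 R] a) (𝓝 0) := by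
    refine (Continuous.tendsto' (by fun_prop) _ _ ?_).mono_left nhdsWithin_le_nhds
    simp [G]
  refine squeeze_zero' (.of_forall fun _ => dist_nonneg) ?_ hlim
  filter_upwards [self_mem_nhdsWithin] with b hb
  rw [Real.dist_eq]
  rcases le_total a b with hab | hab
  · exact hG a b ha.1 hab
  · rw [abs_sub_comm]
    refine (hG b a hb.1 hab).trans_eq ?_
    simp only [G, abs_sub_comm]

lemma servedMass_eq_integral (hθ : 0 ≤ θ) {R : ℝ} (hR : 0 ≤ R) :
    𝓗.servedMass i j θ R =
      ∫ r in 0..R, 2 * Real.pi * 𝓗.p i j * 𝓗.lam i * (r * 𝓗.servedProb i j θ r) := by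
  rw [intervalIntegral.integral_eq_sub_of_hasDeriv_right (f := 𝓗.servedMass i j θ),
    servedMass_zero, sub_zero]
  · rw [uIcc_of_le hR]
    exact 𝓗.continuousOn_servedMass hθ R
  · intro r hr
    rw [min_eq_left hR] at hr
    exact 𝓗.hasDerivWithinAt_servedMass hθ hr.1.le
  · have := 𝓗.continuous_servedProb (i := i) (j := j) (θ := θ)
    exact Continuous.intervalIntegrable (by fun_prop) _ _

/-- The probability that the user is served: the distance to the serving station has the density
`r ↦ 2π p λ r * servedProb r`. -/
lemma measureReal_served (hθ : 0 ≤ θ) (hm : 0 < 𝓗.meanArea i j θ) :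
    P.real (𝓗.served i j θ) =
      2 * Real.pi * 𝓗.p i j * 𝓗.lam i * ∫ r in Ioi 0, r * 𝓗.servedProb i j θ r := by
  have h1 : Tendsto (fun n : ℕ => 𝓗.servedMass i j θ n) atTop
      (𝓝 (2 * Real.pi * 𝓗.p i j * 𝓗.lam i * ∫ r in Ioi 0, r * 𝓗.servedProb i j θ r)) := by
    rw [← integral_const_mul]
    refine Tendsto.congr (fun n => (𝓗.servedMass_eq_integral hθ n.cast_nonneg).symm) ?_
    exact intervalIntegral_tendsto_integral_Ioi 0
      ((𝓗.integrableOn_mul_servedProb hθ hm).const_mul _) tendsto_natCast_atTop_atTop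
  have h2 : 𝓗.served i j θ =
      ⋃ n : ℕ, 𝓗.served i j θ ∩ {ω | 𝓗.dist i j ω < ENNReal.ofReal n} := by
    rw [← inter_iUnion, eq_comm, inter_eq_left]
    intro ω hω
    obtain ⟨n, hn⟩ := ENNReal.exists_nat_gt (𝓗.dist_lt_top_of_assoc hω.1).ne
    exact mem_iUnion.2 ⟨n, by simpa using hn⟩
  have h3 : Tendsto (fun n : ℕ => 𝓗.servedMass i j θ n) atTop
      (𝓝 (P.real (𝓗.served i j θ))) := by
    have hmono : Monotone fun n : ℕ =>
        𝓗.served i j θ ∩ {ω | 𝓗.dist i j ω < ENNReal.ofReal n} := fun m n hmn ω hω =>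
      ⟨hω.1, lt_of_lt_of_le hω.2 (ENNReal.ofReal_le_ofReal (by exact_mod_cast hmn))⟩
    have := tendsto_measure_iUnion_atTop (μ := P) hmono
    rw [← h2] at this
    exact (ENNReal.tendsto_toReal (measure_ne_top _ _)).comp this
  exact tendsto_nhds_unique h3 h1

end HetNet

/-! ### Association and delivery probabilities -/

namespace HetNet

variable {N M : ℕ} {Ω : Type*} [MeasurableSpace Ω] {P : Measure Ω} (𝓗 : HetNet N M P)

lemma mul_servedProb_τ (i : Fin N) (j : Fin M) (r : ℝ) :
    r * 𝓗.servedProb i j 𝓗.τ r = 𝓗.integrand i j r := by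
  have h1 : 𝓗.meanArea i j 𝓗.τ = ∑ l, 𝓗.lam l * (𝓗.S l / 𝓗.S i) ^ (2 / 𝓗.β) *
      (𝓗.p l j * coefH 𝓗.τ 𝓗.β + (1 - 𝓗.p l j) * coefD 𝓗.τ 𝓗.β + 𝓗.p l j) :=
    Finset.sum_congr rfl fun l _ => by
      rw [ratio_sq, areaCoef_eq 𝓗.τ_pos 𝓗.two_lt_β, mul_assoc]
  rw [integrand, servedProb, ← h1, mul_assoc r, ← Real.exp_add]
  ring_nf

lemma sdp_eq_div (i : Fin N) (j : Fin M) :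
    𝓗.sdp i j = (𝓗.assocProb i j)⁻¹ * P.real (𝓗.assoc i j ∩ 𝓗.success i j) := by
  rw [sdp, integral_condExp_indicator (𝓗.measurable_dist i j) (𝓗.measurableSet_success i j),
    measureReal_def, cond_apply (𝓗.measurableSet_assoc i j), ENNReal.toReal_mul,
    ENNReal.toReal_inv]
  rfl

variable [IsProbabilityMeasure P]

lemma meanArea_pos (i : Fin N) (j : Fin M) : 0 < 𝓗.meanArea i j 𝓗.τ :=
  Finset.sum_pos (fun l _ => mul_pos (𝓗.lam_pos l) (mul_pos (pow_pos (𝓗.ratio_pos i l) 2)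
    (areaCoef_pos (𝓗.p_nonneg l j) (𝓗.p_le_one l j) 𝓗.τ_pos 𝓗.two_lt_β))) ⟨i, Finset.mem_univ i⟩

lemma integrableOn_integrand (i : Fin N) (j : Fin M) :
    IntegrableOn (𝓗.integrand i j) (Ioi 0) := by
  have := 𝓗.integrableOn_mul_servedProb (i := i) (j := j) 𝓗.τ_pos.le (𝓗.meanArea_pos i j)
  simpa only [mul_servedProb_τ] using this

lemma measureReal_assoc_inter_success (i : Fin N) (j : Fin M) :
    P.real (𝓗.assoc i j ∩ 𝓗.success i j) =
      2 * Real.pi * 𝓗.p i j * 𝓗.lam i * ∫ r in Ioi 0, 𝓗.integrand i j r := by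
  rw [← served_τ, 𝓗.measureReal_served 𝓗.τ_pos.le (𝓗.meanArea_pos i j)]
  simp only [mul_servedProb_τ]

lemma assocProb_eq_zero {i : Fin N} {j : Fin M} (hp : 𝓗.p i j = 0) : 𝓗.assocProb i j = 0 := by
  have h : P (⋃ k, {ω | j ∈ 𝓗.cache i k ω}) = 0 := measure_iUnion_null fun k => by
    rw [𝓗.measure_mem_cache j (i, k), hp, ENNReal.ofReal_zero]
  rw [assocProb, measureReal_def, measure_mono_null (fun ω hω => mem_iUnion.2 hω.1) h,
    ENNReal.toReal_zero]

lemma assocProb_eq (i : Fin N) (j : Fin M) :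
    𝓗.assocProb i j = 𝓗.lam i * 𝓗.p i j * 𝓗.S i ^ (2 / 𝓗.β) /
      ∑ l, 𝓗.lam l * 𝓗.p l j * 𝓗.S l ^ (2 / 𝓗.β) := by
  rcases (𝓗.p_nonneg i j).eq_or_lt with hp | hp
  · rw [𝓗.assocProb_eq_zero hp.symm, ← hp]
    simp
  have hSi := Real.rpow_pos_of_pos (𝓗.S_pos i) (2 / 𝓗.β)
  have hsum : 0 < ∑ l, 𝓗.lam l * 𝓗.p l j * 𝓗.S l ^ (2 / 𝓗.β) := by
    refine Finset.sum_pos' (fun l _ => mul_nonneg (mul_nonneg (𝓗.lam_pos l).le (𝓗.p_nonneg l j))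
      (Real.rpow_nonneg (𝓗.S_pos l).le _)) ⟨i, Finset.mem_univ i, ?_⟩
    exact mul_pos (mul_pos (𝓗.lam_pos i) hp) hSi
  have hK : 𝓗.meanArea i j 0 =
      (∑ l, 𝓗.lam l * 𝓗.p l j * 𝓗.S l ^ (2 / 𝓗.β)) / 𝓗.S i ^ (2 / 𝓗.β) := by
    rw [meanArea, Finset.sum_div]
    refine Finset.sum_congr rfl fun l _ => ?_
    rw [ratio_sq, areaCoef_zero_right 𝓗.two_lt_β,
      Real.div_rpow (𝓗.S_pos l).le (𝓗.S_pos i).le]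
    ring
  have hKpos : 0 < 𝓗.meanArea i j 0 := by
    rw [hK]
    exact div_pos hsum hSi
  have hint : ∫ r in Ioi 0, r * 𝓗.servedProb i j 0 r =
      (2 * (Real.pi * 𝓗.meanArea i j 0))⁻¹ := by
    have h := integral_rpow_mul_exp_neg_mul_rpow (p := 2) (q := 1) two_pos (by norm_num)
      (mul_pos Real.pi_pos hKpos)
    norm_num [Real.rpow_neg_one] at h
    have h' : ∀ r : ℝ, r * 𝓗.servedProb i j 0 r =
        r * Real.exp (-(Real.pi * 𝓗.meanArea i j 0 * r ^ 2)) := fun r => by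
      simp [servedProb]
    simp_rw [h', h, mul_inv]
    ring
  rw [assocProb, ← measureReal_congr (𝓗.served_zero_ae i j), 𝓗.measureReal_served le_rfl hKpos,
    hint, hK]
  have := Real.pi_pos
  field_simp

lemma assocProb_mul_sdp (i : Fin N) (j : Fin M) :
    𝓗.assocProb i j * 𝓗.sdp i j = P.real (𝓗.assoc i j ∩ 𝓗.success i j) := by
  rw [sdp_eq_div]
  rcases eq_or_ne (𝓗.assocProb i j) 0 with h | h
  · rw [h, zero_mul]
    exact (measureReal_mono_null inter_subset_left h).symm
  · rw [mul_inv_cancel_left₀ h]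

lemma averageSDP_eq : 𝓗.averageSDP =
    ∑ j, ∑ i, 𝓗.t j * P.real (𝓗.assoc i j ∩ 𝓗.success i j) := by
  simp only [averageSDP, mul_assoc, assocProb_mul_sdp]

/-- Delivery splits into disjoint events according to the request and the serving tier; the
request is independent of the network. -/
lemma measureReal_delivered : P.real 𝓗.delivered = 𝓗.averageSDP := by
  have hE : 𝓗.delivered = ⋃ a : Fin M × Fin N,
      {ω | 𝓗.req ω = a.1} ∩ 𝓗.served a.2 a.1 𝓗.τ := by
    ext ω
    simp only [mem_iUnion, served_τ]
    constructor
    · rintro ⟨i, h⟩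
      exact ⟨(𝓗.req ω, i), rfl, h⟩
    · rintro ⟨⟨j, i⟩, hj, h⟩
      obtain rfl : 𝓗.req ω = j := hj
      exact ⟨i, h⟩
  have hreq : ∀ j, MeasurableSet {ω | 𝓗.req ω = j} := fun j =>
    𝓗.measurable_req (measurableSet_singleton j)
  have hdisj : Pairwise (Function.onFun Disjoint fun a : Fin M × Fin N =>
      {ω | 𝓗.req ω = a.1} ∩ 𝓗.served a.2 a.1 𝓗.τ) := by
    rintro ⟨j, i⟩ ⟨j', i'⟩ hne
    refine disjoint_left.2 fun ω h h' => hne ?_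
    obtain rfl : 𝓗.req ω = j := h.1
    obtain rfl : 𝓗.req ω = j' := h'.1
    exact Prod.ext rfl (𝓗.assoc_unique h.2.1 h'.2.1)
  rw [hE, measureReal_iUnion_fintype hdisj
    fun a => (hreq a.1).inter (𝓗.measurableSet_served a.2 a.1 _), Fintype.sum_prod_type,
    averageSDP_eq]
  refine Finset.sum_congr rfl fun j _ => Finset.sum_congr rfl fun i _ => ?_
  have h := 𝓗.indepFun_req.measure_inter_preimage_eq_mul {j}
    (𝓗.confAssoc i j ∩ 𝓗.confSuccess i j 𝓗.τ) (measurableSet_singleton j)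
    ((𝓗.measurableSet_confAssoc i j).inter (𝓗.measurableSet_confSuccess i j _))
  rw [← served_eq_preimage] at h
  have h' : {ω | 𝓗.req ω = j} = 𝓗.req ⁻¹' {j} := rfl
  rw [measureReal_def, h', h, ENNReal.toReal_mul, ← h', ← measureReal_def, 𝓗.req_prob,
    ← measureReal_def, served_τ]

end HetNet

end

theorem proposition1 {N M : ℕ} {Ω : Type*} [MeasurableSpace Ω] (P : Measure Ω)
    [IsProbabilityMeasure P] (𝓗 : HetNet N M P) :
    -- association probabilities
    (∀ i j, 𝓗.assocProb i j = 𝓗.lam i * 𝓗.p i j * 𝓗.S i ^ (2 / 𝓗.β) /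
      ∑ l, 𝓗.lam l * 𝓗.p l j * 𝓗.S l ^ (2 / 𝓗.β)) ∧
    -- successful delivery probability of file `j` from tier `i`
    (∀ i j, IntegrableOn (𝓗.integrand i j) (Ioi 0) ∧
      𝓗.sdp i j = 2 * Real.pi * 𝓗.p i j * 𝓗.lam i / 𝓗.assocProb i j *
        ∫ r in Ioi 0, 𝓗.integrand i j r) ∧
    -- total successful delivery probability
    𝓗.averageSDP = ∑ j, ∑ i, 2 * Real.pi * 𝓗.p i j * 𝓗.t j * 𝓗.lam i *
      ∫ r in Ioi 0, 𝓗.integrand i j r ∧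
    P.real 𝓗.delivered = 𝓗.averageSDP := by
  refine ⟨𝓗.assocProb_eq, fun i j => ⟨𝓗.integrableOn_integrand i j, ?_⟩, ?_,
    𝓗.measureReal_delivered⟩
  · rw [𝓗.sdp_eq_div, 𝓗.measureReal_assoc_inter_success]
    ring
  · rw [𝓗.averageSDP_eq]
    refine Finset.sum_congr rfl fun j _ => Finset.sum_congr rfl fun i _ => ?_
    rw [𝓗.measureReal_assoc_inter_success]
    ring
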